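/- Let $p$ be an odd prime and $R=\mathbf{Z}_{(p)}$. Let $A=\bigoplus_{n\ge 0}A^n$ be a $\Gamma$-Hopf algebra over $R$ such that every $A^n$ is a free $R$-module of finite rank. That is: $A$ is a connected ($A^0=R$), graded commutative algebra with divided powers $\gamma^k:A^{2n}\to A^{2nk}$ ($k\ge 0$, $n\ge 1$) satisfying the usual axioms (a $\Gamma$-algebra), and also a graded Hopf algebra with augmentation $\varepsilon:A\to R$ and a coassociative counital diagonal $\Delta:A\to A\otimes A$ that is a morphism of graded algebras and commutes with divided powers. Here $A\otimes A$ has the product $(a\otimes b)(a'\otimes b')=(-1)^{\deg b\,\deg a'}aa'\otimes bb'$ and the divided powers for which $a\mapsto a\otimes 1$ and $b\mapsto 1\otimes b$ are $\Gamma$-morphisms. Let $A^\sharp=\bigoplus_n\operatorname{Hom}_R(A^n,R)$ be the dual graded Hopf algebra, and let $P(A^\sharp)=\{f\in A^\sharp : \Delta f=f\otimes 1+1\otimes f\}$, a graded Lie algebra under the graded commutator $[f,g]=fg-(-1)^{\deg f\,\deg g}gf$. (a) There is a graded submodule $X\subset \ker\varepsilon\subset A$ whose inclusion extends to an isomorphism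 of (graded) $\Gamma$-algebras $\Gamma(X)\xrightarrow{\cong}A$. Here $\Gamma(X)$ is the free $\Gamma$-algebra on $X$, i.e. the tensor product of the divided power algebra on $X^{\mathrm{even}}$ and the exterior algebra on $X^{\mathrm{odd}}$. (b) The inclusion $P(A^\sharp)\subset A^\sharp$ extends to an isomorphism of graded Hopf algebras $UP(A^\sharp)\xrightarrow{\cong}A^\sharp$. Here, for a graded Lie algebra $L$, the universal enveloping algebra $UL$ is the quotient of the tensor algebra of $L$ by the relations $xy-(-1)^{\deg x\,\deg y}yx=[x,y]$ for homogeneous $x,y\in L$, with the diagonal $x\mapsto x\otimes 1+1\otimes x$ for $x\in L$. -/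

import Mathlib

open scoped TensorProduct DirectSum

noncomputable section

namespace GammaHopf

/-! ### Graded modules -/

section Graded

variable {R : Type*} [CommRing R] {M : Type*} [AddCommGroup M] [Module R M]
variable (ℳ : ℕ → Submodule R M) [DirectSum.Decomposition ℳ]

/-- The projection of a graded module onto its component of degree `n`. -/
def proj (n : ℕ) : M →ₗ[R] M :=
  (ℳ n).subtype ∘ₗ DirectSum.component R ℕ (fun i => ℳ i) n ∘ₗ
    (DirectSum.decomposeLinearEquiv ℳ).toLinearMap

/-- The linear endomorphism of a graded module that multiplies elements of degree `n` by `c n`. -/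
def degScale (c : ℕ → R) : M →ₗ[R] M :=
  DirectSum.toModule R ℕ M (fun n => c n • (ℳ n).subtype) ∘ₗ
    (DirectSum.decomposeLinearEquiv ℳ).toLinearMap

variable {ℳ}

theorem proj_apply (n : ℕ) (x : M) : proj ℳ n x = (DirectSum.decompose ℳ x n : M) := rfl

theorem proj_mem (n : ℕ) (x : M) : proj ℳ n x ∈ ℳ n := by
  simp [proj]

theorem proj_same {n : ℕ} {x : M} (hx : x ∈ ℳ n) : proj ℳ n x = x := by
  rw [proj_apply, DirectSum.decompose_of_mem_same ℳ hx]

theorem proj_ne {n m : ℕ} {x : M} (hx : x ∈ ℳ m) (h : m ≠ n) : proj ℳ n x = 0 := by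
  rw [proj_apply, DirectSum.decompose_of_mem_ne ℳ hx h]

theorem degScale_of_mem (c : ℕ → R) {n : ℕ} {x : M} (hx : x ∈ ℳ n) :
    degScale ℳ c x = c n • x := by
  simp only [degScale, LinearMap.comp_apply, LinearEquiv.coe_coe,
    DirectSum.decomposeLinearEquiv_apply, DirectSum.decompose_of_mem ℳ hx]
  rw [← DirectSum.lof_eq_of R, DirectSum.toModule_lof]
  rfl

variable (ℳ) in
theorem hom_induction {motive : M → Prop} (x : M) (zero : motive 0)
    (hom : ∀ n, ∀ y ∈ ℳ n, motive y) (add : ∀ y z, motive y → motive z → motive (y + z)) :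
    motive x :=
  DirectSum.Decomposition.inductionOn ℳ zero (fun {i} m => hom i m m.2) add x

/-- Every element is the sum of its homogeneous components. -/
theorem exists_sum_proj (x : M) : ∃ N, ∀ K, N ≤ K → x = ∑ n ∈ Finset.range K, proj ℳ n x := by
  induction x using hom_induction ℳ with
  | zero => exact ⟨0, fun K _ => by simp⟩
  | hom n y hy =>
    refine ⟨n + 1, fun K hK => ?_⟩
    rw [Finset.sum_eq_single n, proj_same hy]
    · intro b _ hb
      exact proj_ne hy hb.symm
    · intro h
      exact absurd (Finset.mem_range.2 (by omega)) h
  | add y z hy hz =>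
    obtain ⟨N, hN⟩ := hy
    obtain ⟨N', hN'⟩ := hz
    refine ⟨max N N', fun K hK => ?_⟩
    simp only [map_add, Finset.sum_add_distrib]
    rw [← hN K (le_trans (le_max_left _ _) hK), ← hN' K (le_trans (le_max_right _ _) hK)]

variable (ℳ)

/-- The projection onto the part of odd degree. -/
def oddPart : M →ₗ[R] M := degScale ℳ (fun n => if Odd n then 1 else 0)

/-- The Koszul sign map `x ⊗ y ↦ (-1) ^ (deg x * deg y) x ⊗ y`; see `koszul_tmul`. -/
def koszul : M ⊗[R] M →ₗ[R] M ⊗[R] M :=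
  LinearMap.id - (2 : R) • TensorProduct.map (oddPart ℳ) (oddPart ℳ)

variable {ℳ}

theorem koszul_tmul {i j : ℕ} {x y : M} (hx : x ∈ ℳ i) (hy : y ∈ ℳ j) :
    koszul ℳ (x ⊗ₜ[R] y) = (-1 : R) ^ (i * j) • (x ⊗ₜ[R] y) := by
  simp only [koszul, oddPart, LinearMap.sub_apply, LinearMap.id_apply, LinearMap.smul_apply,
    TensorProduct.map_tmul, degScale_of_mem _ hx, degScale_of_mem _ hy]
  rcases Nat.even_or_odd i with hi | hi
  · have h1 : ¬ Odd i := by simpa using hi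
    simp [h1, (hi.mul_right j).neg_one_pow]
  · rcases Nat.even_or_odd j with hj | hj
    · have h1 : ¬ Odd j := by simpa using hj
      simp [h1, (hj.mul_left i).neg_one_pow]
    · simp only [hi, hj, if_true, (hi.mul hj).neg_one_pow, one_smul]
      module

variable (ℳ)

/-- The submodule of `M ⊗ M` of elements of total degree `n`. -/
def tensorGrading (n : ℕ) : Submodule R (M ⊗[R] M) :=
  Submodule.span R {t | ∃ i j, i + j = n ∧ ∃ x ∈ ℳ i, ∃ y ∈ ℳ j, t = x ⊗ₜ[R] y}

variable {ℳ}

theorem tensorGrading_induction {n : ℕ} {motive : M ⊗[R] M → Prop} {t : M ⊗[R] M}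
    (ht : t ∈ tensorGrading ℳ n) (zero : motive 0)
    (tmul : ∀ i j, i + j = n → ∀ x ∈ ℳ i, ∀ y ∈ ℳ j, motive (x ⊗ₜ[R] y))
    (add : ∀ s t, motive s → motive t → motive (s + t)) : motive t := by
  have key : ∀ t ∈ tensorGrading ℳ n, motive t := by
    intro t ht
    refine Submodule.closure_induction (p := fun t _ => motive t) zero
      (fun s t _ _ hs ht => add s t hs ht) ?_ ht
    rintro r _ ⟨i, j, h, x, hx, y, hy, rfl⟩
    rw [TensorProduct.smul_tmul']
    exact tmul i j h _ (Submodule.smul_mem _ r hx) y hy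
  exact key t ht

theorem tmul_mem_tensorGrading {i j : ℕ} {x y : M} (hx : x ∈ ℳ i) (hy : y ∈ ℳ j) :
    x ⊗ₜ[R] y ∈ tensorGrading ℳ (i + j) :=
  Submodule.subset_span ⟨i, j, rfl, x, hx, y, hy, rfl⟩

variable (ℳ) in
theorem tensor_hom_induction {motive : M ⊗[R] M → Prop} (t : M ⊗[R] M) (zero : motive 0)
    (tmul : ∀ i j, ∀ x ∈ ℳ i, ∀ y ∈ ℳ j, motive (x ⊗ₜ[R] y))
    (add : ∀ s t, motive s → motive t → motive (s + t)) : motive t := by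
  induction t using TensorProduct.induction_on with
  | zero => exact zero
  | add s t hs ht => exact add s t hs ht
  | tmul x y =>
    induction x using hom_induction ℳ with
    | zero => simpa using zero
    | add x x' h h' => rw [TensorProduct.add_tmul]; exact add _ _ h h'
    | hom i x hx =>
      induction y using hom_induction ℳ with
      | zero => simpa using zero
      | add x x' h h' => rw [TensorProduct.tmul_add]; exact add _ _ h h'
      | hom j y hy => exact tmul i j x hx y hy

end Graded

/-! ### Graded Hopf algebras -/

section Hopf

variable {R : Type*} [CommRing R] {A : Type*} [Ring A] [Algebra R A]
variable (𝒜 : ℕ → Submodule R A) [GradedAlgebra 𝒜]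

/-- A graded Hopf algebra, in the sense customary for graded objects in topology: a graded algebra
and graded coalgebra such that the counit (augmentation) and the diagonal
`A → A ⊗ A` are morphisms of graded algebras, where `A ⊗ A` is the graded tensor product, with
`(a ⊗ b) (a' ⊗ b') = (-1) ^ (deg b * deg a') a a' ⊗ b b'`. -/
class GradedHopfAlgebra [Coalgebra R A] : Prop where
  comul_mem : ∀ n, ∀ x ∈ 𝒜 n, Coalgebra.comul (R := R) x ∈ tensorGrading 𝒜 n
  counit_eq_zero : ∀ n, n ≠ 0 → ∀ x ∈ 𝒜 n, Coalgebra.counit (R := R) x = 0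
  counit_one : Coalgebra.counit (R := R) (1 : A) = 1
  counit_mul : ∀ x y : A, Coalgebra.counit (R := R) (x * y) =
    Coalgebra.counit (R := R) x * Coalgebra.counit (R := R) y
  comul_one : Coalgebra.comul (R := R) (1 : A) = 1 ⊗ₜ[R] 1
  comul_mul : ∀ x y : A,
    GradedTensorProduct.of R 𝒜 𝒜 (Coalgebra.comul (R := R) (x * y)) =
      GradedTensorProduct.of R 𝒜 𝒜 (Coalgebra.comul (R := R) x) *
        GradedTensorProduct.of R 𝒜 𝒜 (Coalgebra.comul (R := R) y)

/-- A graded algebra is connected if its component of degree `0` is the ground ring. -/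
def IsConnected : Prop :=
  Function.Injective (algebraMap R A) ∧ ∀ x ∈ 𝒜 0, ∃ r : R, x = algebraMap R A r

/-- Graded commutativity: `x y = (-1) ^ (deg x * deg y) y x`. -/
def IsGradedCommutative : Prop :=
  ∀ i j, ∀ x ∈ 𝒜 i, ∀ y ∈ 𝒜 j, x * y = (-1 : R) ^ (i * j) • (y * x)

/-- The graded commutator, `[x, y] = x y - (-1) ^ (deg x * deg y) y x`;
see `gradedCommutator_apply`. -/
def gradedCommutator : A →ₗ[R] A →ₗ[R] A :=
  TensorProduct.curry (LinearMap.mul' R A -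
    LinearMap.mul' R A ∘ₗ (TensorProduct.comm R A A).toLinearMap ∘ₗ koszul 𝒜)

variable {𝒜}

theorem gradedCommutator_apply {i j : ℕ} {x y : A} (hx : x ∈ 𝒜 i) (hy : y ∈ 𝒜 j) :
    gradedCommutator 𝒜 x y = x * y - (-1 : R) ^ (i * j) • (y * x) := by
  simp [gradedCommutator, koszul_tmul hx hy]

theorem gradedCommutator_mem {i j : ℕ} {x y : A} (hx : x ∈ 𝒜 i) (hy : y ∈ 𝒜 j) :
    gradedCommutator 𝒜 x y ∈ 𝒜 (i + j) := by
  rw [gradedCommutator_apply hx hy]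
  refine Submodule.sub_mem _ (SetLike.mul_mem_graded hx hy) (Submodule.smul_mem _ _ ?_)
  rw [add_comm]
  exact SetLike.mul_mem_graded hy hx

theorem units_smul_eq {N : Type*} [AddCommGroup N] [Module R N] (n : ℕ) (x : N) :
    ((-1 : ℤˣ) ^ n) • x = (-1 : R) ^ n • x := by
  rcases Nat.even_or_odd n with h | h <;> simp [h.neg_one_pow]

open GradedTensorProduct in
theorem of_tmul_mul_of_tmul {i j : ℕ} (a b : A) {a' b' : A} (hb : a' ∈ 𝒜 i) (ha : b' ∈ 𝒜 j) :
    of R 𝒜 𝒜 (a ⊗ₜ[R] a') * of R 𝒜 𝒜 (b' ⊗ₜ[R] b) =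
      (-1 : R) ^ (i * j) • of R 𝒜 𝒜 ((a * b') ⊗ₜ[R] (a' * b)) := by
  have := tmul_coe_mul_coe_tmul 𝒜 𝒜 a ⟨a', hb⟩ ⟨b', ha⟩ b
  rw [← units_smul_eq (R := R)]
  exact this

end Hopf
/-! ### Graded Lie algebras and their universal enveloping algebras -/

section Lie

variable {R : Type*} [CommRing R] {L : Type*} [AddCommGroup L] [Module R L]
variable (ℒ : ℕ → Submodule R L) [DirectSum.Decomposition ℒ]

/-- A (non-negatively) graded Lie algebra: a graded module with a bilinear bracket of degree `0`
satisfying graded anti-symmetry, the graded Jacobi identity, and `[x, [x, x]] = 0` for `x` of odd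
degree. -/
class GradedLieAlgebra where
  bracket : L →ₗ[R] L →ₗ[R] L
  bracket_mem : ∀ i j, ∀ x ∈ ℒ i, ∀ y ∈ ℒ j, bracket x y ∈ ℒ (i + j)
  antisymm : ∀ i j, ∀ x ∈ ℒ i, ∀ y ∈ ℒ j, bracket x y = -((-1 : R) ^ (i * j) • bracket y x)
  jacobi : ∀ i j k, ∀ x ∈ ℒ i, ∀ y ∈ ℒ j, ∀ z ∈ ℒ k,
    bracket x (bracket y z) =
      bracket (bracket x y) z + (-1 : R) ^ (i * j) • bracket y (bracket x z)
  odd : ∀ i, Odd i → ∀ x ∈ ℒ i, bracket x (bracket x x) = 0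

variable [GradedLieAlgebra ℒ]

/-- The relations `x y - (-1) ^ (deg x * deg y) y x = [x, y]`. -/
inductive UEA.Rel : TensorAlgebra R L → TensorAlgebra R L → Prop
  | bracket (i j : ℕ) (x y : L) (hx : x ∈ ℒ i) (hy : y ∈ ℒ j) :
      UEA.Rel (TensorAlgebra.ι R x * TensorAlgebra.ι R y -
          (-1 : R) ^ (i * j) • (TensorAlgebra.ι R y * TensorAlgebra.ι R x))
        (TensorAlgebra.ι R (GradedLieAlgebra.bracket ℒ x y))

/-- The universal enveloping algebra of a graded Lie algebra. -/
def UEA : Type _ := RingQuot (UEA.Rel ℒ)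

namespace UEA

instance : Ring (UEA ℒ) := inferInstanceAs (Ring (RingQuot (UEA.Rel ℒ)))

instance : Algebra R (UEA ℒ) := inferInstanceAs (Algebra R (RingQuot (UEA.Rel ℒ)))

/-- The canonical map `L → U L`. -/
def ι : L →ₗ[R] UEA ℒ :=
  (RingQuot.mkAlgHom R (UEA.Rel ℒ)).toLinearMap ∘ₗ TensorAlgebra.ι R

variable {ℒ}

theorem ι_bracket {i j : ℕ} {x y : L} (hx : x ∈ ℒ i) (hy : y ∈ ℒ j) :
    ι ℒ (GradedLieAlgebra.bracket ℒ x y) =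
      ι ℒ x * ι ℒ y - (-1 : R) ^ (i * j) • (ι ℒ y * ι ℒ x) := by
  have := RingQuot.mkAlgHom_rel R (UEA.Rel.bracket i j x y hx hy)
  rw [map_sub, map_smul, map_mul, map_mul] at this
  exact this.symm

variable {B : Type*} [Ring B] [Algebra R B]

/-- The universal property of `U L`. -/
def lift (f : L →ₗ[R] B) (hf : ∀ i j, ∀ x ∈ ℒ i, ∀ y ∈ ℒ j,
    f x * f y - (-1 : R) ^ (i * j) • (f y * f x) = f (GradedLieAlgebra.bracket ℒ x y)) :
    UEA ℒ →ₐ[R] B :=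
  RingQuot.liftAlgHom R ⟨TensorAlgebra.lift R f, by
    rintro _ _ ⟨i, j, x, y, hx, hy⟩
    simpa using hf i j x hx y hy⟩

theorem lift_ι (f : L →ₗ[R] B) (hf : ∀ i j, ∀ x ∈ ℒ i, ∀ y ∈ ℒ j,
    f x * f y - (-1 : R) ^ (i * j) • (f y * f x) = f (GradedLieAlgebra.bracket ℒ x y)) (x : L) :
    lift f hf (ι ℒ x) = f x := by
  have h : lift f hf (ι ℒ x) =
      RingQuot.liftAlgHom R ⟨TensorAlgebra.lift R f, by
        rintro _ _ ⟨i, j, x, y, hx, hy⟩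
        simpa using hf i j x hx y hy⟩
        (RingQuot.mkAlgHom R (UEA.Rel ℒ) (TensorAlgebra.ι R x)) := rfl
  rw [h, RingQuot.liftAlgHom_mkAlgHom_apply, TensorAlgebra.lift_ι_apply]

theorem algHom_ext {f g : UEA ℒ →ₐ[R] B} (h : ∀ x, f (ι ℒ x) = g (ι ℒ x)) : f = g := by
  apply RingQuot.ringQuot_ext'
  apply TensorAlgebra.hom_ext
  ext x
  exact h x

variable (ℒ)

/-- `IsMonomial n m`: `m` is a product `x₁ ⋯ xᵣ` of homogeneous elements of `L` whose degrees add
up to `n`. -/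
inductive IsMonomial : ℕ → UEA ℒ → Prop
  | one : IsMonomial 0 1
  | ι_mul (i n : ℕ) (x : L) (m : UEA ℒ) (hx : x ∈ ℒ i) (hm : IsMonomial n m) :
      IsMonomial (i + n) (ι ℒ x * m)

/-- The grading of `U L` induced by that of `L`. -/
def grading (n : ℕ) : Submodule R (UEA ℒ) := Submodule.span R {m | IsMonomial ℒ n m}

variable {ℒ}

theorem IsMonomial.mul {i j : ℕ} {a b : UEA ℒ} (ha : IsMonomial ℒ i a) (hb : IsMonomial ℒ j b) :
    IsMonomial ℒ (i + j) (a * b) := by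
  induction ha with
  | one => simpa using hb
  | ι_mul i n x m hx _ ih =>
    rw [add_assoc, mul_assoc]
    exact .ι_mul _ _ _ _ hx ih

theorem ι_mem {i : ℕ} {x : L} (hx : x ∈ ℒ i) : ι ℒ x ∈ grading ℒ i := by
  have := IsMonomial.ι_mul i 0 x 1 hx .one
  rw [mul_one] at this
  exact Submodule.subset_span this

instance : SetLike.GradedMonoid (grading ℒ) where
  one_mem := Submodule.subset_span .one
  mul_mem i j a b ha hb := by
    have h : grading ℒ i * grading ℒ j ≤ grading ℒ (i + j) := by
      rw [grading, grading, Submodule.span_mul_span]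
      refine Submodule.span_le.2 ?_
      rintro _ ⟨a, ha, b, hb, rfl⟩
      exact Submodule.subset_span (IsMonomial.mul ha hb)
    exact h (Submodule.mul_mem_mul ha hb)

/-- The canonical map from `L` to the direct sum of the graded pieces of `U L`. -/
def gradedι : L →ₗ[R] ⨁ n, grading ℒ n :=
  DirectSum.toModule R ℕ _ (fun n =>
    DirectSum.lof R ℕ (fun n => grading ℒ n) n ∘ₗ
      (ι ℒ).restrict (p := ℒ n) (q := grading ℒ n) (fun _ hx => ι_mem hx)) ∘ₗ
    (DirectSum.decomposeLinearEquiv ℒ).toLinearMap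

theorem gradedι_of_mem {i : ℕ} {x : L} (hx : x ∈ ℒ i) :
    gradedι x = DirectSum.of (fun n => grading ℒ n) i ⟨ι ℒ x, ι_mem hx⟩ := by
  simp only [gradedι, LinearMap.comp_apply, LinearEquiv.coe_coe,
    DirectSum.decomposeLinearEquiv_apply, DirectSum.decompose_of_mem ℒ hx]
  rw [← DirectSum.lof_eq_of R, DirectSum.toModule_lof]
  rfl

/-- The decomposition of `U L` into its homogeneous components, as an algebra morphism. -/
def gradedLift : UEA ℒ →ₐ[R] ⨁ n, grading ℒ n :=
  lift (B := ⨁ n, grading ℒ n) gradedι (by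
    intro i j x hx y hy
    have h : gradedι y * gradedι x =
        DirectSum.of (fun n => grading ℒ n) (i + j) ⟨ι ℒ y * ι ℒ x, by
          rw [add_comm]; exact SetLike.mul_mem_graded (ι_mem hy) (ι_mem hx)⟩ := by
      rw [gradedι_of_mem hx, gradedι_of_mem hy, DirectSum.of_mul_of]
      exact DirectSum.of_eq_of_gradedMonoid_eq (Sigma.subtype_ext (add_comm _ _) rfl)
    rw [h, gradedι_of_mem hx, gradedι_of_mem hy,
      gradedι_of_mem (GradedLieAlgebra.bracket_mem i j x hx y hy), DirectSum.of_mul_of]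
    have h2 : ∀ (n : ℕ) (a b : grading ℒ n) (c : R),
        DirectSum.of (fun n => grading ℒ n) n a - c • DirectSum.of (fun n => grading ℒ n) n b =
          DirectSum.of (fun n => grading ℒ n) n (a - c • b) := by
      intro n a b c
      simp only [← DirectSum.lof_eq_of R, map_sub, map_smul]
    refine (h2 _ _ _ _).trans (congrArg _ ?_)
    exact Subtype.ext (ι_bracket hx hy).symm)

instance : GradedAlgebra (grading ℒ) :=
  GradedAlgebra.ofAlgHom _ (gradedLift (ℒ := ℒ))
    (by
      apply algHom_ext
      intro x
      induction x using hom_induction ℒ with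
      | zero => simp
      | add y z hy hz => simp only [map_add, hy, hz]
      | hom n y hy =>
        rw [AlgHom.comp_apply, gradedLift, lift_ι, gradedι_of_mem hy, DirectSum.coeAlgHom_of]
        rfl)
    (by
      rintro n ⟨m, hm⟩
      induction hm using Submodule.span_induction with
      | zero => exact (map_zero _).trans (map_zero (DirectSum.of (fun n => grading ℒ n) n)).symm
      | add a b ha hb iha ihb =>
        rw [map_add, iha, ihb, ← map_add]
        rfl
      | smul r a ha iha =>
        rw [map_smul, iha, ← DirectSum.lof_eq_of R, ← map_smul]
        rfl
      | mem m hm =>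
        simp only
        induction hm with
        | one => rw [map_one]; rfl
        | ι_mul i n x m hx hm ih =>
          rw [map_mul, ih, gradedLift, lift_ι, gradedι_of_mem hx, DirectSum.of_mul_of]
          exact DirectSum.of_eq_of_gradedMonoid_eq (Sigma.subtype_ext rfl rfl))

/-! The Hopf algebra structure of `U L`, in which the elements of `L` are primitive. -/

theorem primitive_commutator {B : Type*} [Ring B] [Algebra R B] {ℬ : ℕ → Submodule R B}
    [GradedAlgebra ℬ] {i j : ℕ} {x y : B} (hx : x ∈ ℬ i) (hy : y ∈ ℬ j) :
    GradedTensorProduct.of R ℬ ℬ (x ⊗ₜ[R] 1 + 1 ⊗ₜ[R] x) *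
        GradedTensorProduct.of R ℬ ℬ (y ⊗ₜ[R] 1 + 1 ⊗ₜ[R] y) -
      (-1 : R) ^ (i * j) • (GradedTensorProduct.of R ℬ ℬ (y ⊗ₜ[R] 1 + 1 ⊗ₜ[R] y) *
        GradedTensorProduct.of R ℬ ℬ (x ⊗ₜ[R] 1 + 1 ⊗ₜ[R] x)) =
      GradedTensorProduct.of R ℬ ℬ
        ((x * y - (-1 : R) ^ (i * j) • (y * x)) ⊗ₜ[R] 1 +
          1 ⊗ₜ[R] (x * y - (-1 : R) ^ (i * j) • (y * x))) := by
  have h1 : (1 : B) ∈ ℬ 0 := SetLike.one_mem_graded ℬ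
  simp only [map_add, add_mul, mul_add, of_tmul_mul_of_tmul _ _ h1 h1, of_tmul_mul_of_tmul _ _ h1 hx,
    of_tmul_mul_of_tmul _ _ h1 hy, of_tmul_mul_of_tmul _ _ hx h1, of_tmul_mul_of_tmul _ _ hy h1,
    of_tmul_mul_of_tmul _ _ hx hy, of_tmul_mul_of_tmul _ _ hy hx, TensorProduct.sub_tmul,
    TensorProduct.tmul_sub, map_sub, one_mul, mul_one, zero_mul, mul_zero, pow_zero, one_smul,
    TensorProduct.tmul_smul, ← TensorProduct.smul_tmul', map_smul, mul_comm j i]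
  have hs : (-1 : R) ^ (i * j) * (-1 : R) ^ (i * j) = 1 := by
    rw [← mul_pow]; simp
  simp only [smul_add, smul_smul, hs, one_smul]
  abel

/-- The diagonal of `U L` as a morphism of graded algebras: `x ↦ x ⊗ 1 + 1 ⊗ x` for `x` in `L`. -/
def comulAlgHom : UEA ℒ →ₐ[R] (grading ℒ) ᵍ⊗[R] (grading ℒ) :=
  lift ((GradedTensorProduct.of R (grading ℒ) (grading ℒ)).toLinearMap ∘ₗ
      ((TensorProduct.mk R (UEA ℒ) (UEA ℒ)).flip 1 + TensorProduct.mk R (UEA ℒ) (UEA ℒ) 1) ∘ₗ ι ℒ)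
    (by
      intro i j x hx y hy
      simp only [LinearMap.comp_apply, LinearEquiv.coe_coe, LinearMap.add_apply,
        LinearMap.flip_apply, TensorProduct.mk_apply]
      rw [primitive_commutator (ι_mem hx) (ι_mem hy), ι_bracket hx hy])

/-- The augmentation of `U L`, which vanishes on `L`. -/
def counitAlgHom : UEA ℒ →ₐ[R] R :=
  lift 0 (by simp)

instance : CoalgebraStruct R (UEA ℒ) where
  comul := (GradedTensorProduct.of R (grading ℒ) (grading ℒ)).symm.toLinearMap ∘ₗ
    (comulAlgHom (ℒ := ℒ)).toLinearMap
  counit := (counitAlgHom (ℒ := ℒ)).toLinearMap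

theorem of_comul (u : UEA ℒ) :
    GradedTensorProduct.of R (grading ℒ) (grading ℒ) (Coalgebra.comul (R := R) u) =
      comulAlgHom u := rfl

theorem counit_eq (u : UEA ℒ) : Coalgebra.counit (R := R) u = counitAlgHom u := rfl

theorem comul_one : Coalgebra.comul (R := R) (1 : UEA ℒ) = 1 ⊗ₜ[R] 1 := by
  apply (GradedTensorProduct.of R (grading ℒ) (grading ℒ)).injective
  rw [of_comul, map_one]
  rfl

theorem comul_ι (x : L) :
    Coalgebra.comul (R := R) (ι ℒ x) = ι ℒ x ⊗ₜ[R] 1 + 1 ⊗ₜ[R] ι ℒ x := by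
  apply (GradedTensorProduct.of R (grading ℒ) (grading ℒ)).injective
  rw [of_comul, comulAlgHom, lift_ι]
  rfl

theorem counit_ι (x : L) : Coalgebra.counit (R := R) (ι ℒ x) = 0 := by
  rw [counit_eq, counitAlgHom, lift_ι]
  rfl

/-- Left multiplication by `x ⊗ 1 + 1 ⊗ x` on the graded tensor product, for `x` in `L` of
degree `i`, with the Koszul sign written out. -/
def leftPrim (i : ℕ) (x : L) : UEA ℒ ⊗[R] UEA ℒ →ₗ[R] UEA ℒ ⊗[R] UEA ℒ :=
  TensorProduct.map (LinearMap.mulLeft R (ι ℒ x)) LinearMap.id +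
    TensorProduct.map (degScale (grading ℒ) fun n => (-1 : R) ^ (i * n))
      (LinearMap.mulLeft R (ι ℒ x))

theorem comul_ι_mul {i : ℕ} {x : L} (hx : x ∈ ℒ i) (u : UEA ℒ) :
    Coalgebra.comul (R := R) (ι ℒ x * u) = leftPrim i x (Coalgebra.comul (R := R) u) := by
  apply (GradedTensorProduct.of R (grading ℒ) (grading ℒ)).injective
  rw [of_comul, map_mul, ← of_comul, ← of_comul, comul_ι]
  generalize Coalgebra.comul (R := R) u = t
  have h1 : (1 : UEA ℒ) ∈ grading ℒ 0 := SetLike.one_mem_graded _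
  induction t using tensor_hom_induction (grading ℒ) with
  | zero => simp
  | add s t hs ht => rw [LinearEquiv.map_add _ s t, mul_add, hs, ht, ← map_add, ← map_add]
  | tmul j k a ha b hb =>
    rw [map_add, add_mul, of_tmul_mul_of_tmul _ _ h1 ha, of_tmul_mul_of_tmul _ _ (ι_mem hx) ha,
      leftPrim, LinearMap.add_apply, TensorProduct.map_tmul, TensorProduct.map_tmul,
      degScale_of_mem _ ha, map_add, zero_mul, pow_zero, one_smul, one_mul, one_mul,
      ← TensorProduct.smul_tmul', map_smul]
    rfl

theorem induction {motive : UEA ℒ → Prop} (u : UEA ℒ) (one : motive 1)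
    (ι_mul : ∀ i, ∀ x ∈ ℒ i, ∀ u, motive u → motive (ι ℒ x * u))
    (add : ∀ u v, motive u → motive v → motive (u + v))
    (smul : ∀ (r : R) u, motive u → motive (r • u)) : motive u := by
  induction u using hom_induction (grading ℒ) with
  | zero => simpa using smul 0 1 one
  | add y z hy hz => exact add _ _ hy hz
  | hom n y hy =>
    induction hy using Submodule.span_induction with
    | zero => simpa using smul 0 1 one
    | add a b _ _ iha ihb => exact add _ _ iha ihb
    | smul r a _ iha => exact smul _ _ iha
    | mem m hm =>
      induction hm with
      | one => exact one
      | ι_mul i n x m hx hm ih => exact ι_mul i x hx m ih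

theorem comul_mem (n : ℕ) (u : UEA ℒ) (hu : u ∈ grading ℒ n) :
    Coalgebra.comul (R := R) u ∈ tensorGrading (grading ℒ) n := by
  induction hu using Submodule.span_induction with
  | zero => simp
  | add a b _ _ iha ihb => rw [map_add]; exact Submodule.add_mem _ iha ihb
  | smul r a _ iha => rw [map_smul]; exact Submodule.smul_mem _ _ iha
  | mem m hm =>
    induction hm with
    | one =>
      rw [comul_one]
      have h1 : (1 : UEA ℒ) ∈ grading ℒ 0 := SetLike.one_mem_graded _
      have h := tmul_mem_tensorGrading h1 h1
      rwa [add_zero] at h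
    | ι_mul i n x m hx hm ih =>
      rw [comul_ι_mul hx]
      refine tensorGrading_induction
        (motive := fun t => leftPrim i x t ∈ tensorGrading (grading ℒ) (i + n)) ih
        (by simp) ?_ (fun s t hs ht => by rw [map_add]; exact Submodule.add_mem _ hs ht)
      · rintro j k rfl a ha b hb
        simp only [leftPrim, LinearMap.add_apply, TensorProduct.map_tmul, degScale_of_mem _ ha,
          LinearMap.mulLeft_apply, LinearMap.id_apply]
        refine Submodule.add_mem _ ?_ ?_
        · rw [← add_assoc]
          exact tmul_mem_tensorGrading (SetLike.mul_mem_graded (ι_mem hx) ha) hb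
        · rw [add_left_comm]
          exact tmul_mem_tensorGrading (Submodule.smul_mem _ _ ha)
            (SetLike.mul_mem_graded (ι_mem hx) hb)

theorem counit_eq_zero (n : ℕ) (hn : n ≠ 0) (u : UEA ℒ) (hu : u ∈ grading ℒ n) :
    Coalgebra.counit (R := R) u = 0 := by
  have h : ∀ m : UEA ℒ, ∀ k, IsMonomial ℒ k m → k ≠ 0 → Coalgebra.counit (R := R) m = 0 := by
    intro m k hm hk
    cases hm with
    | one => exact absurd rfl hk
    | ι_mul i n x m hx hm => rw [counit_eq, map_mul, ← counit_eq, counit_ι, zero_mul]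
  induction hu using Submodule.span_induction with
  | zero => simp
  | add a b _ _ iha ihb => rw [map_add, iha, ihb, add_zero]
  | smul r a _ iha => rw [map_smul, iha, smul_zero]
  | mem m hm => exact h m n hm hn

theorem comul_degScale (i : ℕ) (u : UEA ℒ) :
    Coalgebra.comul (R := R) (degScale (grading ℒ) (fun n => (-1 : R) ^ (i * n)) u) =
      TensorProduct.map (degScale (grading ℒ) fun n => (-1 : R) ^ (i * n))
        (degScale (grading ℒ) fun n => (-1 : R) ^ (i * n)) (Coalgebra.comul (R := R) u) := by
  induction u using hom_induction (grading ℒ) with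
  | zero => simp
  | add y z hy hz => simp only [map_add, hy, hz]
  | hom n y hy =>
    rw [degScale_of_mem _ hy, map_smul]
    refine tensorGrading_induction (motive := fun t => (-1 : R) ^ (i * n) • t =
      TensorProduct.map (degScale (grading ℒ) fun n => (-1 : R) ^ (i * n))
        (degScale (grading ℒ) fun n => (-1 : R) ^ (i * n)) t) (comul_mem n y hy)
      (by simp) ?_ (fun s t hs ht => by simp only [map_add, smul_add, hs, ht])
    · rintro j k rfl a ha b hb
      rw [TensorProduct.map_tmul, degScale_of_mem _ ha, degScale_of_mem _ hb,
        TensorProduct.smul_tmul_smul, mul_add, pow_add]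

/-- The analogue of `leftPrim` on the threefold tensor product. -/
def leftPrimThree (i : ℕ) (x : L) :
    UEA ℒ ⊗[R] (UEA ℒ ⊗[R] UEA ℒ) →ₗ[R] UEA ℒ ⊗[R] (UEA ℒ ⊗[R] UEA ℒ) :=
  TensorProduct.map (LinearMap.mulLeft R (ι ℒ x)) LinearMap.id +
    TensorProduct.map (degScale (grading ℒ) fun n => (-1 : R) ^ (i * n)) (leftPrim i x)

instance : Coalgebra R (UEA ℒ) where
  coassoc := by
    ext u
    simp only [LinearMap.comp_apply, LinearEquiv.coe_coe]
    induction u using induction with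
    | one => simp [comul_one]
    | add u v hu hv => simp only [map_add, hu, hv]
    | smul r u hu => simp only [map_smul, hu]
    | ι_mul i x hx u hu =>
      have h1 : ∀ t : UEA ℒ ⊗[R] UEA ℒ,
          LinearMap.lTensor (UEA ℒ) (Coalgebra.comul (R := R)) (leftPrim i x t) =
            leftPrimThree i x (LinearMap.lTensor (UEA ℒ) (Coalgebra.comul (R := R)) t) := by
        intro t
        induction t using TensorProduct.induction_on with
        | zero => simp
        | add s t hs ht => simp only [map_add, hs, ht]
        | tmul a b => simp [leftPrim, leftPrimThree, comul_ι_mul hx]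
      have h2 : ∀ t : UEA ℒ ⊗[R] UEA ℒ,
          TensorProduct.assoc R _ _ _
              (LinearMap.rTensor (UEA ℒ) (Coalgebra.comul (R := R)) (leftPrim i x t)) =
            leftPrimThree i x (TensorProduct.assoc R _ _ _
              (LinearMap.rTensor (UEA ℒ) (Coalgebra.comul (R := R)) t)) := by
        intro t
        induction t using TensorProduct.induction_on with
        | zero => simp
        | add s t hs ht => simp only [map_add, hs, ht]
        | tmul a b =>
          simp only [leftPrim, LinearMap.add_apply, TensorProduct.map_tmul,
            LinearMap.mulLeft_apply, LinearMap.id_apply, map_add, LinearMap.rTensor_tmul,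
            comul_ι_mul hx, comul_degScale]
          generalize Coalgebra.comul (R := R) a = w
          induction w using TensorProduct.induction_on with
          | zero => simp
          | add s t hs ht =>
            simp only [map_add, TensorProduct.add_tmul] at hs ht ⊢
            rw [← hs, ← ht]
            abel
          | tmul c d =>
            simp [leftPrimThree, leftPrim, TensorProduct.add_tmul, TensorProduct.tmul_add,
              add_assoc]
      rw [comul_ι_mul hx, h1, h2, hu]
  rTensor_counit_comp_comul := by
    ext u
    simp only [LinearMap.comp_apply, TensorProduct.mk_apply]
    induction u using induction with
    | one => simp [comul_one, counit_eq]
    | add u v hu hv => simp only [map_add, hu, hv, TensorProduct.tmul_add]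
    | smul r u hu => simp only [map_smul, hu, TensorProduct.tmul_smul]
    | ι_mul i x hx u hu =>
      have hι : ∀ b : UEA ℒ, Coalgebra.counit (R := R) (ι ℒ x * b) = 0 := by
        intro b
        rw [counit_eq, map_mul, ← counit_eq, counit_ι, zero_mul]
      have h : ∀ t : UEA ℒ ⊗[R] UEA ℒ,
          LinearMap.rTensor (UEA ℒ) (Coalgebra.counit (R := R)) (leftPrim i x t) =
            LinearMap.lTensor R (LinearMap.mulLeft R (ι ℒ x))
              (LinearMap.rTensor (UEA ℒ) (Coalgebra.counit (R := R)) t) := by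
        intro t
        induction t using tensor_hom_induction (grading ℒ) with
        | zero => simp
        | add s t hs ht => simp only [map_add, hs, ht]
        | tmul j k a ha b hb =>
          rcases eq_or_ne j 0 with rfl | hj
          · simp [leftPrim, degScale_of_mem _ ha, hι]
          · simp [leftPrim, degScale_of_mem _ ha, counit_eq_zero j hj a ha, hι]
      rw [comul_ι_mul hx, h, hu]
      simp
  lTensor_counit_comp_comul := by
    ext u
    simp only [LinearMap.comp_apply, LinearMap.flip_apply, TensorProduct.mk_apply]
    induction u using induction with
    | one => simp [comul_one, counit_eq]
    | add u v hu hv => simp only [map_add, hu, hv, TensorProduct.add_tmul]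
    | smul r u hu => simp only [map_smul, hu, TensorProduct.smul_tmul']
    | ι_mul i x hx u hu =>
      have h : ∀ t : UEA ℒ ⊗[R] UEA ℒ,
          LinearMap.lTensor (UEA ℒ) (Coalgebra.counit (R := R)) (leftPrim i x t) =
            LinearMap.rTensor R (LinearMap.mulLeft R (ι ℒ x))
              (LinearMap.lTensor (UEA ℒ) (Coalgebra.counit (R := R)) t) := by
        intro t
        induction t using TensorProduct.induction_on with
        | zero => simp
        | add s t hs ht => simp only [map_add, hs, ht]
        | tmul a b =>
          have : Coalgebra.counit (R := R) (ι ℒ x * b) = 0 := by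
            rw [counit_eq, map_mul, ← counit_eq, counit_ι, zero_mul]
          simp [leftPrim, this]
      rw [comul_ι_mul hx, h, hu]
      simp

end UEA

end Lie
instance UEA.instGradedHopfAlgebra {R : Type*} [CommRing R] {L : Type*} [AddCommGroup L]
    [Module R L] (ℒ : ℕ → Submodule R L) [DirectSum.Decomposition ℒ] [GradedLieAlgebra ℒ] :
    GradedHopfAlgebra (UEA.grading ℒ) where
  comul_mem := UEA.comul_mem
  counit_eq_zero := UEA.counit_eq_zero
  counit_one := by rw [UEA.counit_eq, map_one]
  counit_mul x y := by rw [UEA.counit_eq, map_mul]; rfl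
  comul_one := UEA.comul_one
  comul_mul x y := by rw [UEA.of_comul, map_mul]; rfl

section DecompositionCriterion

variable {R : Type*} [CommRing R] {M : Type*} [AddCommGroup M] [Module R M]

theorem isInternal_of_proj (ℳ : ℕ → Submodule R M) (π : ℕ → M →ₗ[R] M)
    (hmem : ∀ n x, π n x ∈ ℳ n) (hsame : ∀ n, ∀ x ∈ ℳ n, π n x = x)
    (hne : ∀ m n, m ≠ n → ∀ x ∈ ℳ m, π n x = 0)
    (hsum : ∀ x, ∃ K, x = ∑ n ∈ Finset.range K, π n x) : DirectSum.IsInternal ℳ := by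
  have key : ∀ (n : ℕ) (z : ⨁ i, ℳ i),
      π n (DirectSum.coeAddMonoidHom ℳ z) = (z n : M) := by
    intro n z
    induction z using DirectSum.induction_on with
    | zero => simp
    | add x y hx hy => rw [map_add, map_add, hx, hy]; rfl
    | of i x =>
      rw [DirectSum.coeAddMonoidHom_of]
      rcases eq_or_ne i n with rfl | h
      · rw [DirectSum.of_eq_same, hsame _ _ x.2]
      · rw [DirectSum.of_eq_of_ne _ _ _ h.symm, hne _ _ h _ x.2]
        rfl
  constructor
  · rw [injective_iff_map_eq_zero]
    intro z hz
    ext n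
    rw [← key, hz, map_zero]
    rfl
  · intro x
    obtain ⟨K, hK⟩ := hsum x
    refine ⟨∑ n ∈ Finset.range K, DirectSum.of (fun i => ℳ i) n ⟨π n x, hmem n x⟩, ?_⟩
    rw [map_sum]
    simp only [DirectSum.coeAddMonoidHom_of]
    exact hK.symm

end DecompositionCriterion

/-! ### The graded Lie algebra of primitive elements -/

section Primitives

variable (R : Type*) [CommRing R] (A : Type*) [Ring A] [Algebra R A] [Coalgebra R A]

/-- The submodule of primitive elements, those with `Δ x = x ⊗ 1 + 1 ⊗ x`. -/
def primitives : Submodule R A where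
  carrier := {x | Coalgebra.comul (R := R) x = x ⊗ₜ[R] 1 + 1 ⊗ₜ[R] x}
  zero_mem' := by simp
  add_mem' {x y} hx hy := by
    simp only [Set.mem_ofPred_eq] at hx hy ⊢
    rw [map_add, hx, hy, TensorProduct.add_tmul, TensorProduct.tmul_add]
    abel
  smul_mem' r x hx := by
    simp only [Set.mem_ofPred_eq] at hx ⊢
    rw [map_smul, hx, smul_add, TensorProduct.smul_tmul', TensorProduct.tmul_smul]

variable {R A}

theorem mem_primitives {x : A} : x ∈ primitives R A ↔
    Coalgebra.comul (R := R) x = x ⊗ₜ[R] 1 + 1 ⊗ₜ[R] x := Iff.rfl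

variable (𝒜 : ℕ → Submodule R A)

/-- The grading of the primitive elements. -/
def primGrading (n : ℕ) : Submodule R (primitives R A) := (𝒜 n).comap (primitives R A).subtype

variable [GradedAlgebra 𝒜]

/-- The projection of `A ⊗ A` onto its component of total degree `n`. -/
def totalProj (n : ℕ) : A ⊗[R] A →ₗ[R] A ⊗[R] A :=
  ∑ p ∈ Finset.HasAntidiagonal.antidiagonal n, TensorProduct.map (proj 𝒜 p.1) (proj 𝒜 p.2)

variable {𝒜}

theorem totalProj_tmul {i j : ℕ} {x y : A} (hx : x ∈ 𝒜 i) (hy : y ∈ 𝒜 j) (n : ℕ) :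
    totalProj 𝒜 n (x ⊗ₜ[R] y) = if i + j = n then x ⊗ₜ[R] y else 0 := by
  simp only [totalProj, LinearMap.sum_apply, TensorProduct.map_tmul]
  split_ifs with h
  · rw [Finset.sum_eq_single (i, j)]
    · rw [proj_same hx, proj_same hy]
    · rintro ⟨a, b⟩ _ hne
      by_cases ha : i = a
      · have hb : j ≠ b := fun hb => hne (by rw [ha, hb])
        rw [proj_ne hy hb, TensorProduct.tmul_zero]
      · rw [proj_ne hx ha, TensorProduct.zero_tmul]
    · intro hn
      exact absurd (Finset.HasAntidiagonal.mem_antidiagonal.2 h) hn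
  · refine Finset.sum_eq_zero ?_
    rintro ⟨a, b⟩ hab
    by_cases ha : i = a
    · have hb : j ≠ b := by
        rintro rfl
        exact h (by rw [ha]; exact Finset.HasAntidiagonal.mem_antidiagonal.1 hab)
      rw [proj_ne hy hb, TensorProduct.tmul_zero]
    · rw [proj_ne hx ha, TensorProduct.zero_tmul]

theorem totalProj_tmul_one (x : A) (n : ℕ) :
    totalProj 𝒜 n (x ⊗ₜ[R] 1) = proj 𝒜 n x ⊗ₜ[R] 1 := by
  induction x using hom_induction 𝒜 with
  | zero => simp
  | add y z hy hz => simp only [TensorProduct.add_tmul, map_add, hy, hz]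
  | hom m y hy =>
    rw [totalProj_tmul hy (SetLike.one_mem_graded 𝒜), add_zero]
    split_ifs with h
    · rw [← h, proj_same hy]
    · rw [proj_ne hy h, TensorProduct.zero_tmul]

theorem totalProj_one_tmul (x : A) (n : ℕ) :
    totalProj 𝒜 n (1 ⊗ₜ[R] x) = 1 ⊗ₜ[R] proj 𝒜 n x := by
  induction x using hom_induction 𝒜 with
  | zero => simp
  | add y z hy hz => simp only [TensorProduct.tmul_add, map_add, hy, hz]
  | hom m y hy =>
    rw [totalProj_tmul (SetLike.one_mem_graded 𝒜) hy, zero_add]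
    split_ifs with h
    · rw [← h, proj_same hy]
    · rw [proj_ne hy h, TensorProduct.tmul_zero]

variable [GradedHopfAlgebra 𝒜]

theorem comul_proj (x : A) (n : ℕ) :
    Coalgebra.comul (R := R) (proj 𝒜 n x) = totalProj 𝒜 n (Coalgebra.comul (R := R) x) := by
  induction x using hom_induction 𝒜 with
  | zero => simp
  | add y z hy hz => simp only [map_add, hy, hz]
  | hom m y hy =>
    have h : totalProj 𝒜 n (Coalgebra.comul (R := R) y) =
        if m = n then Coalgebra.comul (R := R) y else 0 := by
      refine tensorGrading_induction (motive := fun t => totalProj 𝒜 n t = if m = n then t else 0)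
        (GradedHopfAlgebra.comul_mem m y hy) (by simp) ?_ ?_
      · rintro i j rfl a ha b hb
        exact totalProj_tmul ha hb n
      · intro s t hs ht
        rw [map_add, hs, ht]
        split_ifs <;> simp
    rw [h]
    split_ifs with hmn
    · rw [← hmn, proj_same hy]
    · rw [proj_ne hy hmn, map_zero]

theorem proj_mem_primitives (n : ℕ) {x : A} (hx : x ∈ primitives R A) :
    proj 𝒜 n x ∈ primitives R A := by
  rw [mem_primitives] at hx ⊢
  rw [comul_proj, hx, map_add, totalProj_tmul_one, totalProj_one_tmul]

variable (𝒜) in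
theorem primGrading_isInternal : DirectSum.IsInternal (primGrading 𝒜) := by
  refine isInternal_of_proj (primGrading 𝒜)
    (fun n => (proj 𝒜 n).restrict (fun _ hx => proj_mem_primitives n hx)) ?_ ?_ ?_ ?_
  · intro n x
    exact proj_mem n (x : A)
  · intro n x hx
    exact Subtype.ext (proj_same hx)
  · intro m n h x hx
    exact Subtype.ext (proj_ne hx h)
  · intro x
    obtain ⟨N, hN⟩ := exists_sum_proj (ℳ := 𝒜) (x : A)
    refine ⟨N, Subtype.ext ?_⟩
    rw [AddSubmonoidClass.coe_finsetSum]
    exact hN N le_rfl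

instance : DirectSum.Decomposition (primGrading 𝒜) :=
  (primGrading_isInternal 𝒜).chooseDecomposition

theorem gradedCommutator_mem_primitives (x y : primitives R A) :
    gradedCommutator 𝒜 (x : A) (y : A) ∈ primitives R A := by
  induction x using hom_induction (primGrading 𝒜) with
  | zero => simp
  | add x x' h h' => simpa using Submodule.add_mem _ h h'
  | hom i x hx =>
    induction y using hom_induction (primGrading 𝒜) with
    | zero => simp
    | add y y' h h' => simpa using Submodule.add_mem _ h h'
    | hom j y hy =>
      have hx' : (x : A) ∈ 𝒜 i := hx
      have hy' : (y : A) ∈ 𝒜 j := hy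
      rw [gradedCommutator_apply hx' hy', mem_primitives]
      apply (GradedTensorProduct.of R 𝒜 𝒜).injective
      rw [← UEA.primitive_commutator hx' hy', ← mem_primitives.1 x.2, ← mem_primitives.1 y.2,
        map_sub, map_smul, map_sub, map_smul, GradedHopfAlgebra.comul_mul,
        GradedHopfAlgebra.comul_mul]

variable (𝒜) in
/-- The primitive elements of a graded Hopf algebra form a graded Lie algebra under the graded
commutator. -/
instance primitivesLie : GradedLieAlgebra (primGrading 𝒜) where
  bracket := LinearMap.mk₂ R
    (fun x y => ⟨gradedCommutator 𝒜 (x : A) (y : A), gradedCommutator_mem_primitives x y⟩)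
    (fun _ _ _ => Subtype.ext (by simp)) (fun _ _ _ => Subtype.ext (by simp))
    (fun _ _ _ => Subtype.ext (by simp)) (fun _ _ _ => Subtype.ext (by simp))
  bracket_mem i j x hx y hy := gradedCommutator_mem (𝒜 := 𝒜) hx hy
  antisymm i j x hx y hy := by
    apply Subtype.ext
    have hx' : (x : A) ∈ 𝒜 i := hx
    have hy' : (y : A) ∈ 𝒜 j := hy
    simp only [LinearMap.mk₂_apply, Submodule.coe_neg, Submodule.coe_smul]
    rw [gradedCommutator_apply hx' hy', gradedCommutator_apply hy' hx', mul_comm j i]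
    rcases Nat.even_or_odd (i * j) with h | h
    · simp [h.neg_one_pow]
    · simp [h.neg_one_pow, add_comm]
  jacobi i j k x hx y hy z hz := by
    apply Subtype.ext
    have hx' : (x : A) ∈ 𝒜 i := hx
    have hy' : (y : A) ∈ 𝒜 j := hy
    have hz' : (z : A) ∈ 𝒜 k := hz
    simp only [LinearMap.mk₂_apply, Submodule.coe_add, Submodule.coe_smul]
    rw [gradedCommutator_apply hx' (gradedCommutator_mem hy' hz'),
      gradedCommutator_apply (gradedCommutator_mem hx' hy') hz',
      gradedCommutator_apply hy' (gradedCommutator_mem hx' hz'),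
      gradedCommutator_apply hx' hy', gradedCommutator_apply hy' hz',
      gradedCommutator_apply hx' hz']
    rcases neg_one_pow_eq_or R (i * j) with h1 | h1 <;>
    rcases neg_one_pow_eq_or R (i * k) with h2 | h2 <;>
    rcases neg_one_pow_eq_or R (j * k) with h3 | h3 <;>
    · simp only [mul_add, add_mul, pow_add, h1, h2, h3, mul_comm j i,
        mul_neg, neg_neg, mul_one, one_smul, neg_smul]
      noncomm_ring
  odd i hi x hx := by
    apply Subtype.ext
    have hx' : (x : A) ∈ 𝒜 i := hx
    simp only [LinearMap.mk₂_apply]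
    rw [gradedCommutator_apply hx' (gradedCommutator_mem hx' hx'), gradedCommutator_apply hx' hx',
      (hi.mul hi).neg_one_pow, mul_add, pow_add, (hi.mul hi).neg_one_pow]
    simp only [ZeroMemClass.coe_zero, mul_neg, neg_neg, mul_one, one_smul, neg_smul]
    noncomm_ring

end Primitives
/-! ### The dual of a graded Hopf algebra of finite type -/

section Dual

variable {R : Type*} [CommRing R] {A : Type*} [Ring A] [Algebra R A]
variable (𝒜 : ℕ → Submodule R A)

/-- The linear forms that vanish in all but finitely many degrees. -/
def dualSubmodule : Submodule R (Module.Dual R A) where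
  carrier := {f | ∃ N, ∀ n, N ≤ n → ∀ x ∈ 𝒜 n, f x = 0}
  zero_mem' := ⟨0, by simp⟩
  add_mem' {f g} hf hg := by
    obtain ⟨N, hN⟩ := hf
    obtain ⟨K, hK⟩ := hg
    refine ⟨max N K, fun n hn x hx => ?_⟩
    rw [LinearMap.add_apply, hN n (le_trans (le_max_left _ _) hn) x hx,
      hK n (le_trans (le_max_right _ _) hn) x hx, add_zero]
  smul_mem' r f hf := by
    obtain ⟨N, hN⟩ := hf
    exact ⟨N, fun n hn x hx => by rw [LinearMap.smul_apply, hN n hn x hx, smul_zero]⟩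

/-- The graded dual of a graded algebra, the direct sum of the duals of the components. -/
def GradedDual : Type _ := dualSubmodule 𝒜

namespace GradedDual

instance : AddCommGroup (GradedDual 𝒜) := inferInstanceAs (AddCommGroup (dualSubmodule 𝒜))

instance : Module R (GradedDual 𝒜) := inferInstanceAs (Module R (dualSubmodule 𝒜))

/-- The linear form underlying an element of the graded dual. -/
def toDual : GradedDual 𝒜 →ₗ[R] Module.Dual R A := (dualSubmodule 𝒜).subtype

variable {𝒜}

@[ext]
theorem ext {f g : GradedDual 𝒜} (h : ∀ x, toDual 𝒜 f x = toDual 𝒜 g x) : f = g :=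
  Subtype.ext (LinearMap.ext h)

variable (𝒜)

/-- The component of degree `n` of the graded dual: the forms that vanish in all degrees other
than `n`. -/
def grading (n : ℕ) : Submodule R (GradedDual 𝒜) where
  carrier := {f | ∀ m, m ≠ n → ∀ x ∈ 𝒜 m, toDual 𝒜 f x = 0}
  zero_mem' := by simp
  add_mem' {f g} hf hg m hm x hx := by
    rw [map_add, LinearMap.add_apply, hf m hm x hx, hg m hm x hx, add_zero]
  smul_mem' r f hf m hm x hx := by
    rw [map_smul, LinearMap.smul_apply, hf m hm x hx, smul_zero]

variable [GradedAlgebra 𝒜]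

variable {𝒜} in
theorem ext_hom {f g : GradedDual 𝒜} (h : ∀ n, ∀ x ∈ 𝒜 n, toDual 𝒜 f x = toDual 𝒜 g x) :
    f = g := by
  ext x
  induction x using hom_induction 𝒜 with
  | zero => simp
  | add y z hy hz => simp only [map_add, hy, hz]
  | hom n y hy => exact h n y hy

/-- The component of degree `n` of a form. -/
def dualProj (n : ℕ) : GradedDual 𝒜 →ₗ[R] GradedDual 𝒜 where
  toFun f := ⟨toDual 𝒜 f ∘ₗ proj 𝒜 n, n + 1, fun m hm x hx => by
    rw [LinearMap.comp_apply, proj_ne hx (by omega), map_zero]⟩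
  map_add' _ _ := rfl
  map_smul' _ _ := rfl

variable {𝒜} in
theorem dualProj_apply (n : ℕ) (f : GradedDual 𝒜) (x : A) :
    toDual 𝒜 (dualProj 𝒜 n f) x = toDual 𝒜 f (proj 𝒜 n x) := rfl

theorem grading_isInternal : DirectSum.IsInternal (grading 𝒜) := by
  refine isInternal_of_proj (grading 𝒜) (dualProj 𝒜) ?_ ?_ ?_ ?_
  · intro n f m hm x hx
    rw [dualProj_apply, proj_ne hx hm, map_zero]
  · intro n f hf
    refine ext_hom fun m x hx => ?_
    rw [dualProj_apply]
    rcases eq_or_ne m n with rfl | h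
    · rw [proj_same hx]
    · rw [proj_ne hx h, map_zero, hf m h x hx]
  · intro m n h f hf
    refine ext_hom fun k x hx => ?_
    rw [dualProj_apply, map_zero, LinearMap.zero_apply]
    exact hf n h.symm _ (proj_mem n x)
  · intro f
    obtain ⟨N, hN⟩ := f.2
    refine ⟨N, ext_hom fun k x hx => ?_⟩
    rw [map_sum, LinearMap.sum_apply]
    simp only [dualProj_apply]
    by_cases hk : k < N
    · rw [Finset.sum_eq_single k, proj_same hx]
      · intro b _ hb
        rw [proj_ne hx hb.symm, map_zero]
      · intro h
        exact absurd (Finset.mem_range.2 hk) h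
    · rw [Finset.sum_eq_zero]
      · exact hN k (not_lt.1 hk) x hx
      · intro b hb
        rw [proj_ne hx (by have := Finset.mem_range.1 hb; omega), map_zero]

instance : DirectSum.Decomposition (grading 𝒜) := (grading_isInternal 𝒜).chooseDecomposition

/-- The value of an element of `A♯ ⊗ A♯` on an element of `A ⊗ A`, without signs:
`(f ⊗ g) (x ⊗ y) = f x * g y`. -/
def ev : GradedDual 𝒜 ⊗[R] GradedDual 𝒜 →ₗ[R] Module.Dual R (A ⊗[R] A) :=
  TensorProduct.dualDistrib R A A ∘ₗ TensorProduct.map (toDual 𝒜) (toDual 𝒜)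

variable {𝒜} in
theorem ev_tmul (f g : GradedDual 𝒜) (x y : A) :
    ev 𝒜 (f ⊗ₜ[R] g) (x ⊗ₜ[R] y) = toDual 𝒜 f x * toDual 𝒜 g y := by
  simp [ev]

variable {𝒜} in
theorem koszul_koszul (t : A ⊗[R] A) : koszul 𝒜 (koszul 𝒜 t) = t := by
  induction t using tensor_hom_induction 𝒜 with
  | zero => simp
  | add s t hs ht => simp only [map_add, hs, ht]
  | tmul i j x hx y hy =>
    rw [koszul_tmul hx hy, map_smul, koszul_tmul hx hy, smul_smul, ← mul_pow]
    simp

/-! The product of the graded dual. -/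

section Product

variable [Coalgebra R A] [GradedHopfAlgebra 𝒜]

/-- The product dual to the diagonal: `(f g) x = ∑ (-1) ^ (deg x₁ * deg x₂) f x₁ * g x₂` if
`Δ x = ∑ x₁ ⊗ x₂` with `x₁` and `x₂` homogeneous; this is `(f ⊗ g) (Δ x)` with the sign convention
`(f ⊗ g) (x ⊗ y) = (-1) ^ (deg g * deg x) f x * g y`. -/
def mulAux (f g : GradedDual 𝒜) : GradedDual 𝒜 :=
  ⟨ev 𝒜 (f ⊗ₜ[R] g) ∘ₗ koszul 𝒜 ∘ₗ Coalgebra.comul, by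
    obtain ⟨N, hN⟩ := f.2
    obtain ⟨K, hK⟩ := g.2
    refine ⟨N + K, fun n hn x hx => ?_⟩
    simp only [LinearMap.comp_apply]
    refine tensorGrading_induction (motive := fun t => ev 𝒜 (f ⊗ₜ[R] g) (koszul 𝒜 t) = 0)
      (GradedHopfAlgebra.comul_mem n x hx) (by simp) ?_
      (fun s t hs ht => by rw [map_add, map_add, hs, ht, add_zero])
    rintro i j rfl a ha b hb
    rw [koszul_tmul ha hb, map_smul, ev_tmul]
    by_cases hi : N ≤ i
    · have h : toDual 𝒜 f a = 0 := hN i hi a ha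
      rw [h, zero_mul, smul_zero]
    · have h : toDual 𝒜 g b = 0 := hK j (by omega) b hb
      rw [h, mul_zero, smul_zero]⟩

instance : Mul (GradedDual 𝒜) := ⟨mulAux 𝒜⟩

/-- The unit of the graded dual is the augmentation. -/
instance : One (GradedDual 𝒜) :=
  ⟨⟨Coalgebra.counit, 1, fun n hn x hx =>
    GradedHopfAlgebra.counit_eq_zero n (by omega) x hx⟩⟩

variable {𝒜}

theorem mul_apply (f g : GradedDual 𝒜) (x : A) :
    toDual 𝒜 (f * g) x = ev 𝒜 (f ⊗ₜ[R] g) (koszul 𝒜 (Coalgebra.comul (R := R) x)) := rfl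

theorem one_apply (x : A) :
    toDual 𝒜 (1 : GradedDual 𝒜) x = Coalgebra.counit (R := R) x := rfl

/-- Rescaling by `(-1) ^ (n (n - 1) / 2)` in degree `n`, which turns the product of the graded dual
into the convolution product without signs. -/
def toConvDual (f : GradedDual 𝒜) : WithConv (A →ₗ[R] R) :=
  WithConv.toConv (toDual 𝒜 f ∘ₗ degScale 𝒜 (fun n => (-1 : R) ^ n.choose 2))

theorem toConvDual_injective : Function.Injective (toConvDual (𝒜 := 𝒜)) := by
  intro f g h
  refine ext_hom fun n x hx => ?_
  have h1 := LinearMap.congr_fun (congrArg WithConv.ofConv h) ((-1 : R) ^ n.choose 2 • x)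
  simp only [toConvDual, WithConv.ofConv_toConv, LinearMap.comp_apply, map_smul,
    degScale_of_mem _ hx] at h1
  rw [smul_smul, smul_smul, ← mul_pow] at h1
  simpa using h1

theorem toConvDual_mul (f g : GradedDual 𝒜) :
    toConvDual (f * g) = toConvDual f * toConvDual g := by
  apply WithConv.ofConv_injective
  ext x
  induction x using hom_induction 𝒜 with
  | zero => simp
  | add y z hy hz => rw [map_add, map_add, hy, hz]
  | hom n x hx =>
    simp only [toConvDual, WithConv.ofConv_toConv, LinearMap.comp_apply, degScale_of_mem _ hx,
      LinearMap.convMul_def, map_smul, mul_apply]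
    refine tensorGrading_induction (motive := fun t =>
      (-1 : R) ^ n.choose 2 • ev 𝒜 (f ⊗ₜ[R] g) (koszul 𝒜 t) = LinearMap.mul' R R
        (TensorProduct.map (toDual 𝒜 f ∘ₗ degScale 𝒜 fun n => (-1 : R) ^ n.choose 2)
          (toDual 𝒜 g ∘ₗ degScale 𝒜 fun n => (-1 : R) ^ n.choose 2) t))
      (GradedHopfAlgebra.comul_mem n x hx) (by simp) ?_
      (fun s t hs ht => by simp only [map_add, smul_add, hs, ht])
    rintro i j rfl a ha b hb
    have hc : (i + j).choose 2 = i.choose 2 + j.choose 2 + i * j := by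
      clear hx hb
      induction j with
      | zero => simp
      | succ j ih =>
        rw [← add_assoc, Nat.choose_succ_succ' (i + j) 1,
          ih, Nat.choose_succ_succ' j 1]
        simp
        ring
    rw [koszul_tmul ha hb, map_smul, ev_tmul, TensorProduct.map_tmul, LinearMap.mul'_apply,
      LinearMap.comp_apply, LinearMap.comp_apply, degScale_of_mem _ ha, degScale_of_mem _ hb,
      map_smul, map_smul, hc, pow_add, pow_add]
    have h2 : (-1 : R) ^ (i * j) * (-1 : R) ^ (i * j) = 1 := by
      rw [← mul_pow]; simp
    simp only [smul_eq_mul]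
    linear_combination ((-1 : R) ^ i.choose 2 * (-1 : R) ^ j.choose 2 * toDual 𝒜 f a *
      toDual 𝒜 g b) * h2

theorem toConvDual_one : toConvDual (1 : GradedDual 𝒜) = 1 := by
  apply WithConv.ofConv_injective
  ext x
  induction x using hom_induction 𝒜 with
  | zero => simp
  | add y z hy hz => rw [map_add, map_add, hy, hz]
  | hom n x hx =>
    simp only [toConvDual, WithConv.ofConv_toConv, LinearMap.comp_apply, degScale_of_mem _ hx,
      LinearMap.convOne_def, map_smul, one_apply]
    rcases eq_or_ne n 0 with rfl | hn
    · simp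
    · simp [GradedHopfAlgebra.counit_eq_zero n hn x hx]

instance : Ring (GradedDual 𝒜) where
  __ := (inferInstance : AddCommGroup (GradedDual 𝒜))
  left_distrib f g h := by
    ext x
    simp only [map_add, LinearMap.add_apply, mul_apply, TensorProduct.tmul_add]
  right_distrib f g h := by
    ext x
    simp only [map_add, LinearMap.add_apply, mul_apply, TensorProduct.add_tmul]
  zero_mul f := by
    ext x
    simp [mul_apply]
  mul_zero f := by
    ext x
    simp [mul_apply]
  mul_assoc f g h := toConvDual_injective (by simp only [toConvDual_mul, mul_assoc])
  one_mul f := toConvDual_injective (by rw [toConvDual_mul, toConvDual_one, one_mul])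
  mul_one f := toConvDual_injective (by rw [toConvDual_mul, toConvDual_one, mul_one])

instance : Algebra R (GradedDual 𝒜) :=
  Algebra.ofModule
    (fun r f g => by
      ext x
      simp [mul_apply, ← TensorProduct.smul_tmul'])
    (fun r f g => by
      ext x
      simp [mul_apply])

instance : GradedAlgebra (grading 𝒜) where
  one_mem m hm x hx := GradedHopfAlgebra.counit_eq_zero m hm x hx
  mul_mem i j f g hf hg m hm x hx := by
    rw [mul_apply]
    refine tensorGrading_induction (motive := fun t => ev 𝒜 (f ⊗ₜ[R] g) (koszul 𝒜 t) = 0)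
      (GradedHopfAlgebra.comul_mem m x hx) (by simp) ?_
      (fun s t hs ht => by rw [map_add, map_add, hs, ht, add_zero])
    rintro i' j' rfl a ha b hb
    rw [koszul_tmul ha hb, map_smul, ev_tmul]
    by_cases hi : i' = i
    · have h : toDual 𝒜 g b = 0 := hg j' (by omega) b hb
      rw [h, mul_zero, smul_zero]
    · have h : toDual 𝒜 f a = 0 := hf i' hi a ha
      rw [h, zero_mul, smul_zero]

end Product

end GradedDual

end Dual
section DualCoalgebra

variable {R : Type*} [CommRing R] {A : Type*} [Ring A] [Algebra R A]
variable (𝒜 : ℕ → Submodule R A) [GradedAlgebra 𝒜]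

namespace GradedDual

/-- Evaluation of the first tensor factor at `x`. -/
def evalLeft (N : Type*) [AddCommGroup N] [Module R N] (x : A) : GradedDual 𝒜 ⊗[R] N →ₗ[R] N :=
  (TensorProduct.lid R N).toLinearMap ∘ₗ LinearMap.rTensor N ((toDual 𝒜).flip x)

variable {𝒜}

theorem evalLeft_tmul {N : Type*} [AddCommGroup N] [Module R N] (x : A) (f : GradedDual 𝒜)
    (n : N) : evalLeft 𝒜 N x (f ⊗ₜ[R] n) = toDual 𝒜 f x • n := by
  simp [evalLeft]

theorem ev_apply (t : GradedDual 𝒜 ⊗[R] GradedDual 𝒜) (x y : A) :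
    ev 𝒜 t (x ⊗ₜ[R] y) = toDual 𝒜 (evalLeft 𝒜 (GradedDual 𝒜) x t) y := by
  induction t using TensorProduct.induction_on with
  | zero => simp
  | add s t hs ht => simp only [map_add, LinearMap.add_apply, hs, ht]
  | tmul f g => simp [ev_tmul, evalLeft_tmul]

variable (𝒜) [∀ n, Module.Finite R (𝒜 n)] [∀ n, Module.Free R (𝒜 n)]

/-- A basis of `𝒜 n`. -/
def basis (n : ℕ) : Module.Basis (Module.Free.ChooseBasisIndex R (𝒜 n)) R (𝒜 n) :=
  Module.Free.chooseBasis R (𝒜 n)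

/-- The elements of the graded dual given by the basis dual to `basis`. -/
def dualBasis (n : ℕ) (a : Module.Free.ChooseBasisIndex R (𝒜 n)) : GradedDual 𝒜 :=
  ⟨(basis 𝒜 n).coord a ∘ₗ DirectSum.component R ℕ (fun i => 𝒜 i) n ∘ₗ
    (DirectSum.decomposeLinearEquiv 𝒜).toLinearMap, n + 1, fun m hm x hx => by
      simp only [LinearMap.comp_apply, LinearEquiv.coe_coe, DirectSum.decomposeLinearEquiv_apply,
        DirectSum.decompose_of_mem 𝒜 hx]
      rw [DirectSum.component, DFinsupp.lapply_apply]
      rw [DirectSum.of_eq_of_ne _ _ _ (by omega), map_zero]⟩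

variable {𝒜}

theorem dualBasis_ne {m n : ℕ} (a : Module.Free.ChooseBasisIndex R (𝒜 n)) {x : A} (hx : x ∈ 𝒜 m)
    (h : m ≠ n) : toDual 𝒜 (dualBasis 𝒜 n a) x = 0 := by
  change (basis 𝒜 n).coord a (DirectSum.decompose 𝒜 x n) = 0
  rw [DirectSum.decompose_of_mem 𝒜 hx, DirectSum.of_eq_of_ne _ _ _ h.symm, map_zero]

theorem sum_dualBasis {n : ℕ} {x : A} (hx : x ∈ 𝒜 n) :
    ∑ a, toDual 𝒜 (dualBasis 𝒜 n a) x • (basis 𝒜 n a : A) = x := by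
  have h : ∀ a, toDual 𝒜 (dualBasis 𝒜 n a) x = (basis 𝒜 n).repr ⟨x, hx⟩ a := by
    intro a
    change (basis 𝒜 n).coord a (DirectSum.decompose 𝒜 x n) = _
    rw [DirectSum.decompose_of_mem 𝒜 hx, DirectSum.of_eq_same]
    rfl
  simp only [h]
  have h2 := congrArg (Subtype.val) ((basis 𝒜 n).sum_repr ⟨x, hx⟩)
  rw [AddSubmonoidClass.coe_finsetSum] at h2
  exact h2

theorem eq_sum_dualBasis {N : Type*} [AddCommGroup N] [Module R N] (t : GradedDual 𝒜 ⊗[R] N) :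
    ∃ K, ∀ K', K ≤ K' → t = ∑ i ∈ Finset.range K', ∑ a,
      dualBasis 𝒜 i a ⊗ₜ[R] evalLeft 𝒜 N (basis 𝒜 i a : A) t := by
  induction t using TensorProduct.induction_on with
  | zero => exact ⟨0, fun _ _ => by simp⟩
  | add s t hs ht =>
    obtain ⟨K, hK⟩ := hs
    obtain ⟨K', hK'⟩ := ht
    refine ⟨max K K', fun M hM => ?_⟩
    simp only [map_add, TensorProduct.tmul_add, Finset.sum_add_distrib]
    rw [← hK M (le_trans (le_max_left _ _) hM), ← hK' M (le_trans (le_max_right _ _) hM)]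
  | tmul f n =>
    obtain ⟨K, hK⟩ := f.2
    refine ⟨K, fun K' hK' => ?_⟩
    simp only [evalLeft_tmul, ← TensorProduct.smul_tmul, ← TensorProduct.sum_tmul]
    congr 1
    refine ext_hom fun m x hx => ?_
    simp only [map_sum, LinearMap.sum_apply, map_smul, LinearMap.smul_apply]
    by_cases hm : m < K'
    · rw [Finset.sum_eq_single m]
      · conv_lhs => rw [← sum_dualBasis hx]
        simp only [map_sum, map_smul, smul_eq_mul]
        exact Finset.sum_congr rfl fun a _ => mul_comm _ _
      · intro i _ hi
        exact Finset.sum_eq_zero fun a _ => by rw [dualBasis_ne a hx hi.symm, smul_zero]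
      · intro h
        exact absurd (Finset.mem_range.2 hm) h
    · have h : toDual 𝒜 f x = 0 := hK m (by omega) x hx
      rw [h, Finset.sum_eq_zero]
      intro i hi
      have := Finset.mem_range.1 hi
      exact Finset.sum_eq_zero fun a _ => by rw [dualBasis_ne a hx (by omega), smul_zero]

theorem ext_evalLeft {N : Type*} [AddCommGroup N] [Module R N] {s t : GradedDual 𝒜 ⊗[R] N}
    (h : ∀ x, evalLeft 𝒜 N x s = evalLeft 𝒜 N x t) : s = t := by
  obtain ⟨K, hK⟩ := eq_sum_dualBasis s
  obtain ⟨K', hK'⟩ := eq_sum_dualBasis t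
  rw [hK _ (le_max_left K K'), hK' _ (le_max_right K K')]
  simp only [h]

theorem ext_ev {s t : GradedDual 𝒜 ⊗[R] GradedDual 𝒜}
    (h : ∀ i j, ∀ x ∈ 𝒜 i, ∀ y ∈ 𝒜 j, ev 𝒜 s (x ⊗ₜ[R] y) = ev 𝒜 t (x ⊗ₜ[R] y)) : s = t := by
  have h2 : ev 𝒜 s = ev 𝒜 t := by
    refine LinearMap.ext fun u => ?_
    induction u using tensor_hom_induction 𝒜 with
    | zero => simp
    | add u v hu hv => simp only [map_add, hu, hv]
    | tmul i j x hx y hy => exact h i j x hx y hy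
  refine ext_evalLeft fun x => ?_
  ext y
  rw [← ev_apply, ← ev_apply, h2]

variable (𝒜)

/-- The pairing of `A♯ ⊗ A♯` with `A ⊗ A` for homogeneous elements,
`⟨f ⊗ g, x ⊗ y⟩ = (-1) ^ (deg g * deg x) f x * g y`; both sides vanish unless `deg g = deg y`. -/
def pairing : GradedDual 𝒜 ⊗[R] GradedDual 𝒜 →ₗ[R] Module.Dual R (A ⊗[R] A) :=
  (koszul 𝒜).lcomp R R ∘ₗ ev 𝒜

variable {𝒜}

theorem pairing_apply (t : GradedDual 𝒜 ⊗[R] GradedDual 𝒜) (u : A ⊗[R] A) :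
    pairing 𝒜 t u = ev 𝒜 t (koszul 𝒜 u) := rfl

variable (𝒜)

theorem pairing_injective : Function.Injective (pairing 𝒜) := by
  intro s t h
  refine ext_ev fun i j x _ y _ => ?_
  have := LinearMap.congr_fun h (koszul 𝒜 (x ⊗ₜ[R] y))
  rwa [pairing_apply, pairing_apply, koszul_koszul] at this

theorem mul_mem_range_pairing (f : GradedDual 𝒜) :
    toDual 𝒜 f ∘ₗ LinearMap.mul' R A ∈ LinearMap.range (pairing 𝒜) := by
  obtain ⟨N, hN⟩ := f.2
  let φ : A ⊗[R] A →ₗ[R] R := toDual 𝒜 f ∘ₗ LinearMap.mul' R A ∘ₗ koszul 𝒜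
  have hφ : ∀ i j, N ≤ i + j → ∀ x ∈ 𝒜 i, ∀ y ∈ 𝒜 j, φ (x ⊗ₜ[R] y) = 0 := by
    intro i j hij x hx y hy
    have h : toDual 𝒜 f (x * y) = 0 := hN _ hij _ (SetLike.mul_mem_graded hx hy)
    simp only [φ, LinearMap.comp_apply, koszul_tmul hx hy, map_smul, LinearMap.mul'_apply, h,
      smul_zero]
  let g : ∀ i, Module.Free.ChooseBasisIndex R (𝒜 i) → GradedDual 𝒜 := fun i a =>
    ⟨TensorProduct.curry φ (basis 𝒜 i a : A), N, fun n hn x hx =>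
      hφ i n (by omega) _ (basis 𝒜 i a).2 x hx⟩
  have hg : ∀ i a y, toDual 𝒜 (g i a) y = φ ((basis 𝒜 i a : A) ⊗ₜ[R] y) := fun _ _ _ => rfl
  refine ⟨∑ i ∈ Finset.range N, ∑ a, dualBasis 𝒜 i a ⊗ₜ[R] g i a, LinearMap.ext fun u => ?_⟩
  have key : ∀ u, ev 𝒜 (∑ i ∈ Finset.range N, ∑ a, dualBasis 𝒜 i a ⊗ₜ[R] g i a) u = φ u := by
    intro u
    induction u using tensor_hom_induction 𝒜 with
    | zero => simp
    | add u v hu hv => rw [map_add, map_add, hu, hv]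
    | tmul i j x hx y hy =>
      simp only [map_sum, LinearMap.sum_apply, ev_tmul, hg]
      by_cases hi : i < N
      · rw [Finset.sum_eq_single i]
        · conv_rhs => rw [← sum_dualBasis hx]
          simp only [TensorProduct.sum_tmul, map_sum, ← TensorProduct.smul_tmul', map_smul,
            smul_eq_mul]
        · intro k _ hk
          exact Finset.sum_eq_zero fun a _ => by rw [dualBasis_ne a hx hk.symm, zero_mul]
        · intro h
          exact absurd (Finset.mem_range.2 hi) h
      · rw [hφ i j (by omega) x hx y hy, Finset.sum_eq_zero]
        intro k hk
        have := Finset.mem_range.1 hk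
        exact Finset.sum_eq_zero fun a _ => by rw [dualBasis_ne a hx (by omega), zero_mul]
  rw [pairing_apply, key]
  simp only [φ, LinearMap.comp_apply, koszul_koszul]

/-- The diagonal of the graded dual: `Δ f` is the unique element of `A♯ ⊗ A♯` such that
`⟨Δ f, x ⊗ y⟩ = f (x y)`; see `pairing_comul`. -/
def comulAux : GradedDual 𝒜 →ₗ[R] GradedDual 𝒜 ⊗[R] GradedDual 𝒜 :=
  (LinearEquiv.ofInjective (pairing 𝒜) (pairing_injective 𝒜)).symm.toLinearMap ∘ₗ
    ((LinearMap.mul' R A).lcomp R R ∘ₗ toDual 𝒜).codRestrict (LinearMap.range (pairing 𝒜))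
      (mul_mem_range_pairing 𝒜)

/-- The coalgebra structure of the graded dual; the augmentation is evaluation at `1`. -/
instance : CoalgebraStruct R (GradedDual 𝒜) where
  comul := comulAux 𝒜
  counit := (toDual 𝒜).flip 1

variable {𝒜}

theorem pairing_comul (f : GradedDual 𝒜) (x y : A) :
    pairing 𝒜 (Coalgebra.comul (R := R) f) (x ⊗ₜ[R] y) = toDual 𝒜 f (x * y) := by
  have h : pairing 𝒜 (comulAux 𝒜 f) = toDual 𝒜 f ∘ₗ LinearMap.mul' R A := by
    have h1 := congrArg Subtype.val
      ((LinearEquiv.ofInjective (pairing 𝒜) (pairing_injective 𝒜)).apply_symm_apply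
        (((LinearMap.mul' R A).lcomp R R ∘ₗ toDual 𝒜).codRestrict (LinearMap.range (pairing 𝒜))
          (mul_mem_range_pairing 𝒜) f))
    exact h1
  change pairing 𝒜 (comulAux 𝒜 f) (x ⊗ₜ[R] y) = _
  rw [h]
  simp

theorem counit_apply (f : GradedDual 𝒜) : Coalgebra.counit (R := R) f = toDual 𝒜 f 1 := rfl

theorem ev_comul (f : GradedDual 𝒜) {i j : ℕ} {x y : A} (hx : x ∈ 𝒜 i) (hy : y ∈ 𝒜 j) :
    ev 𝒜 (Coalgebra.comul (R := R) f) (x ⊗ₜ[R] y) =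
      (-1 : R) ^ (i * j) * toDual 𝒜 f (x * y) := by
  have h := pairing_comul f x y
  rw [pairing_apply, koszul_tmul hx hy, map_smul] at h
  rw [← h, smul_eq_mul, ← mul_assoc, ← mul_pow]
  simp

theorem toDual_evalLeft_comul (f : GradedDual 𝒜) {i j : ℕ} {x y : A} (hx : x ∈ 𝒜 i)
    (hy : y ∈ 𝒜 j) :
    toDual 𝒜 (evalLeft 𝒜 (GradedDual 𝒜) x (Coalgebra.comul (R := R) f)) y =
      (-1 : R) ^ (i * j) * toDual 𝒜 f (x * y) := by
  rw [← ev_apply, ev_comul f hx hy]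

theorem ext_evalLeft_hom {N : Type*} [AddCommGroup N] [Module R N] {s t : GradedDual 𝒜 ⊗[R] N}
    (h : ∀ n, ∀ x ∈ 𝒜 n, evalLeft 𝒜 N x s = evalLeft 𝒜 N x t) : s = t := by
  refine ext_evalLeft fun x => ?_
  induction x using hom_induction 𝒜 with
  | zero => simp [evalLeft]
  | add y z hy hz =>
    have e : ∀ u, evalLeft 𝒜 N (y + z) u = evalLeft 𝒜 N y u + evalLeft 𝒜 N z u := by
      intro u
      simp [evalLeft, LinearMap.rTensor_add]
    rw [e, e, hy, hz]
  | hom n y hy => exact h n y hy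

instance : Coalgebra R (GradedDual 𝒜) where
  coassoc := by
    refine LinearMap.ext fun f => ?_
    simp only [LinearMap.comp_apply, LinearEquiv.coe_coe]
    refine ext_evalLeft_hom fun i x hx => ext_ev fun j k y hy z hz => ?_
    have h1 : ∀ t : GradedDual 𝒜 ⊗[R] GradedDual 𝒜,
        ev 𝒜 (evalLeft 𝒜 _ x (TensorProduct.assoc R _ _ _
          (LinearMap.rTensor (GradedDual 𝒜) (Coalgebra.comul (R := R)) t))) (y ⊗ₜ[R] z) =
        (-1 : R) ^ (i * j) * ev 𝒜 t ((x * y) ⊗ₜ[R] z) := by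
      intro t
      induction t using TensorProduct.induction_on with
      | zero => simp
      | add s t hs ht => simp only [map_add, LinearMap.add_apply, hs, ht, mul_add]
      | tmul g h =>
        rw [LinearMap.rTensor_tmul, ev_tmul, ← mul_assoc, ← ev_comul g hx hy]
        generalize Coalgebra.comul (R := R) g = w
        induction w using TensorProduct.induction_on with
        | zero => simp
        | add s t hs ht =>
          simp only [TensorProduct.add_tmul, map_add, LinearMap.add_apply, hs, ht, add_mul]
        | tmul c d => simp [evalLeft_tmul, ev_tmul, mul_assoc]
    have h2 : ∀ t : GradedDual 𝒜 ⊗[R] GradedDual 𝒜,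
        ev 𝒜 (evalLeft 𝒜 _ x
          (LinearMap.lTensor (GradedDual 𝒜) (Coalgebra.comul (R := R)) t)) (y ⊗ₜ[R] z) =
        (-1 : R) ^ (j * k) * ev 𝒜 t (x ⊗ₜ[R] (y * z)) := by
      intro t
      induction t using TensorProduct.induction_on with
      | zero => simp
      | add s t hs ht => simp only [map_add, LinearMap.add_apply, hs, ht, mul_add]
      | tmul g h =>
        rw [LinearMap.lTensor_tmul, evalLeft_tmul, map_smul, LinearMap.smul_apply,
          ev_comul h hy hz, ev_tmul, smul_eq_mul]
        ring
    rw [h1, h2, ev_comul f (SetLike.mul_mem_graded hx hy) hz,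
      ev_comul f hx (SetLike.mul_mem_graded hy hz), mul_assoc x y z]
    ring
  rTensor_counit_comp_comul := by
    refine LinearMap.ext fun f => (TensorProduct.lid R (GradedDual 𝒜)).injective ?_
    simp only [LinearMap.comp_apply, TensorProduct.mk_apply]
    change evalLeft 𝒜 (GradedDual 𝒜) 1 (Coalgebra.comul (R := R) f) = _
    refine ext_hom fun n y hy => ?_
    rw [toDual_evalLeft_comul f (SetLike.one_mem_graded 𝒜) hy]
    simp
  lTensor_counit_comp_comul := by
    refine LinearMap.ext fun f => (TensorProduct.rid R (GradedDual 𝒜)).injective ?_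
    simp only [LinearMap.comp_apply, LinearMap.flip_apply, TensorProduct.mk_apply]
    refine ext_hom fun n x hx => ?_
    have h : ∀ t : GradedDual 𝒜 ⊗[R] GradedDual 𝒜,
        toDual 𝒜 (TensorProduct.rid R (GradedDual 𝒜)
          (LinearMap.lTensor (GradedDual 𝒜) (Coalgebra.counit (R := R)) t)) x =
        ev 𝒜 t (x ⊗ₜ[R] 1) := by
      intro t
      induction t using TensorProduct.induction_on with
      | zero => simp
      | add s t hs ht => simp only [map_add, LinearMap.add_apply, hs, ht]
      | tmul g h => simp [ev_tmul, counit_apply, mul_comm]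
    rw [h, ev_comul f hx (SetLike.one_mem_graded 𝒜)]
    simp

/-! Compatibility of the product and the diagonal of the graded dual. -/

section HopfDual

variable [Coalgebra R A] [GradedHopfAlgebra 𝒜]

/-- The form `(x₁ ⊗ x₂, y₁ ⊗ y₂) ↦ t (x₁ ⊗ y₁) * s (x₂ ⊗ y₂)`. -/
def evFour (t s : GradedDual 𝒜 ⊗[R] GradedDual 𝒜) (u v : A ⊗[R] A) : R :=
  TensorProduct.dualDistrib R (A ⊗[R] A) (A ⊗[R] A) (ev 𝒜 t ⊗ₜ[R] ev 𝒜 s)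
    (TensorProduct.tensorTensorTensorComm R A A A A (u ⊗ₜ[R] v))

/-- The form `evFour` with the Koszul sign for exchanging `x₂` and `y₁`. -/
def evFourSigned (t s : GradedDual 𝒜 ⊗[R] GradedDual 𝒜) (u v : A ⊗[R] A) : R :=
  evFour t s u v - 2 * evFour t s (LinearMap.lTensor A (oddPart 𝒜) u)
    (LinearMap.rTensor A (oddPart 𝒜) v)

theorem evFour_tmul (t s : GradedDual 𝒜 ⊗[R] GradedDual 𝒜) (x₁ x₂ y₁ y₂ : A) :
    evFour t s (x₁ ⊗ₜ[R] x₂) (y₁ ⊗ₜ[R] y₂) =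
      ev 𝒜 t (x₁ ⊗ₜ[R] y₁) * ev 𝒜 s (x₂ ⊗ₜ[R] y₂) := by
  simp [evFour]

theorem evFourSigned_tmul (t s : GradedDual 𝒜 ⊗[R] GradedDual 𝒜) {j k : ℕ} (x₁ y₂ : A)
    {x₂ y₁ : A} (hx : x₂ ∈ 𝒜 j) (hy : y₁ ∈ 𝒜 k) :
    evFourSigned t s (x₁ ⊗ₜ[R] x₂) (y₁ ⊗ₜ[R] y₂) =
      (-1 : R) ^ (j * k) * (ev 𝒜 t (x₁ ⊗ₜ[R] y₁) * ev 𝒜 s (x₂ ⊗ₜ[R] y₂)) := by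
  simp only [evFourSigned, LinearMap.lTensor_tmul, LinearMap.rTensor_tmul, evFour_tmul, oddPart,
    degScale_of_mem _ hx, degScale_of_mem _ hy]
  rcases Nat.even_or_odd j with hj | hj
  · have h1 : ¬ Odd j := by simpa using hj
    simp [h1, (hj.mul_right k).neg_one_pow]
  · rcases Nat.even_or_odd k with hk | hk
    · have h1 : ¬ Odd k := by simpa using hk
      simp [h1, (hk.mul_left j).neg_one_pow]
    · simp only [hj, hk, if_true, (hj.mul hk).neg_one_pow, one_smul]
      ring

theorem evFourSigned_add_left (t s : GradedDual 𝒜 ⊗[R] GradedDual 𝒜) (u u' v : A ⊗[R] A) :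
    evFourSigned t s (u + u') v = evFourSigned t s u v + evFourSigned t s u' v := by
  simp only [evFourSigned, evFour, TensorProduct.add_tmul, map_add]
  ring

theorem evFourSigned_add_right (t s : GradedDual 𝒜 ⊗[R] GradedDual 𝒜) (u v v' : A ⊗[R] A) :
    evFourSigned t s u (v + v') = evFourSigned t s u v + evFourSigned t s u v' := by
  simp only [evFourSigned, evFour, TensorProduct.tmul_add, map_add]
  ring

theorem evFourSigned_smul_left (t s : GradedDual 𝒜 ⊗[R] GradedDual 𝒜) (r : R) (u v : A ⊗[R] A) :
    evFourSigned t s (r • u) v = r * evFourSigned t s u v := by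
  simp only [evFourSigned, evFour, ← TensorProduct.smul_tmul', map_smul, smul_eq_mul]
  ring

theorem evFourSigned_smul_right (t s : GradedDual 𝒜 ⊗[R] GradedDual 𝒜) (r : R)
    (u v : A ⊗[R] A) : evFourSigned t s u (r • v) = r * evFourSigned t s u v := by
  simp only [evFourSigned, evFour, TensorProduct.tmul_smul, map_smul, smul_eq_mul]
  ring

theorem evFourSigned_add_fst (t t' s : GradedDual 𝒜 ⊗[R] GradedDual 𝒜) (u v : A ⊗[R] A) :
    evFourSigned (t + t') s u v = evFourSigned t s u v + evFourSigned t' s u v := by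
  simp only [evFourSigned, evFour, TensorProduct.add_tmul, map_add, LinearMap.add_apply]
  ring

theorem evFourSigned_add_snd (t s s' : GradedDual 𝒜 ⊗[R] GradedDual 𝒜) (u v : A ⊗[R] A) :
    evFourSigned t (s + s') u v = evFourSigned t s u v + evFourSigned t s' u v := by
  simp only [evFourSigned, evFour, TensorProduct.tmul_add, map_add, LinearMap.add_apply]
  ring

theorem ev_mul_aux {b c : ℕ} {f₁ f₂ g₁ g₂ : GradedDual 𝒜} (hf₂ : f₂ ∈ grading 𝒜 b)
    (hg₁ : g₁ ∈ grading 𝒜 c) (u v : A ⊗[R] A) :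
    (-1 : R) ^ (b * c) * (ev 𝒜 (f₁ ⊗ₜ[R] g₁) u * ev 𝒜 (f₂ ⊗ₜ[R] g₂) v) =
      evFourSigned (f₁ ⊗ₜ[R] f₂) (g₁ ⊗ₜ[R] g₂) u v := by
  induction u using tensor_hom_induction 𝒜 with
  | zero => simp [evFourSigned, evFour]
  | add u u' h h' => rw [evFourSigned_add_left, map_add, ← h, ← h']; ring
  | tmul i j x₁ hx₁ x₂ hx₂ =>
    induction v using tensor_hom_induction 𝒜 with
    | zero => simp [evFourSigned, evFour]
    | add v v' h h' => rw [evFourSigned_add_right, map_add, ← h, ← h']; ring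
    | tmul k l y₁ hy₁ y₂ hy₂ =>
      rw [evFourSigned_tmul _ _ _ _ hx₂ hy₁, ev_tmul, ev_tmul, ev_tmul, ev_tmul]
      by_cases hj : j = c
      · by_cases hk : k = b
        · subst hj hk
          rw [mul_comm j k]
          ring
        · rw [hf₂ k hk y₁ hy₁]
          ring
      · rw [hg₁ j hj x₂ hx₂]
        ring

theorem ev_mul (t s : GradedDual 𝒜 ⊗[R] GradedDual 𝒜) (x y : A) :
    ev 𝒜 ((GradedTensorProduct.of R (grading 𝒜) (grading 𝒜)).symm
        (GradedTensorProduct.of R (grading 𝒜) (grading 𝒜) t *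
          GradedTensorProduct.of R (grading 𝒜) (grading 𝒜) s)) (x ⊗ₜ[R] y) =
      evFourSigned t s (koszul 𝒜 (Coalgebra.comul (R := R) x))
        (koszul 𝒜 (Coalgebra.comul (R := R) y)) := by
  induction t using tensor_hom_induction (grading 𝒜) with
  | zero => simp [evFourSigned, evFour]
  | add t t' h h' =>
    rw [evFourSigned_add_fst, ← h, ← h', LinearEquiv.map_add _ t t', add_mul, map_add, map_add,
      LinearMap.add_apply]
  | tmul a b f₁ hf₁ f₂ hf₂ =>
    induction s using tensor_hom_induction (grading 𝒜) with
    | zero => simp [evFourSigned, evFour]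
    | add s s' h h' =>
      rw [evFourSigned_add_snd, ← h, ← h', LinearEquiv.map_add _ s s', mul_add, map_add, map_add,
        LinearMap.add_apply]
    | tmul c e g₁ hg₁ g₂ hg₂ =>
      rw [of_tmul_mul_of_tmul _ _ hf₂ hg₁, map_smul, map_smul, LinearMap.smul_apply,
        GradedTensorProduct.of_symm_of, ev_tmul, mul_apply, mul_apply, smul_eq_mul,
        ev_mul_aux hf₂ hg₁]

theorem ev_comul_mul_aux (f g : GradedDual 𝒜) {m n : ℕ} {u v : A ⊗[R] A}
    (hu : u ∈ tensorGrading 𝒜 m) (hv : v ∈ tensorGrading 𝒜 n) :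
    (-1 : R) ^ (m * n) * ev 𝒜 (f ⊗ₜ[R] g) (koszul 𝒜 ((GradedTensorProduct.of R 𝒜 𝒜).symm
        (GradedTensorProduct.of R 𝒜 𝒜 u * GradedTensorProduct.of R 𝒜 𝒜 v))) =
      evFourSigned (Coalgebra.comul (R := R) f) (Coalgebra.comul (R := R) g)
        (koszul 𝒜 u) (koszul 𝒜 v) := by
  refine tensorGrading_induction (motive := fun u =>
    (-1 : R) ^ (m * n) * ev 𝒜 (f ⊗ₜ[R] g) (koszul 𝒜 ((GradedTensorProduct.of R 𝒜 𝒜).symm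
        (GradedTensorProduct.of R 𝒜 𝒜 u * GradedTensorProduct.of R 𝒜 𝒜 v))) =
      evFourSigned (Coalgebra.comul (R := R) f) (Coalgebra.comul (R := R) g)
        (koszul 𝒜 u) (koszul 𝒜 v)) hu (by simp [evFourSigned, evFour]) ?_ ?_
  · rintro i j rfl x₁ hx₁ x₂ hx₂
    refine tensorGrading_induction (motive := fun v =>
      (-1 : R) ^ ((i + j) * n) * ev 𝒜 (f ⊗ₜ[R] g) (koszul 𝒜 ((GradedTensorProduct.of R 𝒜 𝒜).symm
          (GradedTensorProduct.of R 𝒜 𝒜 (x₁ ⊗ₜ[R] x₂) * GradedTensorProduct.of R 𝒜 𝒜 v))) =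
        evFourSigned (Coalgebra.comul (R := R) f) (Coalgebra.comul (R := R) g)
          (koszul 𝒜 (x₁ ⊗ₜ[R] x₂)) (koszul 𝒜 v)) hv (by simp [evFourSigned, evFour]) ?_ ?_
    · rintro k l rfl y₁ hy₁ y₂ hy₂
      rw [of_tmul_mul_of_tmul _ _ hx₂ hy₁, map_smul, GradedTensorProduct.of_symm_of, map_smul,
        koszul_tmul (SetLike.mul_mem_graded hx₁ hy₁) (SetLike.mul_mem_graded hx₂ hy₂),
        koszul_tmul hx₁ hx₂, koszul_tmul hy₁ hy₂, evFourSigned_smul_left, evFourSigned_smul_right,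
        evFourSigned_tmul _ _ _ _ hx₂ hy₁, ev_comul f hx₁ hy₁, ev_comul g hx₂ hy₂, map_smul,
        map_smul, ev_tmul]
      simp only [smul_eq_mul, add_mul, mul_add, pow_add, mul_comm k j]
      rcases neg_one_pow_eq_or R (i * j) with h1 | h1 <;>
      rcases neg_one_pow_eq_or R (i * k) with h2 | h2 <;>
      rcases neg_one_pow_eq_or R (i * l) with h3 | h3 <;>
      rcases neg_one_pow_eq_or R (j * k) with h4 | h4 <;>
      rcases neg_one_pow_eq_or R (j * l) with h5 | h5 <;>
      rcases neg_one_pow_eq_or R (k * l) with h6 | h6 <;>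
      · simp only [h1, h2, h3, h4, h5, h6]
        ring
    · intro s t hs ht
      rw [map_add (koszul 𝒜) s t, evFourSigned_add_right, ← hs, ← ht,
        LinearEquiv.map_add _ s t, mul_add, map_add, map_add, map_add, mul_add]
  · intro s t hs ht
    rw [map_add (koszul 𝒜) s t, evFourSigned_add_left, ← hs, ← ht,
      LinearEquiv.map_add _ s t, add_mul, map_add, map_add, map_add, mul_add]

instance : GradedHopfAlgebra (grading 𝒜) where
  comul_mem n f hf := by
    have h : totalProj (grading 𝒜) n (Coalgebra.comul (R := R) f) = Coalgebra.comul (R := R) f := by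
      refine ext_ev fun i j x hx y hy => ?_
      have h1 : ∀ t : GradedDual 𝒜 ⊗[R] GradedDual 𝒜,
          ev 𝒜 (totalProj (grading 𝒜) n t) (x ⊗ₜ[R] y) =
            if i + j = n then ev 𝒜 t (x ⊗ₜ[R] y) else 0 := by
        intro t
        induction t using tensor_hom_induction (grading 𝒜) with
        | zero => simp
        | add s t hs ht =>
          simp only [map_add, LinearMap.add_apply, hs, ht]
          split_ifs <;> simp
        | tmul a b g hg h hh =>
          rw [totalProj_tmul hg hh]
          by_cases ha : i = a
          · by_cases hb : j = b
            · subst ha hb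
              split_ifs <;> simp
            · have h0 : ev 𝒜 (g ⊗ₜ[R] h) (x ⊗ₜ[R] y) = 0 := by
                rw [ev_tmul, hh j hb y hy, mul_zero]
              split_ifs <;> simp [h0]
          · have h0 : ev 𝒜 (g ⊗ₜ[R] h) (x ⊗ₜ[R] y) = 0 := by
              rw [ev_tmul, hg i ha x hx, zero_mul]
            split_ifs <;> simp [h0]
      rw [h1]
      split_ifs with hij
      · rfl
      · rw [ev_comul f hx hy, hf _ hij _ (SetLike.mul_mem_graded hx hy), mul_zero]
    rw [← h]
    generalize Coalgebra.comul (R := R) f = t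
    induction t using tensor_hom_induction (grading 𝒜) with
    | zero => simp
    | add s t hs ht => rw [map_add]; exact Submodule.add_mem _ hs ht
    | tmul a b g hg h hh =>
      rw [totalProj_tmul hg hh]
      split_ifs with hab
      · rw [← hab]
        exact tmul_mem_tensorGrading hg hh
      · exact Submodule.zero_mem _
  counit_eq_zero n hn f hf := hf 0 hn.symm 1 (SetLike.one_mem_graded 𝒜)
  counit_one := GradedHopfAlgebra.counit_one (𝒜 := 𝒜)
  counit_mul f g := by
    have h1 : (1 : A) ∈ 𝒜 0 := SetLike.one_mem_graded 𝒜
    rw [counit_apply, mul_apply, GradedHopfAlgebra.comul_one (𝒜 := 𝒜), koszul_tmul h1 h1,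
      map_smul, ev_tmul]
    simp [counit_apply]
  comul_one := by
    refine ext_ev fun i j x hx y hy => ?_
    rw [ev_comul _ hx hy, ev_tmul, one_apply, one_apply, one_apply,
      GradedHopfAlgebra.counit_mul (𝒜 := 𝒜)]
    rcases eq_or_ne i 0 with rfl | hi
    · simp
    · rw [GradedHopfAlgebra.counit_eq_zero i hi x hx]
      simp
  comul_mul f g := by
    apply (GradedTensorProduct.of R (grading 𝒜) (grading 𝒜)).symm.injective
    refine ext_ev fun i j x hx y hy => ?_
    rw [GradedTensorProduct.of_symm_of, ev_comul _ hx hy, ev_mul,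
      ← ev_comul_mul_aux f g (GradedHopfAlgebra.comul_mem i x hx)
        (GradedHopfAlgebra.comul_mem j y hy), mul_apply, ← GradedHopfAlgebra.comul_mul,
      GradedTensorProduct.of_symm_of]

end HopfDual

end GradedDual

end DualCoalgebra
/-! ### Algebras with divided powers -/

section Gamma

variable {R : Type*} [CommRing R] {A : Type*} [Ring A] [Algebra R A]

/-- The structure of a `Γ`-algebra on a graded algebra: it is connected and graded commutative, and
it carries divided powers `γ k` on the elements of positive even degree. (The values of `γ k` on
other elements are irrelevant.) -/
structure GammaAlgebra (𝒜 : ℕ → Submodule R A) where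
  connected : IsConnected 𝒜
  commutative : IsGradedCommutative 𝒜
  γ : ℕ → A → A
  γ_mem : ∀ k n, 0 < n → ∀ a ∈ 𝒜 (2 * n), γ k a ∈ 𝒜 (2 * n * k)
  γ_zero : ∀ n, 0 < n → ∀ a ∈ 𝒜 (2 * n), γ 0 a = 1
  γ_one : ∀ n, 0 < n → ∀ a ∈ 𝒜 (2 * n), γ 1 a = a
  γ_mul_γ : ∀ j k n, 0 < n → ∀ a ∈ 𝒜 (2 * n), γ j a * γ k a = (j + k).choose j • γ (j + k) a
  γ_add : ∀ k n, 0 < n → ∀ a ∈ 𝒜 (2 * n), ∀ b ∈ 𝒜 (2 * n),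
    γ k (a + b) = ∑ i ∈ Finset.range (k + 1), γ i a * γ (k - i) b
  γ_mul_even : ∀ k m n, 0 < n → ∀ a ∈ 𝒜 (2 * m), ∀ b ∈ 𝒜 (2 * n), γ k (a * b) = a ^ k * γ k b
  γ_mul_odd : ∀ k m n, 2 ≤ k → ∀ a ∈ 𝒜 (2 * m + 1), ∀ b ∈ 𝒜 (2 * n + 1), γ k (a * b) = 0
  γ_γ : ∀ j k n, 0 < n → 0 < k → ∀ a ∈ 𝒜 (2 * n),
    γ j (γ k a) =
      ((j * k).factorial / (j.factorial * k.factorial ^ j)) • γ (j * k) a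

/-- The compatibility of a (degree-preserving) algebra morphism with divided powers. -/
def IsGammaMorphism {B : Type*} [Ring B] [Algebra R B] {𝒜 : ℕ → Submodule R A}
    {ℬ : ℕ → Submodule R B} (G : GammaAlgebra 𝒜) (H : GammaAlgebra ℬ) (f : A → B) : Prop :=
  ∀ k n, 0 < n → ∀ a ∈ 𝒜 (2 * n), f (G.γ k a) = H.γ k (f a)

/-- A `Γ`-Hopf algebra: a graded Hopf algebra that is a `Γ`-algebra, such that the diagonal is a
`Γ`-morphism. Here `A ⊗ A` has the divided powers of a tensor product of `Γ`-algebras; these are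
determined by the requirement that `a ↦ a ⊗ 1` and `b ↦ 1 ⊗ b` be `Γ`-morphisms, since an element
of positive even degree of `A ⊗ A` is a sum of products `(a ⊗ 1) (1 ⊗ b)` with `a`, `b` both of
even or both of odd degree. -/
structure GammaHopfAlgebra (𝒜 : ℕ → Submodule R A) [GradedAlgebra 𝒜] [Coalgebra R A]
    [GradedHopfAlgebra 𝒜] extends GammaAlgebra 𝒜 where
  tensor : GammaAlgebra fun n =>
    (tensorGrading 𝒜 n).map (GradedTensorProduct.of R 𝒜 𝒜).toLinearMap
  includeLeft_gamma : IsGammaMorphism toGammaAlgebra tensor (GradedTensorProduct.includeLeft 𝒜 𝒜)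
  includeRight_gamma : IsGammaMorphism toGammaAlgebra tensor (GradedTensorProduct.includeRight 𝒜 𝒜)
  comul_gamma : IsGammaMorphism toGammaAlgebra tensor
    (fun a => GradedTensorProduct.of R 𝒜 𝒜 (Coalgebra.comul (R := R) a))

end Gamma

/-! ### The free `Γ`-algebra on a graded module -/

section FreeGamma

variable (R : Type*) [CommRing R] (X : ℕ → Type*) [∀ n, AddCommGroup (X n)] [∀ n, Module R (X n)]

/-- The free `Γ`-algebra `Γ(X)` on a graded module `X` concentrated in positive degrees: the tensor
product of the divided power algebra on the even part of `X` and the exterior algebra on the odd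
part. (No signs are needed to multiply, because the first factor is concentrated in even
degrees.) -/
def FreeGamma : Type _ :=
  DividedPowerAlgebra R (⨁ n, X (2 * n)) ⊗[R] ExteriorAlgebra R (⨁ n, X (2 * n + 1))

namespace FreeGamma

instance : Ring (FreeGamma R X) :=
  inferInstanceAs (Ring
    (DividedPowerAlgebra R (⨁ n, X (2 * n)) ⊗[R] ExteriorAlgebra R (⨁ n, X (2 * n + 1))))

instance : Algebra R (FreeGamma R X) :=
  inferInstanceAs (Algebra R
    (DividedPowerAlgebra R (⨁ n, X (2 * n)) ⊗[R] ExteriorAlgebra R (⨁ n, X (2 * n + 1))))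

variable {X}

/-- The `k`-th divided power of a generator of even degree `2 * n`. -/
def dp (k n : ℕ) (x : X (2 * n)) : FreeGamma R X :=
  DividedPowerAlgebra.dp R k (DirectSum.lof R ℕ (fun n => X (2 * n)) n x) ⊗ₜ[R] 1

/-- A generator of odd degree `2 * n + 1`. -/
def odd (n : ℕ) (x : X (2 * n + 1)) : FreeGamma R X :=
  1 ⊗ₜ[R] ExteriorAlgebra.ι R (DirectSum.lof R ℕ (fun n => X (2 * n + 1)) n x)

variable (X)

/-- `IsMonomial m y`: `y` is a product of divided powers of generators of even degree and of
generators of odd degree, of total degree `m`. -/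
inductive IsMonomial : ℕ → FreeGamma R X → Prop
  | one : IsMonomial 0 1
  | dp_mul (k n m : ℕ) (x : X (2 * n)) (y : FreeGamma R X) (hy : IsMonomial m y) :
      IsMonomial (2 * n * k + m) (dp R k n x * y)
  | odd_mul (n m : ℕ) (x : X (2 * n + 1)) (y : FreeGamma R X) (hy : IsMonomial m y) :
      IsMonomial (2 * n + 1 + m) (odd R n x * y)

/-- The grading of `Γ(X)`. -/
def grading (m : ℕ) : Submodule R (FreeGamma R X) := Submodule.span R {y | IsMonomial R X m y}

/-- The `Γ`-algebra structure of `Γ(X)`. It is determined by `γ k x = dp k x` for generators `x` of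
even degree, since `Γ(X)` is generated by the generators of odd degree and the divided powers of
the generators of even degree. -/
structure Gamma extends GammaAlgebra (grading R X) where
  γ_generator : ∀ k n, 0 < n → ∀ x : X (2 * n), γ k (dp R 1 n x) = dp R k n x

end FreeGamma

end FreeGamma

end GammaHopf

end

/-! In each degree, divide by the decomposable elements and then by the torsion of the quotient.
What remains is free, since `R` is a principal ideal domain. Lift a basis to elements x_i of A and
let f_i be the coordinate forms. A form is primitive in A♯ exactly when it satisfies the Leibniz
rule at the augmentation (`mem_primitives_iff_isDerivation`), so the f_i are primitive; they span
P(A♯), because a form that kills decomposables also kills whatever has a nonzero multiple among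
them. The x_i generate A only up to nonzero multiples (`exists_dualFamily`).

The heart of the proof is the matrix of pairings between words in the f_i and words in the x_i.
Contraction with a primitive form is a signed derivation of A (`contract_mul`), so it lowers the
filtration by powers of the augmentation ideal by at most one. Hence a word in the forms kills every
longer word in the x_i. On a word of the same length without repeated odd letters it vanishes unless
the two words are rearrangements of each other, and then its value is, up to sign, the product of
the factorials of the multiplicities (`formWord_word`). These factorials are exactly what divided
powers remove: against the monomials in divided powers of even x_i and in distinct odd x_i, the
matrix is triangular by word length with signs on the diagonal, over `R` itself and not only over
its fraction field (`isUnitriangular`).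

Both statements follow from this matrix. The coefficients of a combination of divided monomials are
controlled by its pairings modulo any ideal (`coeff_mem`): the zero ideal gives linear independence,
and the ideal (m) shows that the span contains a as soon as it contains ma with m nonzero. As the
x_i generate up to multiples, the divided monomials form a basis of A, which is (a) with X spanned
by the x_i (`presentation_bijective`). Dually, the words in the forms are independent, and a form
living in finitely many degrees is a combination of finitely many of them (`exists_mem_span_eq`).
The corresponding words span UP(A♯) by straightening (`span_uea_words`), where invertibility of 2
turns the square of an odd element into half a bracket. So UP(A♯) → A♯ carries a spanning family to
a basis, which is (b). -/

noncomputable section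

namespace GammaHopf

set_option linter.unusedSectionVars false

/-! ### Straightening of products of generators -/

section Straightening

variable {R B ι : Type*} [CommRing R] [Ring B] [Algebra R B]

/-- The span of the products of at most `n` of the elements `g i`. -/
def wordSpan (R : Type*) [CommRing R] [Algebra R B] (g : ι → B) (n : ℕ) : Submodule R B :=
  Submodule.span R {b | ∃ l : List ι, l.length ≤ n ∧ b = (l.map g).prod}

theorem prod_mem_wordSpan (g : ι → B) {l : List ι} {n : ℕ} (h : l.length ≤ n) :
    (l.map g).prod ∈ wordSpan R g n :=
  Submodule.subset_span ⟨l, h, rfl⟩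

theorem mul_mem_wordSpan {g : ι → B} (i : ι) {b : B} {n : ℕ} (hb : b ∈ wordSpan R g n) :
    g i * b ∈ wordSpan R g (n + 1) := by
  refine Submodule.span_induction (p := fun b _ => g i * b ∈ wordSpan R g (n + 1)) ?_ (by simp)
    (fun x y _ _ hx hy => by rw [mul_add]; exact Submodule.add_mem _ hx hy)
    (fun r x _ hx => by rw [mul_smul_comm]; exact Submodule.smul_mem _ r hx) hb
  rintro _ ⟨l, hl, rfl⟩
  exact prod_mem_wordSpan (l := i :: l) g (by simpa using hl)

theorem span_mul_prod_mem_wordSpan {g : ι → B} {v : B} (hv : v ∈ Submodule.span R (Set.range g))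
    {l : List ι} {n : ℕ} (h : l.length + 1 ≤ n) : v * (l.map g).prod ∈ wordSpan R g n := by
  refine Submodule.span_induction (p := fun b _ => b * (l.map g).prod ∈ wordSpan R g n) ?_
    (by simp) (fun x y _ _ hx hy => by rw [add_mul]; exact Submodule.add_mem _ hx hy)
    (fun r x _ hx => by rw [smul_mul_assoc]; exact Submodule.smul_mem _ r hx) hv
  rintro _ ⟨i, rfl⟩
  exact prod_mem_wordSpan (l := i :: l) g (by simpa using h)

/-- A transposition of adjacent letters changes the product by a scalar and by a word with two
letters replaced by a combination of single ones, hence shorter. Only one direction is needed, so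
the scalar need not be a unit. -/
theorem exists_sub_smul_prod_mem_wordSpan {g : ι → B} {c : ι → ι → R}
    (hcomm : ∀ i j, g i * g j - c i j • (g j * g i) ∈ Submodule.span R (Set.range g))
    {l l' : List ι} (h : l.Perm l') :
    ∀ n, l.length ≤ n + 1 → ∃ s : R, (l.map g).prod - s • (l'.map g).prod ∈ wordSpan R g n := by
  induction h with
  | nil => exact fun n _ => ⟨1, by simp⟩
  | @cons i l l' h ih =>
    intro n hn
    cases n with
    | zero =>
      have h1 : l = [] := by simpa using hn
      subst h1
      -- A word of length at most one has no other rearrangement, so no correction term arises even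
      -- though the bound is 0.
      rw [h.nil_eq]
      exact ⟨1, by simp⟩
    | succ n =>
      obtain ⟨s, hs⟩ := ih n (by simpa using hn)
      refine ⟨s, ?_⟩
      have := mul_mem_wordSpan i hs
      rwa [mul_sub, mul_smul_comm] at this
  | swap i j l =>
    intro n hn
    refine ⟨c j i, ?_⟩
    have := span_mul_prod_mem_wordSpan (hcomm j i) (l := l) (n := n) (by simpa using hn)
    rw [sub_mul, smul_mul_assoc] at this
    simpa [mul_assoc] using this
  | trans h1 h2 ih1 ih2 =>
    intro n hn
    obtain ⟨s, hs⟩ := ih1 n hn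
    obtain ⟨t, ht⟩ := ih2 n (by rwa [← h1.length_eq])
    refine ⟨s * t, ?_⟩
    have := Submodule.add_mem _ hs (Submodule.smul_mem _ s ht)
    rwa [smul_sub, smul_smul, sub_add_sub_cancel] at this

/-- If the generators `g i` of an algebra commute up to scalars and linear combinations of
generators, and the squares of the odd generators are linear combinations of generators, then the
algebra is spanned by any set of words that represents, up to order, all words without repetition
of odd generators. -/
theorem span_words_eq_top [DecidableEq ι] {g : ι → B} {c : ι → ι → R} {odd : ι → Prop}
    (hcomm : ∀ i j, g i * g j - c i j • (g j * g i) ∈ Submodule.span R (Set.range g))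
    (hsq : ∀ i, odd i → g i * g i ∈ Submodule.span R (Set.range g))
    (hgen : Algebra.adjoin R (Set.range g) = ⊤) {𝓛 : Set (List ι)}
    (h𝓛 : ∀ l : List ι, (∀ i, odd i → l.count i ≤ 1) → ∃ l' ∈ 𝓛, l.Perm l') :
    Submodule.span R ((fun l : List ι => (l.map g).prod) '' 𝓛) = ⊤ := by
  set T := Submodule.span R ((fun l : List ι => (l.map g).prod) '' 𝓛) with hT
  have key : ∀ n, ∀ l : List ι, l.length ≤ n → (l.map g).prod ∈ T := by
    intro n
    induction n with
    | zero =>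
      intro l hl
      have hl : l = [] := by simpa using hl
      subst hl
      obtain ⟨l', h1, h2⟩ := h𝓛 [] (by simp)
      rw [← h2.nil_eq] at h1
      exact Submodule.subset_span ⟨[], h1, rfl⟩
    | succ n ih =>
      -- By induction shorter words may be ignored, so letters may be rearranged freely up to
      -- scalars.
      have hW : wordSpan R g n ≤ T := Submodule.span_le.2 (by
        rintro _ ⟨l, hl, rfl⟩
        exact ih l hl)
      have step : ∀ l l' : List ι, l.length ≤ n + 1 → l.Perm l' → (l'.map g).prod ∈ T →
          (l.map g).prod ∈ T := by
        intro l l' hl hp hl'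
        obtain ⟨s, hs⟩ := exists_sub_smul_prod_mem_wordSpan hcomm hp n hl
        have := Submodule.add_mem _ (hW hs) (Submodule.smul_mem _ s hl')
        rwa [sub_add_cancel] at this
      intro l hl
      by_cases hodd : ∀ i, odd i → l.count i ≤ 1
      · obtain ⟨l', h1, h2⟩ := h𝓛 l hodd
        exact step l l' hl h2 (Submodule.subset_span ⟨l', h1, rfl⟩)
      · push Not at hodd
        obtain ⟨i, hi, hc⟩ := hodd
        have hi1 : i ∈ l := List.count_pos_iff.1 (by omega)
        have hi2 : i ∈ l.erase i := List.count_pos_iff.1 (by rw [List.count_erase_self]; omega)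
        -- A repeated odd letter is moved to the front twice; its square is a combination of
        -- generators, which shortens the word.
        have hp : l.Perm (i :: i :: (l.erase i).erase i) :=
          (List.perm_cons_erase hi1).trans ((List.perm_cons_erase hi2).cons i)
        refine step l _ hl hp (hW ?_)
        have h2 := hp.length_eq
        have := span_mul_prod_mem_wordSpan (hsq i hi) (l := (l.erase i).erase i) (n := n)
          (by simp only [List.length_cons] at h2; omega)
        simpa [mul_assoc] using this
  rw [eq_top_iff, ← Algebra.top_toSubmodule, ← hgen, Algebra.adjoin_eq_span, Submodule.span_le]
  intro b hb
  obtain ⟨l, hl, rfl⟩ := Submonoid.exists_list_of_mem_closure hb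
  have : ∃ l' : List ι, l = l'.map g := by
    clear hb
    induction l with
    | nil => exact ⟨[], rfl⟩
    | cons a l ih =>
      obtain ⟨i, rfl⟩ := hl a (by simp)
      obtain ⟨l', rfl⟩ := ih (fun y hy => hl y (by simp [hy]))
      exact ⟨i :: l', rfl⟩
  obtain ⟨l', rfl⟩ := this
  exact key _ l' le_rfl

end Straightening

/-! ### Dual families modulo torsion -/

section DualFamily

variable {R M : Type*} [CommRing R] [IsDomain R] [IsPrincipalIdealRing R] [AddCommGroup M]
  [Module R M] [Module.Finite R M]

/-- The quotient of M/D by its torsion is finitely generated and torsion-free over a principal ideal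
domain, hence free. The x's lift a basis and the f's are its coordinates. The remainder in the last
clause is zero in that quotient, so it is torsion modulo D. -/
theorem exists_dual_family (D : Submodule R M) :
    ∃ (k : ℕ) (x : Fin k → M) (f : Fin k → Module.Dual R M),
      (∀ i j, f i (x j) = if i = j then 1 else 0) ∧ (∀ i, ∀ a ∈ D, f i a = 0) ∧
      ∀ a, ∃ m : R, m ≠ 0 ∧ m • (a - ∑ i, f i a • x i) ∈ D := by
  let T := Submodule.torsion R (M ⧸ D)
  let π : M →ₗ[R] (M ⧸ D) ⧸ T := T.mkQ ∘ₗ D.mkQ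
  have hπ : Function.Surjective π := T.mkQ_surjective.comp D.mkQ_surjective
  obtain ⟨k, b⟩ : Σ k, Module.Basis (Fin k) R ((M ⧸ D) ⧸ T) :=
    Module.basisOfFiniteTypeTorsionFree'
  choose x hx using fun i => hπ (b i)
  refine ⟨k, x, fun i => b.coord i ∘ₗ π, ?_, ?_, ?_⟩
  · intro i j
    simp [hx, Finsupp.single_apply, eq_comm]
  · intro i a ha
    have h : π a = 0 := by
      simp [π, (Submodule.Quotient.mk_eq_zero D).2 ha]
    simp [h]
  · intro a
    have h : π (a - ∑ i, (b.coord i ∘ₗ π) a • x i) = 0 := by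
      simp only [map_sub, map_sum, map_smul, hx, LinearMap.comp_apply, Module.Basis.coord_apply]
      rw [b.sum_repr, sub_self]
    have h1 : D.mkQ (a - ∑ i, (b.coord i ∘ₗ π) a • x i) ∈ T :=
      (Submodule.Quotient.mk_eq_zero T).1 h
    obtain ⟨⟨m, hm⟩, h2⟩ := (Submodule.mem_torsion_iff _).1 h1
    refine ⟨m, nonZeroDivisors.ne_zero hm, ?_⟩
    rw [← Submodule.Quotient.mk_eq_zero D]
    exact h2

end DualFamily

/-! ### Arithmetic of the localization of ℤ at a prime. -/

section Localization

/-- Every ideal of a localization is extended from its preimage in the base ring, and a generator of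
the preimage generates the extension. -/
theorem isPrincipalIdealRing_of_isLocalization {S R : Type*} [CommRing S] [IsPrincipalIdealRing S]
    (M : Submonoid S) [CommRing R] [Algebra S R] [IsLocalization M R] :
    IsPrincipalIdealRing R where
  principal I := by
    rw [← IsLocalization.map_under M R I]
    obtain ⟨a, ha⟩ := (IsPrincipalIdealRing.principal (I.under S)).principal
    rw [ha]
    refine ⟨algebraMap S R a, ?_⟩
    change Ideal.map _ (Ideal.span {a}) = Ideal.span _
    rw [Ideal.map_span, Set.image_singleton]

theorem charZero_of_localization (p : ℕ) (R : Type*) [CommRing R] [(Ideal.span {(p : ℤ)}).IsPrime]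
    [IsLocalization.AtPrime R (Ideal.span {(p : ℤ)})] : CharZero R := by
  have h : Function.Injective (algebraMap ℤ R) :=
    IsLocalization.injective R (Ideal.span {(p : ℤ)}).primeCompl_le_nonZeroDivisors
  refine ⟨fun m n hmn => ?_⟩
  have : algebraMap ℤ R m = algebraMap ℤ R n := by simpa using hmn
  exact_mod_cast h this

/-- This is where p being odd enters: for odd x in a graded Lie algebra, [x, x] is 2x² in the
enveloping algebra, and x² itself has to be recovered from it. -/
theorem isUnit_two_of_localization (p : ℕ) (R : Type*) [CommRing R] [(Ideal.span {(p : ℤ)}).IsPrime]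
    [IsLocalization.AtPrime R (Ideal.span {(p : ℤ)})]
    (hp : p.Prime) (hp2 : p ≠ 2) : IsUnit (2 : R) := by
  have h : (2 : ℤ) ∈ (Ideal.span {(p : ℤ)}).primeCompl := by
    intro h
    have h1 : (p : ℤ) ∣ 2 := Ideal.mem_span_singleton.1 h
    have h2 : p ∣ 2 := by exact_mod_cast h1
    exact hp2 ((Nat.prime_dvd_prime_iff_eq hp Nat.prime_two).1 h2)
  simpa using IsLocalization.map_units R (⟨2, h⟩ : (Ideal.span {(p : ℤ)}).primeCompl)

end Localization

/-! ### Contraction with elements of the graded dual -/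

section Contract

variable {R : Type*} [CommRing R] {A : Type*} [Ring A] [Algebra R A]
variable {𝒜 : ℕ → Submodule R A} [GradedAlgebra 𝒜]

variable (𝒜) in
/-- The involution `x ↦ (-1) ^ (d * deg x) x`. -/
def twist (d : ℕ) : A →ₗ[R] A := degScale 𝒜 fun n => (-1 : R) ^ (d * n)

theorem twist_of_mem (d : ℕ) {n : ℕ} {x : A} (hx : x ∈ 𝒜 n) :
    twist 𝒜 d x = (-1 : R) ^ (d * n) • x :=
  degScale_of_mem _ hx

theorem twist_mul (d : ℕ) (x y : A) : twist 𝒜 d (x * y) = twist 𝒜 d x * twist 𝒜 d y := by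
  induction x using hom_induction 𝒜 with
  | zero => simp
  | add x x' h h' => simp only [add_mul, map_add, h, h']
  | hom i x hx =>
    induction y using hom_induction 𝒜 with
    | zero => simp
    | add y y' h h' => simp only [mul_add, map_add, h, h']
    | hom j y hy =>
      rw [twist_of_mem d hx, twist_of_mem d hy, twist_of_mem d (SetLike.mul_mem_graded hx hy),
        smul_mul_smul_comm, mul_add, pow_add]

variable [Coalgebra R A] [GradedHopfAlgebra 𝒜]

theorem counit_twist (d : ℕ) (x : A) :
    Coalgebra.counit (R := R) (twist 𝒜 d x) = Coalgebra.counit (R := R) x := by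
  induction x using hom_induction 𝒜 with
  | zero => simp
  | add x x' h h' => simp only [map_add, h, h']
  | hom i x hx =>
    rw [twist_of_mem d hx, map_smul]
    rcases eq_or_ne i 0 with rfl | hi
    · simp
    · rw [GradedHopfAlgebra.counit_eq_zero i hi x hx, smul_zero]

namespace GradedDual

/-- Contraction of the first factor of a tensor with a form, with the Koszul sign. -/
def contractLeft (f : GradedDual 𝒜) : A ⊗[R] A →ₗ[R] A :=
  (TensorProduct.lid R A).toLinearMap ∘ₗ LinearMap.rTensor A (toDual 𝒜 f) ∘ₗ koszul 𝒜

theorem contractLeft_tmul (f : GradedDual 𝒜) {i j : ℕ} {x y : A} (hx : x ∈ 𝒜 i) (hy : y ∈ 𝒜 j) :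
    contractLeft f (x ⊗ₜ[R] y) = ((-1 : R) ^ (i * j) * toDual 𝒜 f x) • y := by
  simp [contractLeft, koszul_tmul hx hy, mul_smul]

/-- The contraction `x ↦ ∑ (-1) ^ (deg x₁ * deg x₂) f x₁ • x₂`, where `Δ x = ∑ x₁ ⊗ x₂`. -/
def contract (f : GradedDual 𝒜) : A →ₗ[R] A := contractLeft f ∘ₗ Coalgebra.comul

/-- Right multiplication by the first factor is transposed to contraction: a product of forms is
evaluated by contracting with its leftmost factor and applying the rest. All later computations with
words peel off letters this way. -/
theorem toDual_mul_apply (f g : GradedDual 𝒜) (x : A) :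
    toDual 𝒜 (f * g) x = toDual 𝒜 g (contract f x) := by
  have h : ∀ t : A ⊗[R] A, ev 𝒜 (f ⊗ₜ[R] g) t =
      toDual 𝒜 g (TensorProduct.lid R A (LinearMap.rTensor A (toDual 𝒜 f) t)) := by
    intro t
    induction t using TensorProduct.induction_on with
    | zero => simp
    | add s t hs ht => simp only [map_add, hs, ht]
    | tmul a b => simp [ev_tmul]
  exact h _

theorem counit_contract (f : GradedDual 𝒜) (x : A) :
    Coalgebra.counit (R := R) (contract f x) = toDual 𝒜 f x := by
  rw [← one_apply (𝒜 := 𝒜), ← toDual_mul_apply, mul_one]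

/-- The forms that vanish on `1` and on products of elements of the augmentation ideal, stated as a
Leibniz rule. -/
def IsDerivation (f : GradedDual 𝒜) : Prop :=
  ∀ x y, toDual 𝒜 f (x * y) = toDual 𝒜 f x * Coalgebra.counit (R := R) y +
    Coalgebra.counit (R := R) x * toDual 𝒜 f y

/-- The sign can differ from 1 only if both degrees are positive, and then both augmentations
vanish. -/
theorem neg_one_pow_mul_leibniz (f : GradedDual 𝒜) {i j : ℕ} {x y : A} (hx : x ∈ 𝒜 i)
    (hy : y ∈ 𝒜 j) :
    (-1 : R) ^ (i * j) * (toDual 𝒜 f x * Coalgebra.counit (R := R) y +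
      Coalgebra.counit (R := R) x * toDual 𝒜 f y) =
    toDual 𝒜 f x * Coalgebra.counit (R := R) y + Coalgebra.counit (R := R) x * toDual 𝒜 f y := by
  rcases eq_or_ne i 0 with rfl | hi
  · simp
  rcases eq_or_ne j 0 with rfl | hj
  · simp
  rw [GradedHopfAlgebra.counit_eq_zero i hi x hx, GradedHopfAlgebra.counit_eq_zero j hj y hy]
  simp

theorem isDerivation_of_homogeneous {f : GradedDual 𝒜}
    (h : ∀ i j, ∀ x ∈ 𝒜 i, ∀ y ∈ 𝒜 j, toDual 𝒜 f (x * y) =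
      toDual 𝒜 f x * Coalgebra.counit (R := R) y + Coalgebra.counit (R := R) x * toDual 𝒜 f y) :
    IsDerivation f := by
  intro x y
  induction x using hom_induction 𝒜 with
  | zero => simp
  | add x x' h h' => simp only [add_mul, map_add, h, h']; ring
  | hom i x hx =>
    induction y using hom_induction 𝒜 with
    | zero => simp
    | add y y' h h' => simp only [mul_add, map_add, h, h']; ring
    | hom j y hy => exact h i j x hx y hy

/-- Expand Δ(xy) = Δx Δy. The Leibniz rule makes f of a product of first factors the sum of two
terms, and in each of them an augmentation collapses one diagonal by the counit law. The twist is
the sign for moving f, of degree d, past y. -/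
theorem contract_mul {f : GradedDual 𝒜} (hf : IsDerivation f) {d : ℕ} (hd : f ∈ grading 𝒜 d)
    (x y : A) : contract f (x * y) = x * contract f y + contract f x * twist 𝒜 d y := by
  let E : A ⊗[R] A →ₗ[R] A :=
    (TensorProduct.lid R A).toLinearMap ∘ₗ LinearMap.rTensor A (Coalgebra.counit (R := R))
  have hE : ∀ x, E (Coalgebra.comul (R := R) x) = x := fun x => by
    simp [E, Coalgebra.rTensor_counit_comul]
  -- The identity is bilinear and holds for all tensors, not only diagonals, so it can be checked on
  -- homogeneous pure tensors.
  have key : ∀ u v : A ⊗[R] A, contractLeft f ((GradedTensorProduct.of R 𝒜 𝒜).symm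
      (GradedTensorProduct.of R 𝒜 𝒜 u * GradedTensorProduct.of R 𝒜 𝒜 v)) =
      E u * contractLeft f v + contractLeft f u * twist 𝒜 d (E v) := by
    intro u v
    induction u using tensor_hom_induction 𝒜 with
    | zero => simp
    | add s t hs ht =>
      rw [LinearEquiv.map_add _ s t, add_mul, map_add, map_add, hs, ht]
      simp only [map_add, add_mul]
      abel
    | tmul i j x₁ hx₁ x₂ hx₂ =>
      induction v using tensor_hom_induction 𝒜 with
      | zero => simp
      | add s t hs ht =>
        rw [LinearEquiv.map_add _ s t, mul_add, map_add, map_add, hs, ht]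
        simp only [map_add, mul_add]
        abel
      | tmul k l y₁ hy₁ y₂ hy₂ =>
        rw [of_tmul_mul_of_tmul _ _ hx₂ hy₁, map_smul, GradedTensorProduct.of_symm_of, map_smul,
          contractLeft_tmul f (SetLike.mul_mem_graded hx₁ hy₁) (SetLike.mul_mem_graded hx₂ hy₂),
          contractLeft_tmul f hx₁ hx₂, contractLeft_tmul f hy₁ hy₂, hf]
        simp only [E, LinearMap.comp_apply, LinearMap.rTensor_tmul, LinearEquiv.coe_coe,
          TensorProduct.lid_tmul, map_smul, twist_of_mem d hy₂, smul_mul_smul_comm, smul_smul,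
          ← add_smul]
        congr 1
        -- The two signs are compared only where the terms are nonzero: ε(x₁) forces x₁ to have
        -- degree 0 in `h1`; in `h2`, ε(y₁) forces y₁ to have degree 0 and f(x₁) forces x₁ to have
        -- degree d.
        have h1 : (-1 : R) ^ (j * k) * (-1 : R) ^ ((i + k) * (j + l)) *
            (Coalgebra.counit (R := R) x₁ * toDual 𝒜 f y₁) =
            (-1 : R) ^ (k * l) * (Coalgebra.counit (R := R) x₁ * toDual 𝒜 f y₁) := by
          rcases eq_or_ne i 0 with rfl | hi
          · rw [← pow_add, show j * k + (0 + k) * (j + l) = 2 * (j * k) + k * l by ring, pow_add,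
              pow_mul]
            simp
          · rw [GradedHopfAlgebra.counit_eq_zero i hi _ hx₁]
            simp
        have h2 : (-1 : R) ^ (j * k) * (-1 : R) ^ ((i + k) * (j + l)) *
            (toDual 𝒜 f x₁ * Coalgebra.counit (R := R) y₁) =
            (-1 : R) ^ (i * j) * (-1 : R) ^ (d * l) *
              (toDual 𝒜 f x₁ * Coalgebra.counit (R := R) y₁) := by
          rcases eq_or_ne k 0 with rfl | hk
          · rcases eq_or_ne i d with rfl | hi
            · rw [← pow_add, ← pow_add]
              congr 2
              ring
            · rw [hd i hi _ hx₁]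
              simp
          · rw [GradedHopfAlgebra.counit_eq_zero k hk _ hy₁]
            simp
        linear_combination h1 + h2
  have h := key (Coalgebra.comul (R := R) x) (Coalgebra.comul (R := R) y)
  rw [← GradedHopfAlgebra.comul_mul, GradedTensorProduct.of_symm_of, hE, hE] at h
  exact h

/-- The diagonal of f pairs with x ⊗ y as f(xy) up to a Koszul sign, while f ⊗ 1 + 1 ⊗ f pairs as
the right side of the Leibniz rule, the unit of the dual being ε. The sign is harmless by
`neg_one_pow_mul_leibniz`, and the pairing is faithful by `ext_ev`. -/
theorem mem_primitives_iff_isDerivation [∀ n, Module.Finite R (𝒜 n)]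
    [∀ n, Module.Free R (𝒜 n)] {f : GradedDual 𝒜} :
    f ∈ primitives R (GradedDual 𝒜) ↔ IsDerivation f := by
  have h1 : ∀ x y, ev 𝒜 (f ⊗ₜ[R] 1 + 1 ⊗ₜ[R] f) (x ⊗ₜ[R] y) =
      toDual 𝒜 f x * Coalgebra.counit (R := R) y + Coalgebra.counit (R := R) x * toDual 𝒜 f y := by
    intro x y
    rw [map_add, LinearMap.add_apply, ev_tmul, ev_tmul, one_apply, one_apply]
  have hs : ∀ i j, (-1 : R) ^ (i * j) * (-1 : R) ^ (i * j) = 1 := by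
    intro i j
    rw [← mul_pow]
    simp
  rw [mem_primitives]
  constructor
  · intro hf
    refine isDerivation_of_homogeneous fun i j x hx y hy => ?_
    have := ev_comul f hx hy
    rw [hf, h1, ← neg_one_pow_mul_leibniz f hx hy] at this
    have h2 := congrArg (fun r => (-1 : R) ^ (i * j) * r) this
    simp only [← mul_assoc, hs, one_mul] at h2
    exact h2.symm
  · intro hf
    refine ext_ev fun i j x hx y hy => ?_
    rw [ev_comul f hx hy, hf, neg_one_pow_mul_leibniz f hx hy, h1]

end GradedDual

/-! ### The filtration by powers of the augmentation ideal -/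

variable (R A) in
/-- The powers of the augmentation ideal. -/
def augPow : ℕ → Submodule R A
  | 0 => ⊤
  | n + 1 => LinearMap.ker (Coalgebra.counit (R := R) (A := A)) * augPow n

theorem mul_mem_augPow {a b : A} {n : ℕ} (ha : Coalgebra.counit (R := R) a = 0)
    (hb : b ∈ augPow R A n) : a * b ∈ augPow R A (n + 1) :=
  Submodule.mul_mem_mul ha hb

theorem counit_eq_zero_of_mem_augPow (𝒜 : ℕ → Submodule R A) [GradedAlgebra 𝒜]
    [GradedHopfAlgebra 𝒜] {n : ℕ} {a : A} (ha : a ∈ augPow R A (n + 1)) :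
    Coalgebra.counit (R := R) a = 0 := by
  refine Submodule.mul_induction_on (C := fun a => Coalgebra.counit (R := R) a = 0) ha ?_ ?_
  · intro x hx y _
    rw [GradedHopfAlgebra.counit_mul (𝒜 := 𝒜), LinearMap.mem_ker.1 hx, zero_mul]
  · intro x y hx hy
    rw [map_add, hx, hy, add_zero]

theorem mul_mem_augPow_left (𝒜 : ℕ → Submodule R A) [GradedAlgebra 𝒜] [GradedHopfAlgebra 𝒜]
    (a : A) {b : A} {n : ℕ} (hb : b ∈ augPow R A n) :
    a * b ∈ augPow R A n := by
  cases n with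
  | zero => exact Submodule.mem_top
  | succ n =>
    refine Submodule.mul_induction_on (C := fun b => a * b ∈ augPow R A (n + 1)) hb ?_ ?_
    · intro x hx y hy
      rw [← mul_assoc]
      refine mul_mem_augPow ?_ hy
      rw [GradedHopfAlgebra.counit_mul (𝒜 := 𝒜), LinearMap.mem_ker.1 hx, mul_zero]
    · intro x y hx hy
      rw [mul_add]
      exact Submodule.add_mem _ hx hy

/-- The twist is multiplicative and preserves the augmentation, hence respects powers of its kernel.
-/
theorem twist_mem_augPow (d : ℕ) {n : ℕ} {a : A} (ha : a ∈ augPow R A n) :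
    twist 𝒜 d a ∈ augPow R A n := by
  induction n generalizing a with
  | zero => exact Submodule.mem_top
  | succ n ih =>
    refine Submodule.mul_induction_on (C := fun b => twist 𝒜 d b ∈ augPow R A (n + 1)) ha ?_ ?_
    · intro x hx y hy
      rw [twist_mul]
      refine mul_mem_augPow ?_ (ih hy)
      rw [counit_twist, LinearMap.mem_ker.1 hx]
    · intro x y hx hy
      rw [map_add]
      exact Submodule.add_mem _ hx hy

/-- In the derivation formula for a product of an element of the augmentation ideal I with one of a
power of I, either the second factor is contracted and loses one power while the first supplies one,
or the first is contracted and the second keeps all its powers. -/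
theorem contract_mem_augPow {f : GradedDual 𝒜} (hf : f.IsDerivation) {d : ℕ}
    (hd : f ∈ GradedDual.grading 𝒜 d) {n : ℕ} {a : A} (ha : a ∈ augPow R A (n + 1)) :
    f.contract a ∈ augPow R A n := by
  induction n generalizing a with
  | zero => exact Submodule.mem_top
  | succ n ih =>
    refine Submodule.mul_induction_on (C := fun b => f.contract b ∈ augPow R A (n + 1)) ha ?_ ?_
    · intro x hx y hy
      rw [GradedDual.contract_mul hf hd]
      exact Submodule.add_mem _ (mul_mem_augPow hx (ih hy))
        (mul_mem_augPow_left 𝒜 _ (twist_mem_augPow d hy))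
    · intro x y hx hy
      rw [map_add]
      exact Submodule.add_mem _ hx hy

end Contract

/-! ### The pairing between words in primitive forms and words in dual elements -/

section Weight

variable {ι : Type*} [DecidableEq ι]

/-- The product of the factorials of the multiplicities of the letters of a word. -/
def wordWeight (l : List ι) : ℕ := ∏ i ∈ l.toFinset, (l.count i).factorial

theorem wordWeight_eq_prod {l : List ι} {s : Finset ι} (hs : l.toFinset ⊆ s) :
    wordWeight l = ∏ i ∈ s, (l.count i).factorial := by
  refine Finset.prod_subset hs fun i _ hi => ?_
  rw [List.count_eq_zero_of_not_mem (by simpa using hi), Nat.factorial_zero]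

/-- The recursion matches contraction, which removes one occurrence of a letter and multiplies by
its multiplicity. -/
theorem wordWeight_eq_count_mul {l : List ι} {i : ι} (hi : i ∈ l) :
    wordWeight l = l.count i * wordWeight (l.erase i) := by
  have h1 : (l.erase i).toFinset ⊆ l.toFinset := fun j hj => by
    simpa using List.mem_of_mem_erase (by simpa using hj)
  have h2 : i ∈ l.toFinset := by simpa using hi
  rw [wordWeight_eq_prod h1, wordWeight, ← Finset.mul_prod_erase _ _ h2,
    ← Finset.mul_prod_erase _ _ h2, List.count_erase_self, ← mul_assoc,
    Nat.mul_factorial_pred (List.count_pos_iff.2 hi).ne']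
  congr 1
  refine Finset.prod_congr rfl fun j hj => ?_
  rw [List.count_erase_of_ne (Finset.ne_of_mem_erase hj)]

theorem wordWeight_ne_zero (l : List ι) : wordWeight l ≠ 0 :=
  Finset.prod_ne_zero_iff.2 fun _ _ => Nat.factorial_ne_zero _

end Weight

section Pairing

variable {R : Type*} [CommRing R] {A : Type*} [Ring A] [Algebra R A]
variable (𝒜 : ℕ → Submodule R A) [GradedAlgebra 𝒜] [Coalgebra R A] [GradedHopfAlgebra 𝒜]

/-- A family of homogeneous elements of positive degree together with a dual family of
derivations at the augmentation. -/
structure DualFamily (ι : Type*) where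
  deg : ι → ℕ
  gen : ι → A
  form : ι → GradedDual 𝒜
  deg_pos : ∀ i, 0 < deg i
  gen_mem : ∀ i, gen i ∈ 𝒜 (deg i)
  form_mem : ∀ i, form i ∈ GradedDual.grading 𝒜 (deg i)
  isDerivation : ∀ i, (form i).IsDerivation
  form_gen_self : ∀ i, GradedDual.toDual 𝒜 (form i) (gen i) = 1
  form_gen_ne : ∀ i j, i ≠ j → GradedDual.toDual 𝒜 (form i) (gen j) = 0

namespace DualFamily

variable {𝒜} {ι : Type*} (F : DualFamily 𝒜 ι)

/-- The product of the elements `F.gen i` over a word. -/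
def word (l : List ι) : A := (l.map F.gen).prod

/-- The product of the forms `F.form i` over a word. -/
def formWord (l : List ι) : GradedDual 𝒜 := (l.map F.form).prod

theorem word_cons (i : ι) (l : List ι) : F.word (i :: l) = F.gen i * F.word l := by
  simp [word]

theorem formWord_cons (i : ι) (l : List ι) : F.formWord (i :: l) = F.form i * F.formWord l := by
  simp [formWord]

theorem counit_gen (i : ι) : Coalgebra.counit (R := R) (F.gen i) = 0 :=
  GradedHopfAlgebra.counit_eq_zero _ (F.deg_pos i).ne' _ (F.gen_mem i)

theorem word_mem (l : List ι) : F.word l ∈ 𝒜 (l.map F.deg).sum := by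
  induction l with
  | nil => simpa [word] using SetLike.one_mem_graded 𝒜
  | cons i l ih =>
    rw [word_cons]
    simpa using SetLike.mul_mem_graded (F.gen_mem i) ih

theorem formWord_mem (l : List ι) :
    F.formWord l ∈ GradedDual.grading 𝒜 (l.map F.deg).sum := by
  induction l with
  | nil => simpa [formWord] using SetLike.one_mem_graded (GradedDual.grading 𝒜)
  | cons i l ih =>
    rw [formWord_cons]
    simpa using SetLike.mul_mem_graded (F.form_mem i) ih

theorem word_mem_augPow (l : List ι) : F.word l ∈ augPow R A l.length := by
  induction l with
  | nil => exact Submodule.mem_top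
  | cons i l ih =>
    rw [word_cons]
    exact mul_mem_augPow (F.counit_gen i) ih

theorem twist_word (d : ℕ) (l : List ι) :
    ∃ s : R, (s = 1 ∨ s = -1) ∧ (Even d → s = 1) ∧ twist 𝒜 d (F.word l) = s • F.word l :=
  ⟨_, neg_one_pow_eq_or R _, fun h => (h.mul_right _).neg_one_pow, twist_of_mem d (F.word_mem l)⟩

/-- Letters of even degree commute with everything and can be pulled to the front without a sign. -/
theorem gen_mul_word_erase [DecidableEq ι] (hc : IsGradedCommutative 𝒜) {i : ι}
    (hi : Even (F.deg i)) {l : List ι} (hl : i ∈ l) : F.gen i * F.word (l.erase i) = F.word l := by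
  induction l with
  | nil => simp at hl
  | cons j l ih =>
    by_cases h : j = i
    · subst h
      rw [List.erase_cons_head, word_cons]
    · have hl' : i ∈ l := by
        rcases List.mem_cons.1 hl with h' | h'
        · exact absurd h'.symm h
        · exact h'
      rw [List.erase_cons_tail (by simpa using h), word_cons, word_cons, ← ih hl', ← mul_assoc,
        hc _ _ _ (F.gen_mem i) _ (F.gen_mem j), (hi.mul_right _).neg_one_pow, one_smul, mul_assoc]

/-- The augmentation of a contraction is the value of the form, so modulo the augmentation ideal
contracting a generator gives the Kronecker delta. -/
theorem counit_contract_gen [DecidableEq ι] (i j : ι) : Coalgebra.counit (R := R)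
    ((F.form i).contract (F.gen j) - (if i = j then (1 : R) else 0) • (1 : A)) = 0 := by
  rw [map_sub, GradedDual.counit_contract, map_smul, GradedHopfAlgebra.counit_one (𝒜 := 𝒜)]
  split_ifs with h
  · subst h
    simp [F.form_gen_self]
  · simp [F.form_gen_ne i j h]

variable [DecidableEq ι]

/-- Leading term of the derivation rule: each occurrence of the letter i is deleted in turn, and all
else lies one step deeper in the filtration. For even i all deletions carry the sign +1 and give the
same word, so they add up to the multiplicity. For odd i there is at most one deletion, with an
unspecified sign. -/
theorem contract_word (hc : IsGradedCommutative 𝒜) (i : ι) (l : List ι)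
    (hl : Odd (F.deg i) → l.count i ≤ 1) :
    ∃ s : R, (s = 1 ∨ s = -1) ∧ (Even (F.deg i) → s = 1) ∧
      (F.form i).contract (F.word l) - (s * l.count i) • F.word (l.erase i) ∈
        augPow R A l.length := by
  induction l with
  | nil => exact ⟨1, .inl rfl, fun _ => rfl, Submodule.mem_top⟩
  | cons j l ih =>
    obtain ⟨s, hs, hs', h⟩ := ih fun ho => le_trans (by rw [List.count_cons]; omega) (hl ho)
    obtain ⟨t, ht, ht', htw⟩ := F.twist_word (F.deg i) l
    -- The two halves of the derivation rule for the head letter times the tail: `h1` is the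
    -- contraction of the tail, `h2` that of the head letter, with its leading scalar split off.
    have h1 := mul_mem_augPow (F.counit_gen j) h
    have h2 := mul_mem_augPow (F.counit_contract_gen i j)
      (Submodule.smul_mem _ t (F.word_mem_augPow l))
    have h3 := Submodule.add_mem _ h1 h2
    rw [mul_sub, sub_mul, ← htw, add_comm, sub_add_sub_comm, add_comm, add_comm _ (_ * _),
      add_comm _ (F.gen j * _), htw, ← htw, ← GradedDual.contract_mul (F.isDerivation i)
      (F.form_mem i), ← word_cons] at h3
    by_cases hij : j = i
    · subst hij
      rw [List.erase_cons_head, List.count_cons_self]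
      rcases Nat.even_or_odd (F.deg j) with he | ho
      · refine ⟨1, .inl rfl, fun _ => rfl, ?_⟩
        rw [htw, ht' he, hs' he] at h3
        by_cases hjl : j ∈ l
        · simpa [F.gen_mul_word_erase hc he hjl, add_smul, add_comm] using h3
        · simpa [List.count_eq_zero_of_not_mem hjl] using h3
      · have h0 : l.count j = 0 := by
          have := hl ho
          rw [List.count_cons_self] at this
          omega
        refine ⟨t, ht, ht', ?_⟩
        rw [htw] at h3
        simpa [h0] using h3
    · refine ⟨s, hs, hs', ?_⟩
      rw [List.erase_cons_tail (by simpa using hij), List.count_cons_of_ne hij, word_cons]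
      simpa [Ne.symm hij, ← word_cons] using h3

/-- Each letter of the form word costs at most one power of the augmentation ideal, so at least one
power remains at the end, where the empty form word ε kills it. -/
theorem formWord_apply_of_mem_augPow {l : List ι} {n : ℕ} (hn : l.length < n) {a : A}
    (ha : a ∈ augPow R A n) : GradedDual.toDual 𝒜 (F.formWord l) a = 0 := by
  induction l generalizing n a with
  | nil =>
    obtain ⟨n, rfl⟩ := Nat.exists_eq_succ_of_ne_zero hn.ne'
    exact counit_eq_zero_of_mem_augPow 𝒜 ha
  | cons i l ih =>
    obtain ⟨n, rfl⟩ := Nat.exists_eq_succ_of_ne_zero (Nat.ne_zero_of_lt hn)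
    rw [formWord_cons, GradedDual.toDual_mul_apply]
    exact ih (by simpa using hn) (contract_mem_augPow (F.isDerivation i) (F.form_mem i) ha)

theorem formWord_word_of_length_lt {l l' : List ι} (h : l.length < l'.length) :
    GradedDual.toDual 𝒜 (F.formWord l) (F.word l') = 0 :=
  F.formWord_apply_of_mem_augPow h (F.word_mem_augPow l')

/-- Contract with the first letter: the error term of `contract_word` is too deep in the filtration
to be seen by the remaining letters, and the leading term is the multiplicity times a shorter
pairing of the same kind. If the letter is absent from the other word, the multiplicity is 0. -/
theorem formWord_word (hc : IsGradedCommutative 𝒜) {l l' : List ι} (h : l.length = l'.length)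
    (hl' : ∀ i, Odd (F.deg i) → l'.count i ≤ 1) :
    (¬ l.Perm l' → GradedDual.toDual 𝒜 (F.formWord l) (F.word l') = 0) ∧
    (l.Perm l' → ∃ s : R, (s = 1 ∨ s = -1) ∧
      GradedDual.toDual 𝒜 (F.formWord l) (F.word l') = s * wordWeight l') := by
  induction l generalizing l' with
  | nil =>
    have h' : l' = [] := List.length_eq_zero_iff.1 (by simpa using h.symm)
    subst h'
    refine ⟨fun h => absurd (List.Perm.refl _) h, fun _ => ⟨1, .inl rfl, ?_⟩⟩
    have : GradedDual.toDual 𝒜 (F.formWord []) (F.word []) = 1 :=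
      GradedHopfAlgebra.counit_one (𝒜 := 𝒜)
    simp [this, wordWeight]
  | cons i l ih =>
    obtain ⟨s, hs, -, hm⟩ := F.contract_word hc i l' (hl' i)
    have h1 := F.formWord_apply_of_mem_augPow (l := l) (by rw [← h]; simp) hm
    rw [map_sub, map_smul, sub_eq_zero, ← GradedDual.toDual_mul_apply, ← formWord_cons,
      smul_eq_mul] at h1
    by_cases hi : i ∈ l'
    · have hlen : l.length = (l'.erase i).length := by
        rw [List.length_erase_of_mem hi, ← h]
        simp
      obtain ⟨ih1, ih2⟩ := ih hlen fun j hj => le_trans (List.erase_sublist.count_le j) (hl' j hj)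
      rw [h1, List.cons_perm_iff_perm_erase]
      refine ⟨fun hp => ?_, fun hp => ?_⟩
      · rw [ih1 fun h => hp ⟨hi, h⟩, mul_zero]
      · obtain ⟨t, ht, ht'⟩ := ih2 hp.2
        refine ⟨s * t, ?_, ?_⟩
        · rcases hs with rfl | rfl <;> rcases ht with rfl | rfl <;> simp
        · rw [ht', wordWeight_eq_count_mul hi]
          push_cast
          ring
    · refine ⟨fun _ => ?_, fun hp => absurd (hp.subset (by simp)) hi⟩
      rw [h1, List.count_eq_zero_of_not_mem hi]
      simp

end DualFamily

end Pairing

/-! ### Unitriangular pairings -/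

section Unitriangular

variable {R M 𝓘 : Type*} [CommRing R] [AddCommGroup M] [Module R M]

/-- A family of forms and a family of vectors whose matrix is triangular with respect to a
function `size`, with signs on the diagonal. -/
structure IsUnitriangular (size : 𝓘 → ℕ) (φ : 𝓘 → Module.Dual R M) (v : 𝓘 → M) : Prop where
  of_lt : ∀ α β, size α < size β → φ α (v β) = 0
  of_eq : ∀ α β, size α = size β → α ≠ β → φ α (v β) = 0
  diag : ∀ α, φ α (v α) = 1 ∨ φ α (v α) = -1

namespace IsUnitriangular

variable {size : 𝓘 → ℕ} {φ : 𝓘 → Module.Dual R M} {v : 𝓘 → M}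

/-- Induction on the size: in the pairing with φ α, vectors of larger size contribute nothing, those
of smaller size have coefficients already in I, and equal size leaves only ± c α. Taking I to be
zero gives independence; I = (m) gives divisibility of the coefficients. -/
theorem coeff_mem (h : IsUnitriangular size φ v) (I : Ideal R) (c : 𝓘 →₀ R)
    (hc : ∀ α, φ α (Finsupp.linearCombination R v c) ∈ I)
    (α : 𝓘) : c α ∈ I := by
  classical
  induction hn : size α using Nat.strong_induction_on generalizing α with
  | _ n ih =>
    have h1 := hc α
    rw [Finsupp.linearCombination_apply, Finsupp.sum, map_sum] at h1
    simp only [map_smul, smul_eq_mul] at h1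
    have h2 : c α * φ α (v α) ∈ I := by
      by_cases hα : α ∈ c.support
      · rw [← Finset.add_sum_erase _ _ hα] at h1
        refine (Submodule.add_mem_iff_left I (Ideal.sum_mem I fun β hβ => ?_)).1 h1
        rcases lt_trichotomy (size β) (size α) with hlt | heq | hgt
        · exact I.mul_mem_right _ (ih _ (hn ▸ hlt) β rfl)
        · rw [h.of_eq α β heq.symm (Finset.ne_of_mem_erase hβ).symm, mul_zero]
          exact I.zero_mem
        · rw [h.of_lt α β hgt, mul_zero]
          exact I.zero_mem
      · rw [Finsupp.notMem_support_iff.1 hα, zero_mul]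
        exact I.zero_mem
    rcases h.diag α with h3 | h3 <;> simpa [h3] using h2

theorem linearIndependent (h : IsUnitriangular size φ v) : LinearIndependent R v := by
  rw [linearIndependent_iff]
  intro c hc
  ext α
  exact h.coeff_mem ⊥ c (fun β => by simp [hc]) α

/-- All pairings of ma are divisible by m, hence so are its coefficients, and m can be cancelled.
Thus the span is saturated although only its multiples are known to fill the module. -/
theorem mem_span_of_smul_mem [IsDomain R] [Module.IsTorsionFree R M]
    (h : IsUnitriangular size φ v) {m : R} (hm : m ≠ 0) {a : M}
    (ha : m • a ∈ Submodule.span R (Set.range v)) : a ∈ Submodule.span R (Set.range v) := by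
  rw [Finsupp.mem_span_range_iff_exists_finsupp] at ha
  obtain ⟨c, hc⟩ := ha
  have h1 := h.coeff_mem (Ideal.span {m}) c fun α => by
    rw [Finsupp.linearCombination_apply, hc, map_smul, smul_eq_mul]
    exact Ideal.mul_mem_right _ _ (Ideal.mem_span_singleton_self m)
  choose q hq using fun α => Ideal.mem_span_singleton'.1 (h1 α)
  have h2 : m • a = m • c.sum fun α _ => q α • v α := by
    rw [← hc, Finsupp.sum, Finsupp.sum, Finset.smul_sum]
    refine Finset.sum_congr rfl fun α _ => ?_
    rw [smul_smul, ← hq, mul_comm]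
  rw [smul_right_injective M hm h2]
  exact Submodule.sum_mem _ fun α _ =>
    Submodule.smul_mem _ _ (Submodule.subset_span ⟨α, rfl⟩)

/-- In a relation choose an index of maximal size in the support and evaluate at its vector: every
other term vanishes. -/
theorem linearIndependent_dual (h : IsUnitriangular size φ v) : LinearIndependent R φ := by
  classical
  rw [linearIndependent_iff]
  intro c hc
  by_contra hne
  obtain ⟨α, hα, hmax⟩ :=
    Finset.exists_max_image c.support size (Finsupp.support_nonempty_iff.2 hne)
  have h1 := LinearMap.congr_fun hc (v α)
  rw [Finsupp.linearCombination_apply, Finsupp.sum, LinearMap.sum_apply,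
    Finset.sum_eq_single α] at h1
  · refine Finsupp.mem_support_iff.1 hα ?_
    rcases h.diag α with h3 | h3 <;> simpa [h3] using h1
  · intro β hβ hne
    rw [LinearMap.smul_apply]
    rcases (hmax β hβ).lt_or_eq with h2 | h2
    · rw [h.of_lt β α h2, smul_zero]
    · rw [h.of_eq β α h2 hne, smul_zero]
  · exact fun h2 => absurd hα h2

/-- Back substitution from the largest size downwards. The first condition on T keeps the subtracted
forms zero on the vectors outside T, so the induction never leaves T. -/
theorem exists_mem_span_eq (h : IsUnitriangular size φ v) (T : Finset 𝓘)
    (hT : ∀ α ∈ T, ∀ β ∉ T, φ α (v β) = 0)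
    (g : Module.Dual R M) (hg : ∀ β ∉ T, g (v β) = 0) :
    ∃ g' ∈ Submodule.span R (φ '' T), ∀ β, g (v β) = g' (v β) := by
  classical
  have key : ∀ n : ℕ, ∀ g : Module.Dual R M, (∀ β ∉ T, g (v β) = 0) →
      (∀ β, n ≤ size β → g (v β) = 0) →
      ∃ g' ∈ Submodule.span R (φ '' T), ∀ β, g (v β) = g' (v β) := by
    intro n
    induction n with
    | zero => exact fun g _ hg => ⟨0, Submodule.zero_mem _, fun β => by simp [hg β (Nat.zero_le _)]⟩
    | succ n ih =>
      intro g hg hn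
      let S := T.filter fun α => size α = n
      -- The diagonal entry is ±1, hence its own inverse, so these coefficients make `g₁` agree with
      -- g on vectors of size n. On larger vectors `g₁` vanishes by triangularity.
      let g₁ : Module.Dual R M := ∑ α ∈ S, (φ α (v α) * g (v α)) • φ α
      have hg₁ : g₁ ∈ Submodule.span R (φ '' T) := Submodule.sum_mem _ fun α hα =>
        Submodule.smul_mem _ _ (Submodule.subset_span ⟨α, (Finset.mem_filter.1 hα).1, rfl⟩)
      have hsq : ∀ α, φ α (v α) * φ α (v α) = 1 := fun α => by
        rcases h.diag α with h3 | h3 <;> simp [h3]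
      have happly : ∀ β, g₁ (v β) = ∑ α ∈ S, φ α (v α) * g (v α) * φ α (v β) := fun β => by
        simp [g₁, LinearMap.sum_apply]
      obtain ⟨g', hg', h'⟩ := ih (g - g₁)
        (fun β hβ => by
          rw [LinearMap.sub_apply, hg β hβ, happly, Finset.sum_eq_zero, sub_zero]
          intro α hα
          rw [hT α (Finset.mem_filter.1 hα).1 β hβ, mul_zero])
        (fun β hβ => by
          rw [LinearMap.sub_apply, happly]
          rcases hβ.eq_or_lt with h1 | h1
          · by_cases hβT : β ∈ T
            · rw [Finset.sum_eq_single β]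
              · linear_combination (-g (v β)) * hsq β
              · intro α hα hne
                rw [h.of_eq α β ((Finset.mem_filter.1 hα).2.trans h1) hne, mul_zero]
              · exact fun h2 => absurd (Finset.mem_filter.2 ⟨hβT, h1.symm⟩) h2
            · rw [hg β hβT, Finset.sum_eq_zero, sub_zero]
              intro α hα
              rw [hT α (Finset.mem_filter.1 hα).1 β hβT, mul_zero]
          · rw [hn β h1, Finset.sum_eq_zero, sub_zero]
            intro α hα
            rw [h.of_lt α β (by rw [(Finset.mem_filter.1 hα).2]; exact h1), mul_zero])
      refine ⟨g₁ + g', Submodule.add_mem _ hg₁ hg', fun β => ?_⟩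
      rw [LinearMap.add_apply, ← h' β, LinearMap.sub_apply]
      ring
  -- Above the largest size occurring in T, g vanishes by hypothesis.
  refine key (T.sup size + 1) g hg fun β hβ => hg β fun hβT => ?_
  have := Finset.le_sup (f := size) hβT
  omega

end IsUnitriangular

end Unitriangular

/-! ### Divided powers in torsion-free rings -/

section DividedPowers

variable {R A M : Type*} [CommRing R] [Ring A] [Algebra R A] [IsAddTorsionFree A]
  [AddCommGroup M] [Module R M]

theorem center_of_nsmul_mem {n : ℕ} (hn : n ≠ 0) {a : A}
    (ha : n • a ∈ Subalgebra.center R A) : a ∈ Subalgebra.center R A := by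
  rw [Subalgebra.mem_center_iff] at ha ⊢
  intro b
  have h := ha b
  rw [mul_smul_comm, smul_mul_assoc] at h
  exact nsmul_right_injective hn h

/-- The binomial theorem, with each binomial coefficient absorbed by the factorials. -/
theorem exists_dividedPower_add {A : Type*} [Ring A] {a b : A} (hab : Commute a b)
    (ha : ∀ k : ℕ, ∃ c, k.factorial • c = a ^ k) (hb : ∀ k : ℕ, ∃ c, k.factorial • c = b ^ k) :
    ∀ k : ℕ, ∃ c, k.factorial • c = (a + b) ^ k := by
  choose ca hca using ha
  choose cb hcb using hb
  refine fun k => ⟨∑ i ∈ Finset.range (k + 1), ca i * cb (k - i), ?_⟩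
  rw [hab.add_pow, Finset.smul_sum]
  refine Finset.sum_congr rfl fun i hi => ?_
  have hik : i ≤ k := Nat.lt_succ_iff.1 (Finset.mem_range.1 hi)
  rw [← hca, ← hcb, ← Nat.choose_mul_factorial_mul_factorial hik, ← nsmul_eq_mul',
    smul_mul_smul_comm, smul_smul, mul_assoc]

/-- Without torsion the equation k! γ_k = a^k determines γ_k, so identities between divided powers
follow from identities between powers after multiplication by factorials. -/
theorem dividedPower_mul {a : A} {γ : ℕ → A} (hγ : ∀ k : ℕ, k.factorial • γ k = a ^ k) (j k : ℕ) :
    γ j * γ k = (j + k).choose j • γ (j + k) := by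
  refine nsmul_right_injective
    (mul_ne_zero (Nat.factorial_ne_zero j) (Nat.factorial_ne_zero k)) ?_
  change (_ * _) • _ = (_ * _) • _
  rw [← smul_mul_smul_comm, hγ, hγ, smul_smul, ← pow_add, ← hγ,
    ← Nat.add_choose_mul_factorial_mul_factorial j k, Nat.choose_symm_add]
  congr 1
  ring

theorem dividedPower_add {a b : A} (hab : Commute a b) {γa γb γ : ℕ → A}
    (ha : ∀ k : ℕ, k.factorial • γa k = a ^ k) (hb : ∀ k : ℕ, k.factorial • γb k = b ^ k)
    (h : ∀ k : ℕ, k.factorial • γ k = (a + b) ^ k) (k : ℕ) :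
    γ k = ∑ q ∈ Finset.HasAntidiagonal.antidiagonal k, γa q.1 * γb q.2 := by
  refine nsmul_right_injective (Nat.factorial_ne_zero k) ?_
  change _ • _ = _ • _
  rw [h, hab.add_pow', Finset.smul_sum]
  refine Finset.sum_congr rfl fun q hq => ?_
  rw [← Finset.HasAntidiagonal.mem_antidiagonal.1 hq, ← ha, ← hb, smul_mul_smul_comm, smul_smul,
    ← Nat.add_choose_mul_factorial_mul_factorial q.1 q.2, Nat.choose_symm_add, mul_assoc]

/-- A linear map to a torsion-free algebra whose values are central and have divided powers
extends to the divided power algebra. -/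
theorem exists_dividedPowerAlgebra_lift (φ : M →ₗ[R] A)
    (hc : ∀ m, φ m ∈ Subalgebra.center R A)
    (hφ : ∀ m, ∀ k : ℕ, ∃ c, k.factorial • c = φ m ^ k) :
    ∃ Φ : DividedPowerAlgebra R M →ₐ[R] A, (∀ u, Φ u ∈ Subalgebra.center R A) ∧
      ∀ k m, k.factorial • Φ (DividedPowerAlgebra.dp R k m) = φ m ^ k := by
  choose γ hγ using hφ
  -- Divided powers of a central element are central, again by cancelling the factorial; the
  -- universal property can then be applied with the commutative center as target.
  have hγc : ∀ m k, γ m k ∈ Subalgebra.center R A := fun m k =>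
    center_of_nsmul_mem (Nat.factorial_ne_zero k) (by rw [hγ]; exact pow_mem (hc m) k)
  let f : ℕ × M → Subalgebra.center R A := fun q => ⟨γ q.2 q.1, hγc _ _⟩
  let Φ : DividedPowerAlgebra R M →ₐ[R] Subalgebra.center R A :=
    DividedPowerAlgebra.lift' (f := f)
      (fun m => Subtype.ext (show γ m 0 = 1 by simpa using hγ m 0))
      (fun n r m => Subtype.ext (by
        refine nsmul_right_injective (Nat.factorial_ne_zero n) ?_
        change _ • γ (r • m) n = _ • (r ^ n • γ m n)
        rw [hγ, map_smul, smul_pow, ← hγ, smul_comm]))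
      (fun n q m => Subtype.ext (dividedPower_mul (hγ m) n q))
      (fun n u w => Subtype.ext (by
        rw [AddSubmonoidClass.coe_finsetSum]
        exact dividedPower_add ((Subalgebra.mem_center_iff.1 (hc w) (φ u)))
          (hγ u) (hγ w) (fun k => by rw [hγ, map_add]) n))
  refine ⟨(Subalgebra.center R A).val.comp Φ, fun u => (Φ u).2, fun k m => ?_⟩
  have : Φ (DividedPowerAlgebra.dp R k m) = f (k, m) :=
    DividedPowerAlgebra.lift'_apply_dp _ _ _ _ _ _
  rw [AlgHom.comp_apply, this]
  exact hγ m k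

end DividedPowers

/-! ### Monomials -/

section Monomials

variable {R : Type*} [CommRing R] {A : Type*} [Ring A] [Algebra R A]
variable {𝒜 : ℕ → Submodule R A} [GradedAlgebra 𝒜] [Coalgebra R A] [GradedHopfAlgebra 𝒜]

namespace DualFamily

variable {ι : Type*} (F : DualFamily 𝒜 ι)

/-- The exponents of monomials: natural numbers for the even indices and a finite set of odd
indices. -/
abbrev Exponent : Type _ := ({i // Even (F.deg i)} →₀ ℕ) × Finset {i // Odd (F.deg i)}

variable {F} in
/-- A word with given exponents. -/
def Exponent.toWord (α : F.Exponent) : List ι :=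
  (Finsupp.toMultiset α.1).toList.map Subtype.val ++ α.2.toList.map Subtype.val

variable [DecidableEq ι]

theorem count_toWord_even (α : F.Exponent) (i : {i // Even (F.deg i)}) :
    α.toWord.count (i : ι) = α.1 i := by
  have h : (i : ι) ∉ α.2.toList.map Subtype.val := by
    intro h
    obtain ⟨j, -, hj⟩ := List.mem_map.1 h
    exact (Nat.not_even_iff_odd.2 j.2) (hj ▸ i.2)
  rw [Exponent.toWord, List.count_append, List.count_eq_zero_of_not_mem h, add_zero,
    List.count_map_of_injective _ _ Subtype.val_injective]
  have h2 := Multiset.coe_count i (Finsupp.toMultiset α.1).toList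
  rw [Multiset.coe_toList, Finsupp.count_toMultiset] at h2
  convert h2.symm

theorem count_toWord_odd (α : F.Exponent) (i : {i // Odd (F.deg i)}) :
    α.toWord.count (i : ι) = if i ∈ α.2 then 1 else 0 := by
  have h : (i : ι) ∉ (Finsupp.toMultiset α.1).toList.map Subtype.val := by
    intro h
    obtain ⟨j, -, hj⟩ := List.mem_map.1 h
    exact (Nat.not_even_iff_odd.2 i.2) (hj ▸ j.2)
  rw [Exponent.toWord, List.count_append, List.count_eq_zero_of_not_mem h, zero_add,
    List.count_map_of_injective _ _ Subtype.val_injective,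
    List.Nodup.count (Finset.nodup_toList _)]
  simp

theorem count_toWord_le_one (α : F.Exponent) (i : ι) (hi : Odd (F.deg i)) :
    α.toWord.count i ≤ 1 := by
  have := F.count_toWord_odd α ⟨i, hi⟩
  rw [this]
  split_ifs <;> simp

theorem eq_of_toWord_perm {α β : F.Exponent} (h : α.toWord.Perm β.toWord) : α = β := by
  rw [List.perm_iff_count] at h
  refine Prod.ext (Finsupp.ext fun i => ?_) (Finset.ext fun i => ?_)
  · rw [← count_toWord_even, ← count_toWord_even, h]
  · have := h i
    rw [count_toWord_odd, count_toWord_odd] at this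
    split_ifs at this
    all_goals simp_all

theorem exists_perm_toWord (l : List ι) (hl : ∀ i, Odd (F.deg i) → l.count i ≤ 1) :
    ∃ α : F.Exponent, l.Perm α.toWord := by
  classical
  refine ⟨((Multiset.toFinsupp (l : Multiset ι)).comapDomain Subtype.val
    Subtype.val_injective.injOn, l.toFinset.subtype _), List.perm_iff_count.2 fun i => ?_⟩
  rcases Nat.even_or_odd (F.deg i) with h | h
  · rw [F.count_toWord_even _ ⟨i, h⟩]
    simp
  · rw [F.count_toWord_odd _ ⟨i, h⟩]
    have := hl i h
    split_ifs with hi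
    · have : i ∈ l := by simpa using hi
      have := List.count_pos_iff.2 this
      omega
    · exact List.count_eq_zero_of_not_mem (by simpa using hi)

theorem wordWeight_toWord (α : F.Exponent) :
    wordWeight α.toWord = α.1.prod fun _ k => k.factorial := by
  classical
  have hs : α.toWord.toFinset ⊆ α.1.support.map (Function.Embedding.subtype _) ∪
      α.2.map (Function.Embedding.subtype _) := by
    intro i hi
    simpa [Exponent.toWord] using hi
  rw [wordWeight_eq_prod hs, Finset.prod_union, Finset.prod_map, Finset.prod_map]
  · rw [Finset.prod_eq_one (s := α.2), mul_one]
    · exact Finset.prod_congr rfl fun i _ => by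
        rw [Function.Embedding.coe_subtype, count_toWord_even]
    · intro i _
      rw [Function.Embedding.coe_subtype, count_toWord_odd]
      split_ifs <;> simp
  · rw [Finset.disjoint_left]
    intro i h1 h2
    obtain ⟨j, -, hj⟩ := Finset.mem_map.1 h1
    obtain ⟨k, -, hk⟩ := Finset.mem_map.1 h2
    refine (Nat.not_even_iff_odd.2 k.2) ?_
    have : (k : ι) = j := hk.trans hj.symm
    rw [this]
    exact j.2

/-- Any family of vectors that become words after multiplication by the weight is unitriangular
with respect to the words in the forms. -/
theorem isUnitriangular [IsDomain R] [CharZero R] (hc : IsGradedCommutative 𝒜) {v : F.Exponent → A}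
    (hv : ∀ α, wordWeight α.toWord • v α = F.word α.toWord) :
    IsUnitriangular (fun α : F.Exponent => α.toWord.length)
      (fun α => GradedDual.toDual 𝒜 (F.formWord α.toWord)) v := by
  have hw : ∀ α : F.Exponent, (wordWeight α.toWord : R) ≠ 0 := fun α =>
    Nat.cast_ne_zero.2 (wordWeight_ne_zero _)
  -- Every pairing with v is the known pairing with a word divided by the weight, which is nonzero
  -- in `R` by characteristic 0. On the diagonal the weight cancels exactly.
  have hφ : ∀ α β : F.Exponent, (wordWeight β.toWord : R) *
      GradedDual.toDual 𝒜 (F.formWord α.toWord) (v β) =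
      GradedDual.toDual 𝒜 (F.formWord α.toWord) (F.word β.toWord) := by
    intro α β
    rw [← hv, map_nsmul, nsmul_eq_mul]
  refine ⟨fun α β h => ?_, fun α β h hne => ?_, fun α => ?_⟩
  · have h1 := hφ α β
    rw [F.formWord_word_of_length_lt h] at h1
    exact (mul_eq_zero.1 h1).resolve_left (hw β)
  · have h1 := hφ α β
    rw [(F.formWord_word hc h (F.count_toWord_le_one β)).1 fun hp => hne (F.eq_of_toWord_perm hp)]
      at h1
    exact (mul_eq_zero.1 h1).resolve_left (hw β)
  · obtain ⟨s, hs, h2⟩ := (F.formWord_word hc rfl (F.count_toWord_le_one α)).2 (List.Perm.refl _)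
    have h1 := hφ α α
    rw [h2, mul_comm] at h1
    rw [mul_right_cancel₀ (hw α) h1]
    exact hs

end DualFamily

end Monomials

/-! ### The tensor product of a divided power algebra and an exterior algebra -/

section ExteriorSpan

variable {R N κ : Type*} [CommRing R] [AddCommGroup N] [Module R N]

/-- The straightening lemma with all letters odd and all scalars -1: anticommutators and squares
vanish, so words without repetition, one per finite set, suffice. -/
theorem exteriorAlgebra_span_eq_top {b : κ → N} (hb : Submodule.span R (Set.range b) = ⊤) :
    Submodule.span R (Set.range fun s : Finset κ =>
      (s.toList.map fun i => ExteriorAlgebra.ι R (b i)).prod) = ⊤ := by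
  classical
  have h := span_words_eq_top (R := R) (g := fun i => ExteriorAlgebra.ι R (b i))
    (c := fun _ _ => -1) (odd := fun _ => True) (𝓛 := Set.range Finset.toList)
    (fun i j => by
      rw [neg_one_smul, sub_neg_eq_add, ExteriorAlgebra.ι_add_mul_swap]
      exact Submodule.zero_mem _)
    (fun i _ => by
      rw [ExteriorAlgebra.ι_sq_zero]
      exact Submodule.zero_mem _)
    (by
      rw [Set.range_comp' (ExteriorAlgebra.ι R) b, ← Algebra.adjoin_span (R := R),
        ← Submodule.map_span, hb, Submodule.map_top]
      exact CliffordAlgebra.adjoin_range_ι)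
    (fun l hl => by
      refine ⟨_, ⟨l.toFinset, rfl⟩, ?_⟩
      exact (List.toFinset_toList (List.nodup_iff_count_le_one.2 fun i => hl i trivial)).symm)
  rwa [← Set.range_comp] at h

end ExteriorSpan

/-! ### Comparison of the tensor product presentation with the algebra. -/

section Presentation

variable {R : Type*} [CommRing R] {A : Type*} [Ring A] [Algebra R A]
variable {𝒜 : ℕ → Submodule R A} [GradedAlgebra 𝒜] [Coalgebra R A] [GradedHopfAlgebra 𝒜]
variable {M N : Type*} [AddCommGroup M] [Module R M] [AddCommGroup N] [Module R N]

namespace DualFamily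

variable {ι : Type*} (F : DualFamily 𝒜 ι) (b₀ : {i // Even (F.deg i)} → M)
  (b₁ : {i // Odd (F.deg i)} → N)

/-- The monomials of the tensor product of the divided power algebra and the exterior algebra. -/
def monomial (α : F.Exponent) : DividedPowerAlgebra R M ⊗[R] ExteriorAlgebra R N :=
  (α.1.prod fun i k => DividedPowerAlgebra.dp R k (b₀ i)) ⊗ₜ[R]
    (α.2.toList.map fun i => ExteriorAlgebra.ι R (b₁ i)).prod

variable {b₀ b₁}

theorem span_monomial (h₀ : Submodule.span R (Set.range b₀) = ⊤)
    (h₁ : Submodule.span R (Set.range b₁) = ⊤) :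
    Submodule.span R (Set.range (F.monomial b₀ b₁)) = ⊤ := by
  have h := Submodule.map₂_span_span R
    (TensorProduct.mk R (DividedPowerAlgebra R M) (ExteriorAlgebra R N))
    (Set.range fun (n : {i // Even (F.deg i)} →₀ ℕ) =>
      n.prod fun i k => DividedPowerAlgebra.dp R k (b₀ i))
    (Set.range fun s : Finset {i // Odd (F.deg i)} =>
      (s.toList.map fun i => ExteriorAlgebra.ι R (b₁ i)).prod)
  rw [DividedPowerAlgebra.submodule_span_prod_dp_eq_top h₀, exteriorAlgebra_span_eq_top h₁,
    TensorProduct.map₂_mk_top_top_eq_top, Set.image2_range] at h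
  exact h.symm

/-- Multiplying a k-th divided power by k! gives a k-th power, so the weight turns a divided
monomial into an ordinary product of generators, which the algebra map e sends to the word. -/
theorem wordWeight_smul_monomial (e : DividedPowerAlgebra R M ⊗[R] ExteriorAlgebra R N →ₐ[R] A)
    (h₀ : ∀ i, e (DividedPowerAlgebra.dp R 1 (b₀ i) ⊗ₜ[R] 1) = F.gen i)
    (h₁ : ∀ i, e (1 ⊗ₜ[R] ExteriorAlgebra.ι R (b₁ i)) = F.gen i) [DecidableEq ι] (α : F.Exponent) :
    wordWeight α.toWord • e (F.monomial b₀ b₁ α) = F.word α.toWord := by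
  classical
  have h2 : ((α.1.prod fun _ k => k.factorial : ℕ) : R) •
      (α.1.prod fun i k => DividedPowerAlgebra.dp R k (b₀ i)) =
      ((Finsupp.toMultiset α.1).toList.map fun i => DividedPowerAlgebra.dp R 1 (b₀ i)).prod := by
    rw [← Multiset.prod_coe, ← Multiset.map_coe, Multiset.coe_toList, Finsupp.toMultiset_map,
      Finsupp.prod_toMultiset, Nat.cast_smul_eq_nsmul, nsmul_eq_mul, Finsupp.prod, Finsupp.prod,
      Nat.cast_prod, ← Finset.prod_mul_distrib,
      Finsupp.prod_mapDomain_index (by simp) (fun _ _ _ => pow_add _ _ _)]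
    exact Finset.prod_congr rfl fun i _ => DividedPowerAlgebra.natFactorial_mul_dp_eq _ _
  rw [wordWeight_toWord, ← Nat.cast_smul_eq_nsmul R, ← map_smul, monomial,
    TensorProduct.smul_tmul', h2,
    ← mul_one (List.prod _), ← one_mul (List.prod (List.map _ α.2.toList)),
    ← Algebra.TensorProduct.tmul_mul_tmul, map_mul, word, Exponent.toWord, List.map_append,
    List.prod_append]
  congr 1
  · have := map_list_prod (e.comp Algebra.TensorProduct.includeLeft)
      ((Finsupp.toMultiset α.1).toList.map fun i => DividedPowerAlgebra.dp R 1 (b₀ i))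
    rw [List.map_map] at this
    refine this.trans ?_
    rw [List.map_map]
    congr 2
    funext i
    exact h₀ i
  · have := map_list_prod (e.comp Algebra.TensorProduct.includeRight)
      (α.2.toList.map fun i => ExteriorAlgebra.ι R (b₁ i))
    rw [List.map_map] at this
    refine this.trans ?_
    rw [List.map_map]
    congr 2
    funext i
    exact h₁ i

/-- The monomials span the source and their images are independent, so e is injective. Its range is
the saturated span of these images and contains all generators, hence a nonzero multiple of
everything, hence everything. The families `b₀` and `b₁` are only assumed to span. -/
theorem presentation_bijective [IsDomain R] [CharZero R] [Module.IsTorsionFree R A]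
    (hc : IsGradedCommutative 𝒜)
    (hgen : ∀ a, ∃ m : R, m ≠ 0 ∧ m • a ∈ Algebra.adjoin R (Set.range F.gen))
    (hb₀ : Submodule.span R (Set.range b₀) = ⊤) (hb₁ : Submodule.span R (Set.range b₁) = ⊤)
    (e : DividedPowerAlgebra R M ⊗[R] ExteriorAlgebra R N →ₐ[R] A)
    (h₀ : ∀ i, e (DividedPowerAlgebra.dp R 1 (b₀ i) ⊗ₜ[R] 1) = F.gen i)
    (h₁ : ∀ i, e (1 ⊗ₜ[R] ExteriorAlgebra.ι R (b₁ i)) = F.gen i) :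
    Function.Bijective e := by
  classical
  have hU := F.isUnitriangular hc (F.wordWeight_smul_monomial e h₀ h₁)
  have hspan := F.span_monomial hb₀ hb₁
  have hrange : Submodule.span R (Set.range fun α => e (F.monomial b₀ b₁ α)) =
      LinearMap.range e.toLinearMap := by
    rw [Set.range_comp' (e : _ → A), LinearMap.range_eq_map, ← hspan, Submodule.map_span]
    rfl
  constructor
  · rw [injective_iff_map_eq_zero]
    intro u hu
    have hu' : u ∈ Submodule.span R (Set.range (F.monomial b₀ b₁)) := hspan ▸ Submodule.mem_top
    rw [Finsupp.mem_span_range_iff_exists_finsupp] at hu'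
    obtain ⟨c, rfl⟩ := hu'
    have : c = 0 := linearIndependent_iff.1 hU.linearIndependent c (by
      rw [← hu, Finsupp.linearCombination_apply, Finsupp.sum, Finsupp.sum, map_sum]
      simp only [map_smul])
    rw [this, Finsupp.sum_zero_index]
  · intro a
    obtain ⟨m, hm, hma⟩ := hgen a
    have h1 : Algebra.adjoin R (Set.range F.gen) ≤ e.range := by
      rw [Algebra.adjoin_le_iff]
      rintro _ ⟨i, rfl⟩
      rcases Nat.even_or_odd (F.deg i) with hi | hi
      · exact ⟨_, h₀ ⟨i, hi⟩⟩
      · exact ⟨_, h₁ ⟨i, hi⟩⟩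
    have h2 : m • a ∈ Submodule.span R (Set.range fun α => e (F.monomial b₀ b₁ α)) := by
      rw [hrange]
      exact h1 hma
    have h3 := hU.mem_span_of_smul_mem hm h2
    rw [hrange] at h3
    exact h3

end DualFamily

end Presentation

/-! ### Existence of dual families -/

section Saturation

variable {R A : Type*} [CommRing R] [IsDomain R] [Ring A] [Algebra R A]

/-- The elements of which a nonzero multiple lies in a given subalgebra. -/
def saturation (S : Subalgebra R A) : Subalgebra R A where
  carrier := {a | ∃ m : R, m ≠ 0 ∧ m • a ∈ S}
  mul_mem' := by
    rintro a b ⟨m, hm, ha⟩ ⟨n, hn, hb⟩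
    refine ⟨m * n, mul_ne_zero hm hn, ?_⟩
    rw [← smul_mul_smul_comm]
    exact mul_mem ha hb
  add_mem' := by
    rintro a b ⟨m, hm, ha⟩ ⟨n, hn, hb⟩
    refine ⟨n * m, mul_ne_zero hn hm, ?_⟩
    rw [smul_add, mul_smul, mul_comm, mul_smul]
    exact add_mem (S.smul_mem ha n) (S.smul_mem hb m)
  algebraMap_mem' r := ⟨1, one_ne_zero, by rw [one_smul]; exact S.algebraMap_mem r⟩

theorem le_saturation (S : Subalgebra R A) : S ≤ saturation S :=
  fun a ha => ⟨1, one_ne_zero, by rwa [one_smul]⟩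

theorem mem_saturation_of_smul_mem {S : Subalgebra R A} {m : R} (hm : m ≠ 0) {a : A}
    (h : m • a ∈ saturation S) : a ∈ saturation S := by
  obtain ⟨n, hn, ha⟩ := h
  exact ⟨n * m, mul_ne_zero hn hm, by rwa [mul_smul]⟩

end Saturation

section Existence

variable {R : Type*} [CommRing R] {A : Type*} [Ring A] [Algebra R A]

/-- The decomposable elements of degree `n`, with all elements of degree `0` included. -/
def decomposables (𝒜 : ℕ → Submodule R A) (n : ℕ) : Submodule R (𝒜 n) :=
  Submodule.span R {x | n = 0 ∨
    ∃ i j, 0 < i ∧ 0 < j ∧ i + j = n ∧ ∃ a ∈ 𝒜 i, ∃ b ∈ 𝒜 j, (x : A) = a * b}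

variable {𝒜 : ℕ → Submodule R A} [GradedAlgebra 𝒜]

/-- The element of the graded dual given by a form on one component. -/
def GradedDual.ofComponent (n : ℕ) (f : Module.Dual R (𝒜 n)) : GradedDual 𝒜 :=
  ⟨f ∘ₗ DirectSum.component R ℕ (fun i => 𝒜 i) n ∘ₗ
    (DirectSum.decomposeLinearEquiv 𝒜).toLinearMap, n + 1, fun m hm x hx => by
      simp only [LinearMap.comp_apply, LinearEquiv.coe_coe, DirectSum.decomposeLinearEquiv_apply,
        DirectSum.decompose_of_mem 𝒜 hx]
      rw [DirectSum.component, DFinsupp.lapply_apply]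
      rw [DirectSum.of_eq_of_ne _ _ _ (by omega), map_zero]⟩

theorem GradedDual.ofComponent_mem (n : ℕ) (f : Module.Dual R (𝒜 n)) :
    GradedDual.ofComponent n f ∈ GradedDual.grading 𝒜 n := by
  intro m hm x hx
  change f (DirectSum.decompose 𝒜 x n) = 0
  rw [DirectSum.decompose_of_mem 𝒜 hx, DirectSum.of_eq_of_ne _ _ _ hm.symm, map_zero]

theorem GradedDual.ofComponent_apply (n : ℕ) (f : Module.Dual R (𝒜 n)) (x : 𝒜 n) :
    GradedDual.toDual 𝒜 (GradedDual.ofComponent n f) x = f x := by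
  change f (DirectSum.decompose 𝒜 (x : A) n) = f x
  rw [DirectSum.decompose_of_mem 𝒜 x.2, DirectSum.of_eq_same]

variable [Coalgebra R A] [GradedHopfAlgebra 𝒜]

theorem counit_algebraMap (𝒜 : ℕ → Submodule R A) [GradedAlgebra 𝒜] [GradedHopfAlgebra 𝒜] (r : R) :
    Coalgebra.counit (R := R) (algebraMap R A r) = r := by
  rw [Algebra.algebraMap_eq_smul_one, map_smul, GradedHopfAlgebra.counit_one (𝒜 := 𝒜), smul_eq_mul,
    mul_one]

namespace GradedDual

theorem IsDerivation.apply_one {f : GradedDual 𝒜} (hf : f.IsDerivation) : toDual 𝒜 f 1 = 0 := by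
  have h := hf 1 1
  rw [GradedHopfAlgebra.counit_one (𝒜 := 𝒜), mul_one, mul_one, one_mul] at h
  simpa using h

/-- On a product of two elements of positive degree both Leibniz terms vanish. Elements of degree 0
are scalars by connectedness, and a derivation kills 1. -/
theorem IsDerivation.apply_decomposables (hconn : IsConnected 𝒜) {f : GradedDual 𝒜}
    (hf : f.IsDerivation) {n : ℕ} {x : 𝒜 n} (hx : x ∈ decomposables 𝒜 n) :
    toDual 𝒜 f x = 0 := by
  refine Submodule.span_induction (p := fun (x : 𝒜 n) _ => toDual 𝒜 f x = 0) ?_ (by simp)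
    (fun x y _ _ hx hy => by simp [hx, hy]) (fun r x _ hx => by simp [hx]) hx
  rintro x (rfl | ⟨i, j, hi, hj, -, a, ha, b, hb, hab⟩)
  · obtain ⟨r, hr⟩ := hconn.2 x x.2
    rw [hr, Algebra.algebraMap_eq_smul_one, map_smul, hf.apply_one, smul_zero]
  · rw [hab, hf, GradedHopfAlgebra.counit_eq_zero i hi.ne' a ha,
      GradedHopfAlgebra.counit_eq_zero j hj.ne' b hb]
    simp

/-- Converse of `IsDerivation.apply_decomposables`: if both factors have positive degree, both sides
are zero, and if one has degree 0 it is a scalar and the rule is linearity. -/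
theorem isDerivation_ofComponent (hconn : IsConnected 𝒜) {n : ℕ} (hn : n ≠ 0)
    {f : Module.Dual R (𝒜 n)} (hf : ∀ x ∈ decomposables 𝒜 n, f x = 0) :
    (ofComponent n f).IsDerivation := by
  have h0 : ∀ r, toDual 𝒜 (ofComponent n f) (algebraMap R A r) = 0 := fun r =>
    ofComponent_mem n f 0 hn.symm _ (SetLike.algebraMap_mem_graded 𝒜 r)
  refine isDerivation_of_homogeneous fun i j x hx y hy => ?_
  rcases Nat.eq_zero_or_pos i with rfl | hi
  · obtain ⟨r, rfl⟩ := hconn.2 x hx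
    rw [h0, counit_algebraMap 𝒜, zero_mul, zero_add, ← Algebra.smul_def, map_smul, smul_eq_mul]
  rcases Nat.eq_zero_or_pos j with rfl | hj
  · obtain ⟨r, rfl⟩ := hconn.2 y hy
    rw [h0, counit_algebraMap 𝒜, mul_zero, add_zero, ← Algebra.commutes, ← Algebra.smul_def,
      map_smul, smul_eq_mul, mul_comm]
  rw [GradedHopfAlgebra.counit_eq_zero i hi.ne' x hx,
    GradedHopfAlgebra.counit_eq_zero j hj.ne' y hy, mul_zero, zero_mul, add_zero]
  have hxy := SetLike.mul_mem_graded hx hy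
  by_cases hij : i + j = n
  · subst hij
    exact (ofComponent_apply _ f ⟨x * y, hxy⟩).trans
      (hf _ (Submodule.subset_span (.inr ⟨i, j, hi, hj, rfl, x, hx, y, hy, rfl⟩)))
  · exact ofComponent_mem n f _ hij _ hxy

end GradedDual

/-- Apply `exists_dual_family` to the decomposables of every degree. Generation up to multiples is
an induction on the degree. The span of the forms contains every derivation g because g vanishes on
decomposables and `R` is a domain, so g is determined by its values on the chosen elements. -/
theorem exists_dualFamily [IsDomain R] [IsPrincipalIdealRing R] [∀ n, Module.Finite R (𝒜 n)]
    (hconn : IsConnected 𝒜) :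
    ∃ (κ : ℕ → ℕ) (F : DualFamily 𝒜 (Σ n, Fin (κ n))), (∀ i, F.deg i = i.1) ∧
      (∀ a, ∃ m : R, m ≠ 0 ∧ m • a ∈ Algebra.adjoin R (Set.range F.gen)) ∧
      ∀ f : GradedDual 𝒜, f.IsDerivation → f ∈ Submodule.span R (Set.range F.form) := by
  choose κ x f hfx hfD hspan using fun n => exists_dual_family (decomposables 𝒜 n)
  -- In degree 0 everything counts as decomposable, so no form there can take the value 1.
  have hpos : ∀ i : Σ n, Fin (κ n), 0 < i.1 := by
    rintro ⟨n, i⟩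
    by_contra h
    have hn : n = 0 := by simpa using h
    have h1 := hfx n i i
    rw [hfD n i (x n i) (Submodule.subset_span (.inl hn))] at h1
    simp at h1
  let F : DualFamily 𝒜 (Σ n, Fin (κ n)) :=
    { deg := fun i => i.1
      gen := fun i => (x i.1 i.2 : A)
      form := fun i => GradedDual.ofComponent i.1 (f i.1 i.2)
      deg_pos := hpos
      gen_mem := fun i => (x i.1 i.2).2
      form_mem := fun i => GradedDual.ofComponent_mem _ _
      isDerivation := fun i =>
        GradedDual.isDerivation_ofComponent hconn (hpos i).ne' (hfD i.1 i.2)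
      form_gen_self := fun i => by
        rw [GradedDual.ofComponent_apply, hfx, if_pos rfl]
      form_gen_ne := by
        rintro ⟨n, i⟩ ⟨m, j⟩ hij
        by_cases h : m = n
        · subst h
          rw [GradedDual.ofComponent_apply, hfx, if_neg]
          rintro rfl
          exact hij rfl
        · exact GradedDual.ofComponent_mem _ _ m h _ (x m j).2 }
  refine ⟨κ, F, fun _ => rfl, fun a => ?_, fun g hg => ?_⟩
  · set S := Algebra.adjoin R (Set.range F.gen) with hS
    change a ∈ saturation S
    have key : ∀ n, ∀ a ∈ 𝒜 n, a ∈ saturation S := by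
      intro n
      induction n using Nat.strong_induction_on with
      | _ n ih =>
        intro a ha
        rcases Nat.eq_zero_or_pos n with rfl | hn
        · obtain ⟨r, rfl⟩ := hconn.2 a ha
          exact Subalgebra.algebraMap_mem _ r
        · obtain ⟨m, hm, h⟩ := hspan n ⟨a, ha⟩
          -- Factors of decomposables have smaller degree, so the induction hypothesis covers them.
          have hD : ∀ d ∈ decomposables 𝒜 n, (d : A) ∈ saturation S := by
            intro d hd
            refine Submodule.span_induction (p := fun (d : 𝒜 n) _ => (d : A) ∈ saturation S) ?_
              (zero_mem _) (fun x y _ _ hx hy => add_mem hx hy)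
              (fun r x _ hx => Subalgebra.smul_mem _ hx r) hd
            rintro d (h0 | ⟨i, j, hi, hj, hij, b, hb, c, hc, hbc⟩)
            · omega
            · rw [hbc]
              exact mul_mem (ih i (by omega) b hb) (ih j (by omega) c hc)
          have h1 := mem_saturation_of_smul_mem hm (hD _ h)
          have h2 : ((∑ i, f n i ⟨a, ha⟩ • x n i : 𝒜 n) : A) ∈ saturation S := by
            rw [AddSubmonoidClass.coe_finsetSum]
            exact sum_mem fun i _ => Subalgebra.smul_mem _ (le_saturation S
              (Algebra.subset_adjoin ⟨⟨n, i⟩, rfl⟩)) _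
          have h3 := add_mem h1 h2
          rwa [AddSubgroupClass.coe_sub, sub_add_cancel] at h3
    induction a using hom_induction 𝒜 with
    | zero => exact zero_mem _
    | add y z hy hz => exact add_mem hy hz
    | hom n y hy => exact key n y hy
  · obtain ⟨N, hN⟩ := g.2
    -- The coefficients are the values of g on the dual elements; degrees from N on do not matter
    -- because g vanishes there.
    have h : g = ∑ n ∈ Finset.range N, ∑ i, GradedDual.toDual 𝒜 g (x n i) • F.form ⟨n, i⟩ := by
      refine GradedDual.ext_hom fun m a ha => ?_
      simp only [map_sum, LinearMap.sum_apply, map_smul, LinearMap.smul_apply]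
      by_cases hm : m < N
      · rw [Finset.sum_eq_single m]
        · have h1 : ∀ i, GradedDual.toDual 𝒜 (F.form ⟨m, i⟩) a = f m i ⟨a, ha⟩ := fun i =>
            GradedDual.ofComponent_apply m (f m i) ⟨a, ha⟩
          obtain ⟨r, hr, h2⟩ := hspan m ⟨a, ha⟩
          have h3 := hg.apply_decomposables hconn h2
          rw [Submodule.coe_smul, map_smul, smul_eq_mul] at h3
          have h4 := (mul_eq_zero.1 h3).resolve_left hr
          rw [AddSubgroupClass.coe_sub, map_sub, sub_eq_zero, AddSubmonoidClass.coe_finsetSum,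
            map_sum] at h4
          rw [h4]
          refine Finset.sum_congr rfl fun i _ => ?_
          rw [h1, Submodule.coe_smul, map_smul, smul_eq_mul, smul_eq_mul, mul_comm]
        · intro n _ hn
          refine Finset.sum_eq_zero fun i _ => ?_
          rw [GradedDual.ofComponent_mem n (f n i) m hn.symm a ha, smul_zero]
        · exact fun h => absurd (Finset.mem_range.2 hm) h
      · refine (hN m (not_lt.1 hm) a ha).trans (Finset.sum_eq_zero fun n hn =>
          Finset.sum_eq_zero fun i _ => ?_).symm
        have := Finset.mem_range.1 hn
        rw [GradedDual.ofComponent_mem n (f n i) m (by omega) a ha, smul_zero]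
    rw [h]
    exact Submodule.sum_mem _ fun n _ => Submodule.sum_mem _ fun i _ =>
      Submodule.smul_mem _ _ (Submodule.subset_span ⟨_, rfl⟩)

end Existence

/-! ### The free `Γ`-algebra on the elements of a dual family -/

section Transport

variable {R A B : Type*} [CommRing R] [Ring A] [Algebra R A] [Ring B] [Algebra R B]
  {𝒜 : ℕ → Submodule R A} {ℬ : ℕ → Submodule R B}

/-- Transport of the structure of a `Γ`-algebra along an isomorphism. -/
def GammaAlgebra.transport (G : GammaAlgebra 𝒜) (e : B ≃ₐ[R] A)
    (he : ∀ n b, b ∈ ℬ n ↔ e b ∈ 𝒜 n) : GammaAlgebra ℬ where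
  connected := by
    refine ⟨fun r s h => G.connected.1 ?_, fun x hx => ?_⟩
    · rw [← e.commutes, ← e.commutes, h]
    · obtain ⟨r, hr⟩ := G.connected.2 _ ((he 0 x).1 hx)
      exact ⟨r, e.injective (by rw [hr, e.commutes])⟩
  commutative i j x hx y hy := e.injective (by
    rw [map_mul, map_smul, map_mul]
    exact G.commutative i j _ ((he i x).1 hx) _ ((he j y).1 hy))
  γ k b := e.symm (G.γ k (e b))
  γ_mem k n hn a ha := by
    rw [he, e.apply_symm_apply]
    exact G.γ_mem k n hn _ ((he _ a).1 ha)
  γ_zero n hn a ha := by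
    rw [G.γ_zero n hn _ ((he _ a).1 ha), map_one]
  γ_one n hn a ha := by
    rw [G.γ_one n hn _ ((he _ a).1 ha), e.symm_apply_apply]
  γ_mul_γ j k n hn a ha := by
    rw [← map_mul, G.γ_mul_γ j k n hn _ ((he _ a).1 ha), map_nsmul]
  γ_add k n hn a ha b hb := by
    rw [map_add, G.γ_add k n hn _ ((he _ a).1 ha) _ ((he _ b).1 hb), map_sum]
    simp only [map_mul]
  γ_mul_even k m n hn a ha b hb := by
    rw [map_mul, G.γ_mul_even k m n hn _ ((he _ a).1 ha) _ ((he _ b).1 hb), map_mul, map_pow,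
      e.symm_apply_apply]
  γ_mul_odd k m n hk a ha b hb := by
    rw [map_mul, G.γ_mul_odd k m n hk _ ((he _ a).1 ha) _ ((he _ b).1 hb), map_zero]
  γ_γ j k n hn hk a ha := by
    rw [e.apply_symm_apply, G.γ_γ j k n hn hk _ ((he _ a).1 ha), map_nsmul]

end Transport

/-! ### Consequences of divided powers, torsion-freeness and graded commutativity. -/

section GradedCommutative

variable {R A : Type*} [CommRing R] [Ring A] [Algebra R A] {𝒜 : ℕ → Submodule R A}

/-- Iterate γ_k γ_1 = (k + 1) γ_{k+1}. In a torsion-free algebra this pins down the divided powers.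
-/
theorem GammaAlgebra.factorial_smul_γ (G : GammaAlgebra 𝒜) {n : ℕ} (hn : 0 < n) {a : A}
    (ha : a ∈ 𝒜 (2 * n)) (k : ℕ) : k.factorial • G.γ k a = a ^ k := by
  induction k with
  | zero => simp [G.γ_zero n hn a ha]
  | succ k ih =>
    have h := G.γ_mul_γ k 1 n hn a ha
    rw [G.γ_one n hn a ha, Nat.choose_symm_add, Nat.choose_one_right] at h
    rw [pow_succ, ← ih, smul_mul_assoc, h, smul_smul, Nat.factorial_succ, mul_comm]

theorem isTorsionFree_of_components [IsDomain R] [GradedAlgebra 𝒜]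
    [∀ n, Module.IsTorsionFree R (𝒜 n)] : Module.IsTorsionFree R A where
  isSMulRegular r hr a b h := by
    have h1 : ∀ n, DirectSum.decompose 𝒜 a n = DirectSum.decompose 𝒜 b n := by
      intro n
      refine Module.IsTorsionFree.isSMulRegular hr ?_
      have := congrArg (fun c => DirectSum.decompose 𝒜 c n) h
      rwa [DirectSum.decompose_smul, DirectSum.decompose_smul] at this
    exact (DirectSum.decompose 𝒜).injective (DFinsupp.ext h1)

theorem isAddTorsionFree_of_isTorsionFree (R A : Type*) [CommRing R] [IsDomain R] [CharZero R]
    [AddCommGroup A] [Module R A] [Module.IsTorsionFree R A] : IsAddTorsionFree A where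
  nsmul_right_injective n hn a b h := by
    refine smul_right_injective A (Nat.cast_ne_zero (R := R).2 hn) ?_
    change (n : R) • a = (n : R) • b
    rw [Nat.cast_smul_eq_nsmul, Nat.cast_smul_eq_nsmul]
    exact h

variable [GradedAlgebra 𝒜]

theorem IsGradedCommutative.mem_center (hc : IsGradedCommutative 𝒜) {n : ℕ} (hn : Even n) {a : A}
    (ha : a ∈ 𝒜 n) : a ∈ Subalgebra.center R A := by
  rw [Subalgebra.mem_center_iff]
  intro b
  induction b using hom_induction 𝒜 with
  | zero => simp
  | add y z hy hz => rw [add_mul, mul_add, hy, hz]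
  | hom m y hy => rw [hc m n y hy a ha, (hn.mul_left m).neg_one_pow, one_smul]

theorem IsGradedCommutative.anticommute (hc : IsGradedCommutative 𝒜) {m n : ℕ} (hm : Odd m)
    (hn : Odd n) {a b : A} (ha : a ∈ 𝒜 m) (hb : b ∈ 𝒜 n) : a * b = -(b * a) := by
  rw [hc m n a ha b hb, (hm.mul hn).neg_one_pow, neg_one_smul]

end GradedCommutative

/-! ### Generators of the free Γ-algebra acting on pure tensors. -/

section FreeGammaTensor

variable (R : Type*) [CommRing R] (X : ℕ → Type*) [∀ n, AddCommGroup (X n)] [∀ n, Module R (X n)]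

/-- The identification of the free `Γ`-algebra with the tensor product that defines it. -/
def FreeGamma.equivTensor : FreeGamma R X ≃ₐ[R]
    DividedPowerAlgebra R (⨁ n, X (2 * n)) ⊗[R] ExteriorAlgebra R (⨁ n, X (2 * n + 1)) :=
  AlgEquiv.refl

variable {R X}

theorem FreeGamma.dp_mul_tmul (k n : ℕ) (x : X (2 * n))
    (u : DividedPowerAlgebra R (⨁ n, X (2 * n))) (v : ExteriorAlgebra R (⨁ n, X (2 * n + 1))) :
    FreeGamma.dp R k n x * (FreeGamma.equivTensor R X).symm (u ⊗ₜ[R] v) =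
      (FreeGamma.equivTensor R X).symm ((DividedPowerAlgebra.dp R k
        (DirectSum.lof R ℕ (fun n => X (2 * n)) n x) * u) ⊗ₜ[R] v) := by
  rw [← one_mul v, ← Algebra.TensorProduct.tmul_mul_tmul, map_mul, one_mul]
  rfl

theorem FreeGamma.odd_mul_tmul (n : ℕ) (x : X (2 * n + 1))
    (u : DividedPowerAlgebra R (⨁ n, X (2 * n))) (v : ExteriorAlgebra R (⨁ n, X (2 * n + 1))) :
    FreeGamma.odd R n x * (FreeGamma.equivTensor R X).symm (u ⊗ₜ[R] v) =
      (FreeGamma.equivTensor R X).symm (u ⊗ₜ[R] (ExteriorAlgebra.ι R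
        (DirectSum.lof R ℕ (fun n => X (2 * n + 1)) n x) * v)) := by
  rw [← one_mul u, ← Algebra.TensorProduct.tmul_mul_tmul, map_mul, one_mul]
  rfl

end FreeGammaTensor

/-! ### The morphism from the free Γ-algebra on a graded submodule. -/

section FreeGammaIso

variable {R : Type*} [CommRing R] {A : Type*} [Ring A] [Algebra R A]
variable {𝒜 : ℕ → Submodule R A} [GradedAlgebra 𝒜]

/-- A submodule of a graded module that is concentrated in positive degrees. -/
def IsPositive (𝒜 : ℕ → Submodule R A) (X : Submodule R A) : Prop := ∀ x ∈ X ⊓ 𝒜 0, x = 0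

/-- The map from the even part of a graded submodule. -/
def evenMap (𝒜 : ℕ → Submodule R A) (X : Submodule R A) :
    (⨁ n, ↥(X ⊓ 𝒜 (2 * n))) →ₗ[R] A :=
  DirectSum.toModule R ℕ A fun n => (X ⊓ 𝒜 (2 * n)).subtype

/-- The map from the odd part of a graded submodule. -/
def oddMap (𝒜 : ℕ → Submodule R A) (X : Submodule R A) :
    (⨁ n, ↥(X ⊓ 𝒜 (2 * n + 1))) →ₗ[R] A :=
  DirectSum.toModule R ℕ A fun n => (X ⊓ 𝒜 (2 * n + 1)).subtype

theorem evenMap_lof (X : Submodule R A) (n : ℕ) (x : ↥(X ⊓ 𝒜 (2 * n))) :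
    evenMap 𝒜 X (DirectSum.lof R ℕ (fun n => ↥(X ⊓ 𝒜 (2 * n))) n x) = x := by
  simp [evenMap]

theorem oddMap_lof (X : Submodule R A) (n : ℕ) (x : ↥(X ⊓ 𝒜 (2 * n + 1))) :
    oddMap 𝒜 X (DirectSum.lof R ℕ (fun n => ↥(X ⊓ 𝒜 (2 * n + 1))) n x) = x := by
  simp [oddMap]

theorem evenMap_mem_center (hc : IsGradedCommutative 𝒜) (X : Submodule R A)
    (m : ⨁ n, ↥(X ⊓ 𝒜 (2 * n))) : evenMap 𝒜 X m ∈ Subalgebra.center R A := by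
  induction m using DirectSum.induction_on with
  | zero => rw [map_zero]; exact zero_mem _
  | add y z hy hz => rw [map_add]; exact add_mem hy hz
  | of n x =>
    rw [← DirectSum.lof_eq_of R, evenMap_lof]
    exact hc.mem_center (even_two_mul n) x.2.2

theorem oddMap_mul_swap (hc : IsGradedCommutative 𝒜) (X : Submodule R A)
    (m m' : ⨁ n, ↥(X ⊓ 𝒜 (2 * n + 1))) :
    oddMap 𝒜 X m * oddMap 𝒜 X m' = -(oddMap 𝒜 X m' * oddMap 𝒜 X m) := by
  induction m using DirectSum.induction_on with
  | zero => simp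
  | add y z hy hz => rw [map_add, add_mul, mul_add, hy, hz, neg_add]
  | of n x =>
    induction m' using DirectSum.induction_on with
    | zero => simp
    | add y z hy hz => rw [map_add, add_mul, mul_add, hy, hz, neg_add]
    | of n' x' =>
      rw [← DirectSum.lof_eq_of R, oddMap_lof, ← DirectSum.lof_eq_of R, oddMap_lof]
      exact hc.anticommute ⟨n, rfl⟩ ⟨n', rfl⟩ x.2.2 x'.2.2

variable [IsAddTorsionFree A]

theorem evenMap_dividedPower (G : GammaAlgebra 𝒜) {X : Submodule R A} (hX : IsPositive 𝒜 X)
    (m : ⨁ n, ↥(X ⊓ 𝒜 (2 * n))) : ∀ k : ℕ, ∃ c, k.factorial • c = evenMap 𝒜 X m ^ k := by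
  -- The divided powers of 0 are written down directly: `G.γ` says nothing in degree 0, where
  -- positivity of X leaves only 0.
  have h0 : ∀ k : ℕ, ∃ c : A, k.factorial • c = 0 ^ k := fun k => by
    rcases Nat.eq_zero_or_pos k with rfl | hk
    · exact ⟨1, by simp⟩
    · exact ⟨0, by simp [hk.ne']⟩
  induction m using DirectSum.induction_on with
  | zero => simpa only [map_zero] using h0
  | add y z hy hz =>
    rw [map_add]
    exact exists_dividedPower_add
      (Subalgebra.mem_center_iff.1 (evenMap_mem_center G.commutative X z) _) hy hz
  | of n x =>
    rw [← DirectSum.lof_eq_of R, evenMap_lof]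
    rcases Nat.eq_zero_or_pos n with rfl | hn
    · rw [hX x x.2]
      exact h0
    · exact fun k => ⟨_, G.factorial_smul_γ hn x.2.2 k⟩

/-- The morphism of `Γ`-algebras from the free `Γ`-algebra on a graded submodule. -/
theorem exists_freeGamma_hom (G : GammaAlgebra 𝒜) {X : Submodule R A} (hX : IsPositive 𝒜 X) :
    ∃ e : FreeGamma R (fun n => ↥(X ⊓ 𝒜 n)) →ₐ[R] A,
      (∀ n (x : ↥(X ⊓ 𝒜 (2 * n))) k, k.factorial • e (FreeGamma.dp R k n x) = (x : A) ^ k) ∧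
      ∀ n (x : ↥(X ⊓ 𝒜 (2 * n + 1))), e (FreeGamma.odd R n x) = x := by
  obtain ⟨Φ, hΦc, hΦ⟩ := exists_dividedPowerAlgebra_lift (R := R) (A := A)
    (M := ⨁ n, ↥(X ⊓ 𝒜 (2 * n))) (evenMap 𝒜 X)
    (evenMap_mem_center G.commutative X) (evenMap_dividedPower G hX)
  let Ψ : ExteriorAlgebra R (⨁ n, ↥(X ⊓ 𝒜 (2 * n + 1))) →ₐ[R] A :=
    ExteriorAlgebra.lift R ⟨oddMap 𝒜 X, fun m => by
      -- An odd element anticommutes with itself, so twice its square is 0, and torsion-freeness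
      -- gives the exterior relation.
      have h := oddMap_mul_swap G.commutative X m m
      rwa [eq_neg_iff_add_eq_zero, ← two_nsmul, nsmul_eq_zero_iff_right two_ne_zero] at h⟩
  let e : FreeGamma R (fun n => ↥(X ⊓ 𝒜 n)) →ₐ[R] A :=
    Algebra.TensorProduct.lift Φ Ψ fun u v =>
      (Subalgebra.mem_center_iff.1 (hΦc u) (Ψ v)).symm
  have he : ∀ u v, e (u ⊗ₜ[R] v) = Φ u * Ψ v := fun u v =>
    Algebra.TensorProduct.lift_tmul _ _ _ _ _
  refine ⟨e, fun n x k => ?_, fun n x => ?_⟩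
  · rw [FreeGamma.dp, he, map_one, mul_one, hΦ, evenMap_lof]
  · rw [FreeGamma.odd, he, map_one, one_mul, ExteriorAlgebra.lift_ι_apply, oddMap_lof]

variable {X : Submodule R A} {e : FreeGamma R (fun n => ↥(X ⊓ 𝒜 n)) →ₐ[R] A}

theorem freeGamma_hom_dp (G : GammaAlgebra 𝒜)
    (he : ∀ n (x : ↥(X ⊓ 𝒜 (2 * n))) k, k.factorial • e (FreeGamma.dp R k n x) = (x : A) ^ k)
    {n : ℕ} (hn : 0 < n) (x : ↥(X ⊓ 𝒜 (2 * n))) (k : ℕ) :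
    e (FreeGamma.dp R k n x) = G.γ k x := by
  refine nsmul_right_injective (Nat.factorial_ne_zero k) ?_
  exact (he n x k).trans (G.factorial_smul_γ hn x.2.2 k).symm

/-- Generators and their divided powers go to elements of the right degree. The formal generators of
degree 0 are zero, so their divided powers go to 1 for k = 0 and to 0 otherwise. -/
theorem freeGamma_hom_mem (G : GammaAlgebra 𝒜) (hX : IsPositive 𝒜 X)
    (he : ∀ n (x : ↥(X ⊓ 𝒜 (2 * n))) k, k.factorial • e (FreeGamma.dp R k n x) = (x : A) ^ k)
    (ho : ∀ n (x : ↥(X ⊓ 𝒜 (2 * n + 1))), e (FreeGamma.odd R n x) = x) {m : ℕ}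
    {y : FreeGamma R (fun n => ↥(X ⊓ 𝒜 n))} (hy : y ∈ FreeGamma.grading R _ m) : e y ∈ 𝒜 m := by
  have hmon : ∀ m y, FreeGamma.IsMonomial R (fun n => ↥(X ⊓ 𝒜 n)) m y → e y ∈ 𝒜 m := by
    intro m y hy
    induction hy with
    | one => rw [map_one]; exact SetLike.one_mem_graded 𝒜
    | dp_mul k n m x y _ ih =>
      rw [map_mul]
      refine SetLike.mul_mem_graded ?_ ih
      rcases Nat.eq_zero_or_pos n with rfl | hn
      · have h := he 0 x k
        rw [hX x x.2] at h
        rcases Nat.eq_zero_or_pos k with rfl | hk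
        · have h : e (FreeGamma.dp R 0 0 x) = 1 := by simpa using h
          rw [h]
          simpa using SetLike.one_mem_graded 𝒜
        · rw [zero_pow hk.ne', nsmul_eq_zero_iff_right (Nat.factorial_ne_zero k)] at h
          rw [h]
          exact zero_mem _
      · rw [freeGamma_hom_dp G he hn]
        exact G.γ_mem k n hn _ x.2.2
    | odd_mul n m x y _ ih =>
      rw [map_mul, ho]
      exact SetLike.mul_mem_graded x.2.2 ih
  have : FreeGamma.grading R (fun n => ↥(X ⊓ 𝒜 n)) m ≤ (𝒜 m).comap e.toLinearMap :=
    Submodule.span_le.2 (hmon m)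
  exact this hy

/-- The homogeneous components of Γ(X) are only spans of monomials, not yet known to be independent.
Surjectivity in each degree is obtained by projecting in A: each monomial image is either kept or
killed by the projection. -/
theorem freeGamma_map_grading (G : GammaAlgebra 𝒜) (hX : IsPositive 𝒜 X)
    (he : ∀ n (x : ↥(X ⊓ 𝒜 (2 * n))) k, k.factorial • e (FreeGamma.dp R k n x) = (x : A) ^ k)
    (ho : ∀ n (x : ↥(X ⊓ 𝒜 (2 * n + 1))), e (FreeGamma.odd R n x) = x)
    (hsurj : Function.Surjective e)
    (hspan : Submodule.span R {y | ∃ m, FreeGamma.IsMonomial R (fun n => ↥(X ⊓ 𝒜 n)) m y} = ⊤)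
    (n : ℕ) : (FreeGamma.grading R (fun n => ↥(X ⊓ 𝒜 n)) n).map e.toLinearMap = 𝒜 n := by
  refine le_antisymm ?_ fun a ha => ?_
  · rintro _ ⟨y, hy, rfl⟩
    exact freeGamma_hom_mem G hX he ho hy
  · have h : ⊤ ≤ ((FreeGamma.grading R (fun n => ↥(X ⊓ 𝒜 n)) n).map e.toLinearMap).comap
        (proj 𝒜 n ∘ₗ e.toLinearMap) := by
      rw [← hspan, Submodule.span_le]
      rintro y ⟨m, hy⟩
      have hy' : y ∈ FreeGamma.grading R (fun n => ↥(X ⊓ 𝒜 n)) m := Submodule.subset_span hy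
      have hm := freeGamma_hom_mem G hX he ho hy'
      change proj 𝒜 n (e y) ∈ (FreeGamma.grading R (fun n => ↥(X ⊓ 𝒜 n)) n).map e.toLinearMap
      by_cases h : m = n
      · subst h
        rw [proj_same hm]
        exact ⟨y, hy', rfl⟩
      · rw [proj_ne hm h]
        exact zero_mem _
    obtain ⟨y, rfl⟩ := hsurj a
    have := h (Submodule.mem_top : y ∈ ⊤)
    change proj 𝒜 n (e y) ∈ (FreeGamma.grading R (fun n => ↥(X ⊓ 𝒜 n)) n).map e.toLinearMap at this
    rwa [proj_same ha] at this

end FreeGammaIso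

/-! ### The graded submodule spanned by a dual family, and part (a). -/

namespace DualFamily

variable {R : Type*} [CommRing R] {A : Type*} [Ring A] [Algebra R A]
variable {𝒜 : ℕ → Submodule R A} [GradedAlgebra 𝒜] [Coalgebra R A] [GradedHopfAlgebra 𝒜]
variable {ι : Type*} (F : DualFamily 𝒜 ι)

/-- The span of the generators of degree `n`. -/
def degSpan (n : ℕ) : Submodule R A := Submodule.span R {a | ∃ i, F.deg i = n ∧ a = F.gen i}

theorem degSpan_le (n : ℕ) : F.degSpan n ≤ 𝒜 n := by
  refine Submodule.span_le.2 ?_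
  rintro _ ⟨i, rfl, rfl⟩
  exact F.gen_mem i

/-- The graded submodule spanned by the generators. -/
def space : Submodule R A where
  carrier := {a | ∀ n, proj 𝒜 n a ∈ F.degSpan n}
  zero_mem' n := by rw [map_zero]; exact zero_mem _
  add_mem' hx hy n := by rw [map_add]; exact add_mem (hx n) (hy n)
  smul_mem' r x hx n := by rw [map_smul]; exact Submodule.smul_mem _ r (hx n)

theorem degSpan_le_space (n : ℕ) : F.degSpan n ≤ F.space := by
  intro a ha m
  by_cases h : n = m
  · subst h
    rwa [proj_same (F.degSpan_le n ha)]
  · rw [proj_ne (F.degSpan_le n ha) h]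
    exact zero_mem _

theorem space_inf_eq (n : ℕ) : F.space ⊓ 𝒜 n = F.degSpan n := by
  refine le_antisymm ?_ (le_inf (F.degSpan_le_space n) (F.degSpan_le n))
  rintro a ⟨ha, hn⟩
  have := ha n
  rwa [proj_same hn] at this

theorem gen_mem_space (i : ι) {n : ℕ} (hn : F.deg i = n) : F.gen i ∈ F.space ⊓ 𝒜 n := by
  rw [space_inf_eq]
  exact Submodule.subset_span ⟨i, hn, rfl⟩

theorem proj_mem_space (n : ℕ) {x : A} (hx : x ∈ F.space) : proj 𝒜 n x ∈ F.space :=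
  F.degSpan_le_space n (hx n)

theorem counit_space {x : A} (hx : x ∈ F.space) : Coalgebra.counit (R := R) x = 0 := by
  have h : ∀ n, F.degSpan n ≤ LinearMap.ker (Coalgebra.counit (R := R) (A := A)) := fun n => by
    refine Submodule.span_le.2 ?_
    rintro _ ⟨i, -, rfl⟩
    exact F.counit_gen i
  obtain ⟨N, hN⟩ := exists_sum_proj (ℳ := 𝒜) x
  rw [hN N le_rfl, map_sum]
  exact Finset.sum_eq_zero fun n _ => h n (hx n)

theorem isPositive_space : IsPositive 𝒜 F.space := by
  intro x hx
  rw [space_inf_eq, degSpan] at hx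
  have : {a | ∃ i, F.deg i = 0 ∧ a = F.gen i} = ∅ := by
    ext a
    simp [(F.deg_pos _).ne']
  simpa [this] using hx

/-- The generators of even degree. -/
def evenGen (i : {i // Even (F.deg i)}) : ⨁ n, ↥(F.space ⊓ 𝒜 (2 * n)) :=
  DirectSum.lof R ℕ (fun n => ↥(F.space ⊓ 𝒜 (2 * n))) (F.deg i / 2)
    ⟨F.gen i, F.gen_mem_space i (Nat.two_mul_div_two_of_even i.2).symm⟩

/-- The generators of odd degree. -/
def oddGen (i : {i // Odd (F.deg i)}) : ⨁ n, ↥(F.space ⊓ 𝒜 (2 * n + 1)) :=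
  DirectSum.lof R ℕ (fun n => ↥(F.space ⊓ 𝒜 (2 * n + 1))) (F.deg i / 2)
    ⟨F.gen i, F.gen_mem_space i (Nat.two_mul_div_two_add_one_of_odd i.2).symm⟩

/-- The degree function c stands for 2n or 2n + 1, so that the even and odd parts are treated at
once. -/
theorem span_lof_eq_top {c : ℕ → ℕ} {W : Submodule R (⨁ n, ↥(F.space ⊓ 𝒜 (c n)))}
    (h : ∀ n i (hi : F.deg i = c n), DirectSum.lof R ℕ (fun n => ↥(F.space ⊓ 𝒜 (c n))) n
      ⟨F.gen i, F.gen_mem_space i hi⟩ ∈ W) : W = ⊤ := by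
  rw [eq_top_iff]
  rintro m -
  induction m using DirectSum.induction_on with
  | zero => exact zero_mem _
  | add y z hy hz => exact add_mem hy hz
  | of n x =>
    obtain ⟨x, hx⟩ := x
    have hle := (F.space_inf_eq (c n)).ge
    rw [← DirectSum.lof_eq_of R]
    have hx' : x ∈ F.degSpan (c n) := F.space_inf_eq (c n) ▸ hx
    refine Submodule.span_induction (p := fun x hx => DirectSum.lof R ℕ
      (fun n => ↥(F.space ⊓ 𝒜 (c n))) n ⟨x, hle hx⟩ ∈ W) ?_ ?_ ?_ ?_ hx'
    · rintro _ ⟨i, hi, rfl⟩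
      exact h n i hi
    · convert zero_mem W
      exact map_zero _
    · intro x y hx hy h1 h2
      have := add_mem h1 h2
      rwa [← map_add] at this
    · intro r x hx h1
      have := Submodule.smul_mem W r h1
      rwa [← map_smul] at this

theorem span_evenGen : Submodule.span R (Set.range F.evenGen) = ⊤ := by
  refine F.span_lof_eq_top fun n i hi => Submodule.subset_span ⟨⟨i, hi ▸ even_two_mul n⟩, ?_⟩
  have : F.deg i / 2 = n := by omega
  subst this
  rfl

theorem span_oddGen : Submodule.span R (Set.range F.oddGen) = ⊤ := by
  refine F.span_lof_eq_top fun n i hi => Submodule.subset_span ⟨⟨i, hi ▸ odd_two_mul_add_one n⟩, ?_⟩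
  have : F.deg i / 2 = n := by omega
  subst this
  rfl

/-- Links the monomials used for the tensor product with those defining the grading of Γ(X), so that
homogeneous monomials are seen to span. -/
theorem isMonomial_monomial (α : F.Exponent) : ∃ m,
    FreeGamma.IsMonomial R (fun n => ↥(F.space ⊓ 𝒜 n)) m
      ((FreeGamma.equivTensor R _).symm (F.monomial F.evenGen F.oddGen α)) := by
  classical
  have h1 : ∀ l : List {i // Odd (F.deg i)}, ∃ m,
      FreeGamma.IsMonomial R (fun n => ↥(F.space ⊓ 𝒜 n)) m ((FreeGamma.equivTensor R _).symm
        (1 ⊗ₜ[R] (l.map fun i => ExteriorAlgebra.ι R (F.oddGen i)).prod)) := by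
    intro l
    induction l with
    | nil => exact ⟨0, .one⟩
    | cons i l ih =>
      obtain ⟨m, hm⟩ := ih
      have := FreeGamma.IsMonomial.odd_mul (F.deg i / 2) m
        ⟨F.gen i, F.gen_mem_space i (Nat.two_mul_div_two_add_one_of_odd i.2).symm⟩ _ hm
      rw [FreeGamma.odd_mul_tmul] at this
      exact ⟨_, this⟩
  have h2 : ∀ (k : {i // Even (F.deg i)} → ℕ) (s : Finset {i // Even (F.deg i)})
      (v : ExteriorAlgebra R (⨁ n, ↥(F.space ⊓ 𝒜 (2 * n + 1)))),
      (∃ m, FreeGamma.IsMonomial R (fun n => ↥(F.space ⊓ 𝒜 n)) m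
        ((FreeGamma.equivTensor R _).symm (1 ⊗ₜ[R] v))) →
      ∃ m, FreeGamma.IsMonomial R (fun n => ↥(F.space ⊓ 𝒜 n)) m ((FreeGamma.equivTensor R _).symm
        ((∏ i ∈ s, DividedPowerAlgebra.dp R (k i) (F.evenGen i)) ⊗ₜ[R] v)) := by
    intro k s v hv
    induction s using Finset.induction_on with
    | empty => simpa using hv
    | insert i s hi ih =>
      obtain ⟨m, hm⟩ := ih
      have := FreeGamma.IsMonomial.dp_mul (k i) (F.deg i / 2) m
        ⟨F.gen i, F.gen_mem_space i (Nat.two_mul_div_two_of_even i.2).symm⟩ _ hm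
      rw [FreeGamma.dp_mul_tmul] at this
      rw [Finset.prod_insert hi]
      exact ⟨_, this⟩
  exact h2 _ _ _ (h1 _)

theorem equivTensor_symm_evenGen (i : {i // Even (F.deg i)}) :
    (FreeGamma.equivTensor R fun n => ↥(F.space ⊓ 𝒜 n)).symm
      (DividedPowerAlgebra.dp R 1 (F.evenGen i) ⊗ₜ[R] 1) = FreeGamma.dp R 1 (F.deg i / 2)
        ⟨F.gen i, F.gen_mem_space i (Nat.two_mul_div_two_of_even i.2).symm⟩ :=
  rfl

theorem equivTensor_symm_oddGen (i : {i // Odd (F.deg i)}) :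
    (FreeGamma.equivTensor R fun n => ↥(F.space ⊓ 𝒜 n)).symm
      (1 ⊗ₜ[R] ExteriorAlgebra.ι R (F.oddGen i)) = FreeGamma.odd R (F.deg i / 2)
        ⟨F.gen i, F.gen_mem_space i (Nat.two_mul_div_two_add_one_of_odd i.2).symm⟩ :=
  rfl

/-- Once the canonical algebra map is bijective and graded, the divided powers of Γ(X) are those of
A carried back along it, which makes it a Γ-morphism at once. They have the prescribed values on
generators because the map takes formal divided powers to actual ones. -/
theorem exists_freeGamma_equiv [IsDomain R] [CharZero R] [Module.IsTorsionFree R A]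
    (G : GammaAlgebra 𝒜)
    (hgen : ∀ a, ∃ m : R, m ≠ 0 ∧ m • a ∈ Algebra.adjoin R (Set.range F.gen)) :
    ∃ (Γ : FreeGamma.Gamma R (fun n => ↥(F.space ⊓ 𝒜 n)))
      (e : FreeGamma R (fun n => ↥(F.space ⊓ 𝒜 n)) ≃ₐ[R] A),
      (∀ n, (FreeGamma.grading R (fun n => ↥(F.space ⊓ 𝒜 n)) n).map e.toLinearMap = 𝒜 n) ∧
      IsGammaMorphism Γ.toGammaAlgebra G e ∧
      (∀ n (x : ↥(F.space ⊓ 𝒜 (2 * n))), e (FreeGamma.dp R 1 n x) = x) ∧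
      ∀ n (x : ↥(F.space ⊓ 𝒜 (2 * n + 1))), e (FreeGamma.odd R n x) = x := by
  have := isAddTorsionFree_of_isTorsionFree R A
  obtain ⟨e₀, hdp, hodd⟩ := exists_freeGamma_hom G F.isPositive_space
  have hdp1 : ∀ n (x : ↥(F.space ⊓ 𝒜 (2 * n))), e₀ (FreeGamma.dp R 1 n x) = x := fun n x => by
    simpa using hdp n x 1
  have h₀ : ∀ i, (e₀.comp (FreeGamma.equivTensor R _).symm.toAlgHom)
      (DividedPowerAlgebra.dp R 1 (F.evenGen i) ⊗ₜ[R] 1) = F.gen i := fun i =>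
    (congrArg e₀ (F.equivTensor_symm_evenGen i)).trans (hdp1 _ _)
  have h₁ : ∀ i, (e₀.comp (FreeGamma.equivTensor R _).symm.toAlgHom)
      (1 ⊗ₜ[R] ExteriorAlgebra.ι R (F.oddGen i)) = F.gen i := fun i =>
    (congrArg e₀ (F.equivTensor_symm_oddGen i)).trans (hodd _ _)
  have hbij : Function.Bijective e₀ :=
    (F.presentation_bijective G.commutative hgen F.span_evenGen F.span_oddGen _ h₀ h₁).comp
      (FreeGamma.equivTensor R _).bijective
  have hmap := freeGamma_map_grading G F.isPositive_space hdp hodd hbij.2 (by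
    rw [eq_top_iff]
    refine le_trans (F.span_monomial F.span_evenGen F.span_oddGen).ge (Submodule.span_mono ?_)
    rintro _ ⟨α, rfl⟩
    exact F.isMonomial_monomial α)
  let e := AlgEquiv.ofBijective e₀ hbij
  have hmem : ∀ n b, b ∈ FreeGamma.grading R (fun n => ↥(F.space ⊓ 𝒜 n)) n ↔ e b ∈ 𝒜 n := by
    intro n b
    rw [← hmap n]
    constructor
    · exact fun h => ⟨b, h, rfl⟩
    · rintro ⟨c, hc, hcb⟩
      rwa [← e.injective hcb]
  refine ⟨{ G.transport e hmem with
    γ_generator := fun k n hn x => ?_ }, e, hmap, ?_, hdp1, hodd⟩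
  · change e.symm (G.γ k (e₀ (FreeGamma.dp R 1 n x))) = FreeGamma.dp R k n x
    rw [hdp1, ← freeGamma_hom_dp G hdp hn x k]
    exact e.symm_apply_apply _
  · intro k n hn a ha
    exact e.apply_symm_apply _

end DualFamily

/-! ### The universal enveloping algebra of the primitive elements of the dual -/

section UEADual

variable {R : Type*} [CommRing R] {A : Type*} [Ring A] [Algebra R A] [Coalgebra R A]
variable {𝒜 : ℕ → Submodule R A} [GradedAlgebra 𝒜] [GradedHopfAlgebra 𝒜]

/-- The morphism of algebras `U P(A) → A` that extends the inclusion of the primitive elements. -/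
def primLift (𝒜 : ℕ → Submodule R A) [GradedAlgebra 𝒜] [GradedHopfAlgebra 𝒜] :
    UEA (primGrading 𝒜) →ₐ[R] A :=
  UEA.lift (primitives R A).subtype fun _ _ _ hx _ hy =>
    (gradedCommutator_apply (𝒜 := 𝒜) hx hy).symm

theorem primLift_ι (x : primitives R A) : primLift 𝒜 (UEA.ι (primGrading 𝒜) x) = x :=
  UEA.lift_ι _ _ x

theorem primLift_mem {n : ℕ} {u : UEA (primGrading 𝒜)} (hu : u ∈ UEA.grading (primGrading 𝒜) n) :
    primLift 𝒜 u ∈ 𝒜 n := by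
  have hmon : ∀ n u, UEA.IsMonomial (primGrading 𝒜) n u → primLift 𝒜 u ∈ 𝒜 n := by
    intro n u hu
    induction hu with
    | one => rw [map_one]; exact SetLike.one_mem_graded 𝒜
    | ι_mul i n x m hx _ ih =>
      rw [map_mul, primLift_ι]
      exact SetLike.mul_mem_graded hx ih
  have : UEA.grading (primGrading 𝒜) n ≤ (𝒜 n).comap (primLift 𝒜).toLinearMap :=
    Submodule.span_le.2 (hmon n)
  exact this hu

/-- Compatibility with the projections lets an injective lift also reflect degrees. -/
theorem primLift_proj (n : ℕ) (u : UEA (primGrading 𝒜)) :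
    primLift 𝒜 (proj (UEA.grading (primGrading 𝒜)) n u) = proj 𝒜 n (primLift 𝒜 u) := by
  induction u using hom_induction (UEA.grading (primGrading 𝒜)) with
  | zero => simp
  | add y z hy hz => simp only [map_add, hy, hz]
  | hom k y hy =>
    by_cases h : k = n
    · subst h
      rw [proj_same hy, proj_same (primLift_mem hy)]
    · rw [proj_ne hy h, proj_ne (primLift_mem hy) h, map_zero]

/-- Applying ε ⊗ ε to Δx = x ⊗ 1 + 1 ⊗ x gives ε(x) = 2ε(x). -/
theorem counit_of_mem_primitives (𝒜 : ℕ → Submodule R A) [GradedAlgebra 𝒜] [GradedHopfAlgebra 𝒜]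
    {x : A} (hx : x ∈ primitives R A) : Coalgebra.counit (R := R) x = 0 := by
  have h := congrArg (fun t => Coalgebra.counit (R := R) (TensorProduct.lid R A
    (LinearMap.rTensor A (Coalgebra.counit (R := R)) t))) (mem_primitives.1 hx)
  simp only [Coalgebra.rTensor_counit_comul, map_add, LinearMap.rTensor_tmul,
    TensorProduct.lid_tmul, map_smul, GradedHopfAlgebra.counit_one (𝒜 := 𝒜), smul_eq_mul, mul_one,
    one_mul] at h
  simpa using h

theorem counit_primLift (u : UEA (primGrading 𝒜)) :
    Coalgebra.counit (R := R) (primLift 𝒜 u) = Coalgebra.counit (R := R) u := by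
  induction u using UEA.induction with
  | one =>
    rw [map_one, GradedHopfAlgebra.counit_one (𝒜 := 𝒜),
      GradedHopfAlgebra.counit_one (𝒜 := UEA.grading (primGrading 𝒜))]
  | add u v hu hv => rw [map_add, map_add, map_add, hu, hv]
  | smul r u hu => rw [map_smul, map_smul, map_smul, hu]
  | ι_mul i x hx u hu =>
    rw [map_mul, GradedHopfAlgebra.counit_mul (𝒜 := 𝒜),
      GradedHopfAlgebra.counit_mul (𝒜 := UEA.grading (primGrading 𝒜)), primLift_ι, UEA.counit_ι,
      counit_of_mem_primitives 𝒜 x.2, zero_mul, zero_mul]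

/-- Both diagonals are multiplicative and agree on L. The induction multiplies by one element of L
on the left, and the Koszul signs match because the lift preserves degrees. -/
theorem comul_primLift (u : UEA (primGrading 𝒜)) :
    Coalgebra.comul (R := R) (primLift 𝒜 u) =
      TensorProduct.map (primLift 𝒜).toLinearMap (primLift 𝒜).toLinearMap
        (Coalgebra.comul (R := R) u) := by
  induction u using UEA.induction with
  | one => simp [UEA.comul_one, GradedHopfAlgebra.comul_one (𝒜 := 𝒜)]
  | add u v hu hv => rw [map_add, map_add, map_add, map_add, hu, hv]
  | smul r u hu => rw [map_smul, map_smul, map_smul, map_smul, hu]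
  | ι_mul i x hx u hu =>
    apply (GradedTensorProduct.of R 𝒜 𝒜).injective
    rw [map_mul, primLift_ι, GradedHopfAlgebra.comul_mul, hu, mem_primitives.1 x.2,
      UEA.comul_ι_mul hx]
    have hx' : (x : A) ∈ 𝒜 i := hx
    have h1 : (1 : A) ∈ 𝒜 0 := SetLike.one_mem_graded 𝒜
    generalize Coalgebra.comul (R := R) u = t
    induction t using tensor_hom_induction (UEA.grading (primGrading 𝒜)) with
    | zero => simp
    | add s t hs ht => simp only [map_add, mul_add] at hs ht ⊢; rw [hs, ht]
    | tmul j k a ha b hb =>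
      simp only [UEA.leftPrim, LinearMap.add_apply, TensorProduct.map_tmul, map_add, add_mul,
        degScale_of_mem _ ha, LinearMap.mulLeft_apply, LinearMap.id_apply, AlgHom.toLinearMap_apply,
        map_mul, primLift_ι, map_smul]
      rw [of_tmul_mul_of_tmul _ _ h1 (primLift_mem ha),
        of_tmul_mul_of_tmul _ _ hx' (primLift_mem ha),
        zero_mul, pow_zero, one_smul, one_mul, one_mul, ← TensorProduct.smul_tmul', map_smul]

end UEADual

/-! ### Bases of A and of its dual, and bijectivity of UP(A♯) → A♯. -/

namespace DualFamily

variable {R : Type*} [CommRing R] {A : Type*} [Ring A] [Algebra R A]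
variable {𝒜 : ℕ → Submodule R A} [GradedAlgebra 𝒜] [Coalgebra R A] [GradedHopfAlgebra 𝒜]
variable {ι : Type*} (F : DualFamily 𝒜 ι)

/-- The divided monomials in the generators span the algebra. -/
theorem exists_span_eq_top [DecidableEq ι] [IsDomain R] [CharZero R] [Module.IsTorsionFree R A]
    (G : GammaAlgebra 𝒜)
    (hgen : ∀ a, ∃ m : R, m ≠ 0 ∧ m • a ∈ Algebra.adjoin R (Set.range F.gen)) :
    ∃ v : F.Exponent → A, (∀ α, wordWeight α.toWord • v α = F.word α.toWord) ∧
      Submodule.span R (Set.range v) = ⊤ := by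
  obtain ⟨-, e, -, -, hdp, hodd⟩ := F.exists_freeGamma_equiv G hgen
  let e' := (FreeGamma.equivTensor R _).symm.trans e
  refine ⟨fun α => e' (F.monomial F.evenGen F.oddGen α),
    F.wordWeight_smul_monomial e'.toAlgHom
      (fun i => (congrArg e (F.equivTensor_symm_evenGen i)).trans (hdp _ _))
      (fun i => (congrArg e (F.equivTensor_symm_oddGen i)).trans (hodd _ _)), ?_⟩
  have h := congrArg (Submodule.map e'.toLinearMap) (F.span_monomial F.span_evenGen F.span_oddGen)
  rw [Submodule.map_span, Submodule.map_top, LinearMap.range_eq_top.2 e'.surjective,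
    ← Set.range_comp] at h
  exact h

/-- Letters have positive degree, so the total degree bounds both the length of a word and the
degree of each letter. This leaves finitely many words, and a word determines its exponents. -/
theorem finite_setOf_degree_lt (hfin : ∀ N, {i | F.deg i < N}.Finite) (N : ℕ) :
    {α : F.Exponent | (α.toWord.map F.deg).sum < N}.Finite := by
  classical
  have := (hfin N).to_subtype
  have h := (List.finite_length_lt {i | F.deg i < N} N).image (List.map Subtype.val)
  refine Set.Finite.of_finite_image (f := Exponent.toWord) (h.subset ?_) ?_
  · rintro _ ⟨α, hα, rfl⟩
    have hα : (α.toWord.map F.deg).sum < N := hα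
    generalize α.toWord = l at hα
    have hmem : ∀ i ∈ l, F.deg i < N := fun i hi =>
      (List.le_sum_of_mem (List.mem_map_of_mem hi)).trans_lt hα
    have hlen : l.length ≤ (l.map F.deg).sum := by
      clear hα hmem
      induction l with
      | nil => simp
      | cons i l ih =>
        have := F.deg_pos i
        simp only [List.length_cons, List.map_cons, List.sum_cons]
        omega
    refine ⟨l.pmap Subtype.mk hmem, ?_, ?_⟩
    · rw [Set.mem_ofPred_eq, List.length_pmap]
      exact hlen.trans_lt hα
    · simp [List.map_pmap]
  · intro α _ β _ h
    exact F.eq_of_toWord_perm (by rw [h])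

variable [∀ n, Module.Finite R (𝒜 n)] [∀ n, Module.Free R (𝒜 n)]

/-- The forms of a dual family as primitive elements. -/
def prim (i : ι) : primitives R (GradedDual 𝒜) :=
  ⟨F.form i, GradedDual.mem_primitives_iff_isDerivation.2 (F.isDerivation i)⟩

theorem span_prim
    (hprim : ∀ f : GradedDual 𝒜, f.IsDerivation → f ∈ Submodule.span R (Set.range F.form)) :
    Submodule.span R (Set.range F.prim) = ⊤ := by
  refine Submodule.map_injective_of_injective (primitives R (GradedDual 𝒜)).injective_subtype ?_
  rw [Submodule.map_span, ← Set.range_comp, Submodule.map_subtype_top]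
  refine le_antisymm (Submodule.span_le.2 ?_) fun f hf => ?_
  · rintro _ ⟨i, rfl⟩
    exact (F.prim i).2
  · exact hprim f (GradedDual.mem_primitives_iff_isDerivation.1 hf)

/-- Straightening in the enveloping algebra: graded commutators of generators are brackets, hence
combinations of the spanning primitives. For odd x the relation says 2x² = [x, x], so with 2
invertible x² is such a combination too. -/
theorem span_uea_words (h2 : IsUnit (2 : R))
    (hprim : ∀ f : GradedDual 𝒜, f.IsDerivation → f ∈ Submodule.span R (Set.range F.form)) :
    Submodule.span R (Set.range fun α : F.Exponent =>
      (α.toWord.map fun i => UEA.ι (primGrading (GradedDual.grading 𝒜)) (F.prim i)).prod) = ⊤ := by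
  classical
  set ℒ := primGrading (GradedDual.grading 𝒜)
  have hV : Submodule.span R (Set.range fun i => UEA.ι ℒ (F.prim i)) =
      LinearMap.range (UEA.ι ℒ) := by
    rw [LinearMap.range_eq_map, ← F.span_prim hprim, Submodule.map_span, ← Set.range_comp]
    rfl
  have hmem : ∀ i, F.prim i ∈ ℒ (F.deg i) := fun i => F.form_mem i
  have hcomm : ∀ i j, UEA.ι ℒ (F.prim i) * UEA.ι ℒ (F.prim j) - (-1 : R) ^ (F.deg i * F.deg j) •
      (UEA.ι ℒ (F.prim j) * UEA.ι ℒ (F.prim i)) ∈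
        Submodule.span R (Set.range fun i => UEA.ι ℒ (F.prim i)) := fun i j => by
    rw [← UEA.ι_bracket (hmem i) (hmem j), hV]
    exact ⟨_, rfl⟩
  have h := span_words_eq_top (R := R) (g := fun i => UEA.ι ℒ (F.prim i))
    (c := fun i j => (-1 : R) ^ (F.deg i * F.deg j)) (odd := fun i => Odd (F.deg i))
    (𝓛 := Set.range fun α : F.Exponent => α.toWord) hcomm
    (fun i hi => by
      have h1 := hcomm i i
      rw [(hi.mul hi).neg_one_pow, neg_one_smul, sub_neg_eq_add, ← two_smul R] at h1
      obtain ⟨c, hc⟩ := h2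
      rw [← hc] at h1
      exact (Submodule.smul_mem_iff_of_isUnit _ c.isUnit).1 h1)
    (by
      rw [eq_top_iff]
      rintro u -
      induction u using UEA.induction with
      | one => exact one_mem _
      | add u v hu hv => exact add_mem hu hv
      | smul r u hu => exact Subalgebra.smul_mem _ hu r
      | ι_mul i x hx u hu =>
        refine mul_mem ?_ hu
        have : UEA.ι ℒ x ∈ Submodule.span R (Set.range fun i => UEA.ι ℒ (F.prim i)) := by
          rw [hV]
          exact ⟨_, rfl⟩
        exact Algebra.span_le_adjoin R _ this)
    (fun l hl => by
      obtain ⟨α, hα⟩ := F.exists_perm_toWord l hl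
      exact ⟨_, ⟨α, rfl⟩, hα⟩)
  rwa [← Set.range_comp] at h

/-- The lift carries the spanning words of UP(A♯) to the words in the forms. These are independent
by triangularity, and they span A♯ because a form is determined on the divided monomials, of which
only those of bounded degree matter. -/
theorem primLift_bijective [DecidableEq ι] [IsDomain R] [CharZero R] [Module.IsTorsionFree R A]
    (G : GammaAlgebra 𝒜) (h2 : IsUnit (2 : R))
    (hgen : ∀ a, ∃ m : R, m ≠ 0 ∧ m • a ∈ Algebra.adjoin R (Set.range F.gen))
    (hprim : ∀ f : GradedDual 𝒜, f.IsDerivation → f ∈ Submodule.span R (Set.range F.form))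
    (hfin : ∀ N, {i | F.deg i < N}.Finite) :
    Function.Bijective (primLift (GradedDual.grading 𝒜)) := by
  obtain ⟨v, hv, hspan⟩ := F.exists_span_eq_top G hgen
  have hU := F.isUnitriangular G.commutative hv
  have hword : ∀ l : List ι, primLift (GradedDual.grading 𝒜)
      (l.map fun i => UEA.ι (primGrading (GradedDual.grading 𝒜)) (F.prim i)).prod =
        F.formWord l := fun l => by
    rw [map_list_prod, List.map_map, formWord]
    congr 2
    funext i
    exact primLift_ι (F.prim i)
  constructor
  · have hli : LinearIndependent R fun α : F.Exponent => F.formWord α.toWord :=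
      LinearIndependent.of_comp (GradedDual.toDual 𝒜) hU.linearIndependent_dual
    rw [injective_iff_map_eq_zero]
    intro u hu
    have hu' := (F.span_uea_words h2 hprim).ge (Submodule.mem_top : u ∈ ⊤)
    rw [Finsupp.mem_span_range_iff_exists_finsupp] at hu'
    obtain ⟨c, rfl⟩ := hu'
    have : c = 0 := linearIndependent_iff.1 hli c (by
      rw [← hu, Finsupp.linearCombination_apply, Finsupp.sum, Finsupp.sum, map_sum]
      simp only [map_smul, hword])
    rw [this, Finsupp.sum_zero_index]
  · intro g
    obtain ⟨N, hN⟩ := g.2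
    -- A nonzero multiple of `v α` is a homogeneous word, and torsion-freeness lets the projection
    -- be compared after multiplying by the weight.
    have hvmem : ∀ α : F.Exponent, v α ∈ 𝒜 (α.toWord.map F.deg).sum := by
      intro α
      have := isAddTorsionFree_of_isTorsionFree R A
      have h1 : proj 𝒜 (α.toWord.map F.deg).sum (v α) = v α := by
        refine nsmul_right_injective (wordWeight_ne_zero α.toWord) ?_
        change _ • _ = _ • _
        rw [← map_nsmul, hv, proj_same (F.word_mem _)]
      rw [← h1]
      exact proj_mem _ _
    -- T collects the exponents of degree below the bound N for g. Form words and divided monomials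
    -- of different degrees pair to 0, which gives the separation condition on T.
    let T := (F.finite_setOf_degree_lt hfin N).toFinset
    have hT : ∀ α, α ∈ T ↔ (α.toWord.map F.deg).sum < N := fun α => Set.Finite.mem_toFinset _
    obtain ⟨g', hg', h⟩ := hU.exists_mem_span_eq T
      (fun α hα β hβ => F.formWord_mem α.toWord _ (by rw [hT] at hα hβ; omega) _ (hvmem β))
      (GradedDual.toDual 𝒜 g)
      (fun β hβ => hN _ (by rw [hT] at hβ; omega) _ (hvmem β))
    have h3 : GradedDual.toDual 𝒜 g = g' := by
      refine LinearMap.ext_on hspan ?_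
      rintro _ ⟨β, rfl⟩
      exact h β
    have h4 : Submodule.span R ((fun α : F.Exponent => GradedDual.toDual 𝒜 (F.formWord α.toWord)) ''
        T) ≤ (LinearMap.range (primLift (GradedDual.grading 𝒜)).toLinearMap).map
          (GradedDual.toDual 𝒜) := by
      refine Submodule.span_le.2 ?_
      rintro _ ⟨α, -, rfl⟩
      exact ⟨_, ⟨_, hword α.toWord⟩, rfl⟩
    obtain ⟨g'', ⟨u, hu⟩, h5⟩ := h4 hg'
    refine ⟨u, GradedDual.ext fun x => ?_⟩
    rw [h3, ← h5, ← hu]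
    rfl

end DualFamily

/-- The inclusion of the primitive elements of the dual extends to an isomorphism of graded Hopf
algebras. -/
theorem exists_uea_equiv {R : Type*} [CommRing R] {A : Type*} [Ring A] [Algebra R A]
    [Coalgebra R A] {𝒜 : ℕ → Submodule R A} [GradedAlgebra 𝒜] [GradedHopfAlgebra 𝒜]
    (hbij : Function.Bijective (primLift 𝒜)) :
    ∃ e : UEA (primGrading 𝒜) ≃ₐc[R] A,
      (∀ x : primitives R A, e (UEA.ι (primGrading 𝒜) x) = x) ∧
      ∀ n, ∀ u, u ∈ UEA.grading (primGrading 𝒜) n ↔ e u ∈ 𝒜 n := by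
  let e : UEA (primGrading 𝒜) ≃ₐc[R] A :=
    { AlgEquiv.ofBijective (primLift 𝒜) hbij with
      map_smul' := map_smul (primLift 𝒜)
      counit_comp := LinearMap.ext counit_primLift
      map_comp_comul := LinearMap.ext fun u => (comul_primLift u).symm }
  refine ⟨e, primLift_ι, fun n u => ⟨primLift_mem, fun hu => ?_⟩⟩
  · have hu : primLift 𝒜 u ∈ 𝒜 n := hu
    -- The image of u equals its own degree n component, so by injectivity u does as well.
    have h := primLift_proj n u
    rw [proj_same hu] at h
    rw [← hbij.1 h]
    exact proj_mem n u

end GammaHopf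

end

/-! ### The theorem. -/

theorem mainTheorem8 (p : ℕ) (hp : p.Prime) (hp2 : p ≠ 2)
    {R : Type*} [CommRing R] [(Ideal.span {(p : ℤ)}).IsPrime]
    [IsLocalization.AtPrime R (Ideal.span {(p : ℤ)})]
    {A : Type*} [Ring A] [Algebra R A] [Coalgebra R A]
    (𝒜 : ℕ → Submodule R A) [GradedAlgebra 𝒜] [GammaHopf.GradedHopfAlgebra 𝒜]
    [∀ n, Module.Finite R (𝒜 n)] [∀ n, Module.Free R (𝒜 n)]
    (G : GammaHopf.GammaHopfAlgebra 𝒜) :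
    (∃ X : Submodule R A,
      (∀ n, ∀ x ∈ X, GammaHopf.proj 𝒜 n x ∈ X) ∧
      (∀ x ∈ X, Coalgebra.counit (R := R) x = 0) ∧
      ∃ (Γ : GammaHopf.FreeGamma.Gamma R (fun n => ↥(X ⊓ 𝒜 n)))
        (e : GammaHopf.FreeGamma R (fun n => ↥(X ⊓ 𝒜 n)) ≃ₐ[R] A),
        (∀ n, (GammaHopf.FreeGamma.grading R (fun n => ↥(X ⊓ 𝒜 n)) n).map e.toLinearMap = 𝒜 n) ∧
        GammaHopf.IsGammaMorphism Γ.toGammaAlgebra G.toGammaAlgebra e ∧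
        (∀ n (x : ↥(X ⊓ 𝒜 (2 * n))), e (GammaHopf.FreeGamma.dp R 1 n x) = x) ∧
        (∀ n (x : ↥(X ⊓ 𝒜 (2 * n + 1))), e (GammaHopf.FreeGamma.odd R n x) = x)) ∧
    (∃ e : GammaHopf.UEA (GammaHopf.primGrading (GammaHopf.GradedDual.grading 𝒜)) ≃ₐc[R]
        GammaHopf.GradedDual 𝒜,
      (∀ x : GammaHopf.primitives R (GammaHopf.GradedDual 𝒜),
        e (GammaHopf.UEA.ι (GammaHopf.primGrading (GammaHopf.GradedDual.grading 𝒜)) x) = x) ∧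
      (∀ n, ∀ u, u ∈ GammaHopf.UEA.grading
          (GammaHopf.primGrading (GammaHopf.GradedDual.grading 𝒜)) n ↔
        e u ∈ GammaHopf.GradedDual.grading 𝒜 n)) := by
  have := IsLocalization.isDomain_of_atPrime R (Ideal.span {(p : ℤ)})
  have := GammaHopf.isPrincipalIdealRing_of_isLocalization (R := R)
    (Ideal.span {(p : ℤ)}).primeCompl
  have := GammaHopf.charZero_of_localization p R
  have := GammaHopf.isTorsionFree_of_components (R := R) (𝒜 := 𝒜)
  obtain ⟨κ, F, hdeg, hgen, hprim⟩ := GammaHopf.exists_dualFamily (𝒜 := 𝒜) G.connected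
  refine ⟨⟨F.space, fun n x hx => F.proj_mem_space n hx, fun x hx => F.counit_space hx,
    F.exists_freeGamma_equiv G.toGammaAlgebra hgen⟩, ?_⟩
  refine GammaHopf.exists_uea_equiv (F.primLift_bijective G.toGammaAlgebra
    (GammaHopf.isUnit_two_of_localization p R hp hp2) hgen hprim fun N => ?_)
  -- Each degree carries finitely many generators, so there are finitely many below any bound.
  have : {i : Σ n, Fin (κ n) | F.deg i < N} ⊆
      ((Finset.range N).sigma fun n => (Finset.univ : Finset (Fin (κ n)))) := fun i hi => by
    have hi : F.deg i < N := hi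
    rw [hdeg] at hi
    simpa using hi
  exact (Finset.finite_toSet _).subset this
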